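/- **Setting (martingale decision making).** Let $d\ge 1$. One observes inputs $u_t\in\mathbb R^{d_u}$, covariates $z_t\in\mathbb R^{d}$ and responses $$y_t=\langle\theta,z_t\rangle+w_t,\qquad w_t\mid\mathcal F_{t-1}\sim\mathcal N(0,\sigma_w^2),\qquad u_t,z_t\ \text{are}\ \mathcal F_{t-1}\text{-measurable},\quad y_t\ \text{is}\ \mathcal F_t\text{-measurable},$$ with law $P_\theta$ and expectation $\mathbb E_\theta$ under the model $\theta\in\mathbb R^d$; $\tau=(u_t,z_t,y_t)_{t\le T}$ is the trajectory, and the exploration policy satisfies $\mathbb E_\theta[\sum_{t\le T}\|u_t\|^2]\le T\gamma^2$. Put $\Sigma_T=\sum_{t\le T}z_tz_t^\top$ and $\Gamma_T(\theta)=\frac1T\mathbb E_\theta[\Sigma_T]$ (second moments are assumed finite wherever $\Gamma_T$ is used). For losses $J_\theta:\mathbb R^{d_a}\to\mathbb R$ let $R(a;\theta)=J_\theta(a)-\inf_{a'}J_\theta(a')$, let $a_{\rm opt}(\theta)$ be a minimizer of $J_\theta$, and let $\mathcal H=\nabla^2_\theta R(a_{\rm opt}(\theta);\theta_\star)|_{\theta=\theta_\star}$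 and $\Phi_T=\mathrm{tr}(\mathcal H\,\Gamma_T(\theta_\star)^{-1})$. **Smooth loss.** There are $r>0$, $\mu>0$, $L_{R1},L_{R2},L_{R3},L_{a1},L_{a2},L_{a3},L_{\rm hess}$ such that for all $\theta,a$ with $\|\theta-\theta_\star\|\le r$ and $\|a-a_{\rm opt}(\theta_\star)\|\le L_{a1}r$: $R(a';\theta)\ge\frac\mu2\|a'-a_{\rm opt}(\theta)\|^2$ for all $a'\in\mathbb R^{d_a}$; $R(\cdot;\theta)$ and $a_{\rm opt}$ are three times differentiable at $a$ and at $\theta$; $\|\nabla_a^iR(a;\theta)\|_{\rm op}\le L_{Ri}$ $(i=1,2,3)$; $\|\nabla^i a_{\rm opt}(\theta)\|_{\rm op}\le L_{ai}$ $(i=1,2)$ and $\|\nabla^3a_{\rm opt}(\theta)[v,v,v]\|\le L_{a3}$ for unit $v$; and $\nabla_a^2R(a;\cdot)$ is $L_{\rm hess}$-Lipschitz on the ball $\|\theta-\theta_\star\|\le r$. Put $L_{\rm quad}=\frac16(L_{R3}L_{a1}^3+3L_{R2}L_{a2}L_{a1}+L_{R1}L_{a3})$. There are universal constants $c_1,c_2,c_3,c_4>0$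 such that the following two statements hold for every such problem and every horizon $T$. **1. Upper bound for certainty equivalence.** Let $\delta\in(0,1/2)$, $\underline\lambda,C_{\rm con},\alpha>0$, $\bar\Gamma_T\succeq0$, and suppose that under $\theta_\star$ * for every $T\ge T_{\rm se}$, with probability at least $1-\delta/4$: $\lambda_{\min}(\Sigma_T)\ge\underline\lambda T$ and $\Sigma_T\preceq T\bar\Gamma_T$; * for every $T\ge T_{\rm con}$, with probability at least $1-\delta/4$: $\|\Sigma_T-\mathbb E_{\theta_\star}\Sigma_T\|_{\rm op}\le C_{\rm con}T^{-\alpha}\lambda_{\min}(\mathbb E_{\theta_\star}\Sigma_T)$. Let $D=\log\frac1\delta+d+\log\det(\bar\Gamma_T/\underline\lambda+I)$ and let $\hat\theta_{\rm ls}$ be any minimizer of $\sum_{t\le T}(y_t-\langle\theta,z_t\rangle)^2$. If $T>\max\{T_{\rm con},T_{\rm se},(4C_{\rm con})^{1/\alpha},\,c_1\sigma_w^2D/(\underline\lambda r^2)\}$, then with probability at least $1-\delta$ under $\theta_\star$ $$R(a_{\rm opt}(\hat\theta_{\rm ls});\theta_\star)\le5\sigma_w^2\log\tfrac{24d}{\delta}\cdot\frac{\Phi_T}{T}+\frac{c_2L_{\rm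 quad}\,\sigma_w^3D^{3/2}}{\underline\lambda^{3/2}\,T^{3/2}}+\frac{c_3\sigma_w^2C_{\rm con}^2\,d\,\mathrm{tr}(\mathcal H)\log\frac d\delta}{\underline\lambda\,T^{1+2\alpha}} .$$ **2. Lower bound for every decision rule.** Suppose that the conditional law of $(u_t,z_t)$ given the past trajectory does not depend on $\theta$ (the model acts on the trajectory only through the responses $y_t$), and that for some $\underline\lambda,r_{\rm cov},L_{\rm cov},C_{\rm cov},c_{\rm cov},\alpha>0$ one has $\lambda_{\min}(\Gamma_T(\theta_\star))\ge\underline\lambda$ and, whenever $\|\theta-\theta_\star\|\le r_{\rm cov}$, $$\Gamma_T(\theta)\preceq c_{\rm cov}\Gamma_T(\theta_\star)+\big(L_{\rm cov}\|\theta-\theta_\star\|+C_{\rm cov}T^{-\alpha}\big)I .$$ If $$\underline\lambda T\ge\max\Big\{\big(\tfrac{80d}{r^2}\big)^{6/5},\big(\tfrac{\sigma_w^2L_{R2}}{5\mu}\big)^{6},\big(\tfrac{8L_{\rm cov}\sqrt{5d}}{\underline\lambda}\big)^{12/5},\big(\tfrac{8C_{\rm cov}}{\underline\lambda^{1-\alpha}}\big)^{1/\alpha},\big(\tfrac{5d}{r_{\rm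 cov}^2}\big)^{6/5}\Big\},$$ then with $\mathcal B_T=\{\theta:\|\theta-\theta_\star\|^2\le5d/(\underline\lambda T)^{5/6}\}$ the local minimax risk satisfies $$\inf_{\mathsf{dec}}\ \sup_{\theta\in\mathcal B_T}\mathbb E_\theta\big[R(\mathsf{dec}(\tau);\theta)\big]\ \ge\ \frac{\sigma_w^2}{1+2c_{\rm cov}}\cdot\frac{\Phi_T}{T}-\frac{C_{\rm lb}}{(\underline\lambda T)^{5/4}},$$ the infimum being over all measurable maps from trajectories to decisions, where $$C_{\rm lb}=c_4\Big((L_{a1}L_{a2}L_{R2}+L_{a1}^3L_{R3}+L_{a1}^2L_{\rm hess})\,d^{3/2}+d\,\sigma_w^5L_{a1}^2L_{R2}\,(L_{R2}/\mu)^{3/2}\Big).$$ -/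

import Mathlib

open MeasureTheory ProbabilityTheory
open scoped NNReal ENNReal

noncomputable section

namespace MDM

/-- Euclidean space `ℝⁿ` with the 2-norm. -/
abbrev Vec (n : ℕ) : Type := EuclideanSpace ℝ (Fin n)

/-! ### Linear algebra -/

/-- The smallest eigenvalue of a symmetric matrix, as the minimum of the Rayleigh quotient
over the unit sphere. -/
def lamMin {d : ℕ} (M : Matrix (Fin d) (Fin d) ℝ) : ℝ :=
  ⨅ x : Metric.sphere (0 : Vec d) 1,
    inner ℝ (x : Vec d) (Matrix.toEuclideanCLM (𝕜 := ℝ) M (x : Vec d))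

/-- The operator norm of a matrix for the Euclidean norm. -/
def opNorm {d : ℕ} (M : Matrix (Fin d) (Fin d) ℝ) : ℝ :=
  ‖Matrix.toEuclideanCLM (n := Fin d) (𝕜 := ℝ) M‖

/-- The Loewner order `A ⪯ B`. -/
def LoewnerLE {d : ℕ} (A B : Matrix (Fin d) (Fin d) ℝ) : Prop := (B - A).PosSemidef

/-! ### The decision problem -/

section Decision

variable {d dₐ : ℕ}

/-- The excess risk `R(a; θ) = J_θ(a) - inf_{a'} J_θ(a')`. -/
def excessRisk (J : Vec d → Vec dₐ → ℝ) (a : Vec dₐ) (θ : Vec d) : ℝ :=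
  J θ a - ⨅ a', J θ a'

/-- `f` is three times differentiable at `x`: it is twice continuously differentiable near `x`
and its second derivative is differentiable at `x`. -/
def ThriceDifferentiableAt {E F : Type*} [NormedAddCommGroup E] [NormedSpace ℝ E]
    [NormedAddCommGroup F] [NormedSpace ℝ F] (f : E → F) (x : E) : Prop :=
  ContDiffAt ℝ 2 f x ∧ DifferentiableAt ℝ (iteratedFDeriv ℝ 2 f) x

/-- The constants of smooth decision making: the radius `r`, the growth constant `μ`, the bounds
`LR i`, `La i` on the derivatives of order `i` of the excess risk in the decision and of the
optimal decision in the model, and the Lipschitz constant `Lhess` of the Hessian of the risk. -/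
structure SmoothConstants where
  r : ℝ
  μ : ℝ
  LR1 : ℝ
  LR2 : ℝ
  LR3 : ℝ
  La1 : ℝ
  La2 : ℝ
  La3 : ℝ
  Lhess : ℝ

/-- The constant of the cubic error in the quadratic approximation of the risk. -/
def SmoothConstants.Lquad (S : SmoothConstants) : ℝ :=
  (S.LR3 * S.La1 ^ 3 + 3 * S.LR2 * S.La2 * S.La1 + S.LR1 * S.La3) / 6

/-- Smooth decision making around the model `θ₀`, for the loss `J` and the plug-in optimal
decision `aopt`. -/
structure SmoothDecision (J : Vec d → Vec dₐ → ℝ) (aopt : Vec d → Vec dₐ) (θ₀ : Vec d)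
    (S : SmoothConstants) : Prop where
  r_pos : 0 < S.r
  μ_pos : 0 < S.μ
  /-- `aopt θ` minimizes the loss `J_θ`. -/
  optimal : ∀ θ, ‖θ - θ₀‖ ≤ S.r → ∀ a, J θ (aopt θ) ≤ J θ a
  /-- Quadratic growth over all decisions; it makes the minimizer unique. -/
  growth : ∀ θ, ‖θ - θ₀‖ ≤ S.r → ∀ a, S.μ / 2 * ‖a - aopt θ‖ ^ 2 ≤ excessRisk J a θ
  risk_diff : ∀ θ a, ‖θ - θ₀‖ ≤ S.r → ‖a - aopt θ₀‖ ≤ S.La1 * S.r →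
    ThriceDifferentiableAt (fun a' => excessRisk J a' θ) a
  risk_bound₁ : ∀ θ a, ‖θ - θ₀‖ ≤ S.r → ‖a - aopt θ₀‖ ≤ S.La1 * S.r →
    ‖iteratedFDeriv ℝ 1 (fun a' => excessRisk J a' θ) a‖ ≤ S.LR1
  risk_bound₂ : ∀ θ a, ‖θ - θ₀‖ ≤ S.r → ‖a - aopt θ₀‖ ≤ S.La1 * S.r →
    ‖iteratedFDeriv ℝ 2 (fun a' => excessRisk J a' θ) a‖ ≤ S.LR2
  risk_bound₃ : ∀ θ a, ‖θ - θ₀‖ ≤ S.r → ‖a - aopt θ₀‖ ≤ S.La1 * S.r →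
    ‖iteratedFDeriv ℝ 3 (fun a' => excessRisk J a' θ) a‖ ≤ S.LR3
  opt_diff : ∀ θ, ‖θ - θ₀‖ ≤ S.r → ThriceDifferentiableAt aopt θ
  opt_bound₁ : ∀ θ, ‖θ - θ₀‖ ≤ S.r → ‖iteratedFDeriv ℝ 1 aopt θ‖ ≤ S.La1
  opt_bound₂ : ∀ θ, ‖θ - θ₀‖ ≤ S.r → ‖iteratedFDeriv ℝ 2 aopt θ‖ ≤ S.La2
  opt_bound₃ : ∀ θ, ‖θ - θ₀‖ ≤ S.r → ∀ v : Vec d, ‖v‖ = 1 →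
    ‖iteratedFDeriv ℝ 3 aopt θ (fun _ => v)‖ ≤ S.La3
  hess_lipschitz : ∀ θ θ' a, ‖θ - θ₀‖ ≤ S.r → ‖θ' - θ₀‖ ≤ S.r → ‖a - aopt θ₀‖ ≤ S.La1 * S.r →
    ‖iteratedFDeriv ℝ 2 (fun a' => excessRisk J a' θ) a
      - iteratedFDeriv ℝ 2 (fun a' => excessRisk J a' θ') a‖ ≤ S.Lhess * ‖θ - θ'‖

/-- The model-task Hessian: the Hessian at `θ = θ₀` of `θ ↦ R(aopt(θ); θ₀)`. -/
def taskHessian (J : Vec d → Vec dₐ → ℝ) (aopt : Vec d → Vec dₐ) (θ₀ : Vec d) :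
    Matrix (Fin d) (Fin d) ℝ :=
  Matrix.of fun i j => iteratedFDeriv ℝ 2 (fun θ => excessRisk J (aopt θ) θ₀) θ₀
    ![EuclideanSpace.single i 1, EuclideanSpace.single j 1]

end Decision

/-! ### Martingale observations -/

section Observations

variable {Ω : Type*} [mΩ : MeasurableSpace Ω] {d dᵤ : ℕ}

/-- A trajectory `(u_t, z_t, y_t)` of length `T`: inputs, covariates and responses. -/
abbrev Traj (d dᵤ T : ℕ) : Type := Fin T → Vec dᵤ × Vec d × ℝ

/-- Inputs `u`, covariates `z` and scalar responses `y`, adapted to a filtration. Time is counted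
from `0`: the input and the covariate of step `t` are known before the noise of step `t` is drawn,
i.e. are measurable for `ℱ t`, and the response of step `t` is measurable for `ℱ (t + 1)`. -/
structure Observations (Ω : Type*) [mΩ : MeasurableSpace Ω] (d dᵤ : ℕ) where
  ℱ : Filtration ℕ mΩ
  u : ℕ → Ω → Vec dᵤ
  z : ℕ → Ω → Vec d
  y : ℕ → Ω → ℝ
  u_meas : ∀ t, Measurable[ℱ t] (u t)
  z_meas : ∀ t, Measurable[ℱ t] (z t)
  y_meas : ∀ t, Measurable[ℱ (t + 1)] (y t)

namespace Observations

variable (X : Observations Ω d dᵤ)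

/-- The noise `w_t = y_t - ⟨θ, z_t⟩` under the model `θ`. -/
def noise (θ : Vec d) (t : ℕ) (ω : Ω) : ℝ := X.y t ω - inner ℝ θ (X.z t ω)

/-- The trajectory of the first `T` steps. -/
def traj (T : ℕ) (ω : Ω) : Traj d dᵤ T := fun t => (X.u t ω, X.z t ω, X.y t ω)

/-- `P` is a law of the observations under the model `θ`: one has `y_t = ⟨θ, z_t⟩ + w_t`, where,
conditionally on `ℱ t`, the noise `w_t` has the law `N(0, σ²)`. -/
structure IsLaw (σ : ℝ≥0) (θ : Vec d) (P : Measure Ω) : Prop where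
  prob : IsProbabilityMeasure P
  noise_law : ∀ t, P.map (X.noise θ t) = gaussianReal 0 (σ ^ 2)
  noise_indep : ∀ t, Indep (X.ℱ t) (MeasurableSpace.comap (X.noise θ t) inferInstance) P

/-- The exploration policy and the mechanism that produces the covariates do not know the model:
there is, at each step, a conditional law of the next input and covariate given the past
trajectory that is the same for all `θ`. -/
def SameExploration (P : Vec d → Measure Ω) : Prop :=
  ∀ t : ℕ, ∃ κ : Kernel (Traj d dᵤ t) (Vec dᵤ × Vec d), IsMarkovKernel κ ∧
    ∀ θ, (P θ).map (fun ω => (X.traj t ω, (X.u t ω, X.z t ω))) = ((P θ).map (X.traj t)) ⊗ₘ κ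

/-- The power constraint `E[∑_{t < T} ‖u_t‖²] ≤ T γ²`. -/
def PowerBound (P : Measure Ω) (T : ℕ) (γ : ℝ) : Prop :=
  ∫⁻ ω, ENNReal.ofReal (∑ t ∈ Finset.range T, ‖X.u t ω‖ ^ 2) ∂P ≤ ENNReal.ofReal (T * γ ^ 2)

/-- The random covariance `Σ_T = ∑_{t < T} z_t z_tᵀ`. -/
def cov (T : ℕ) (ω : Ω) : Matrix (Fin d) (Fin d) ℝ :=
  Matrix.of fun i j => ∑ t ∈ Finset.range T, X.z t ω i * X.z t ω j

/-- The expected covariance `E[Σ_T]`. -/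
def meanCov (P : Measure Ω) (T : ℕ) : Matrix (Fin d) (Fin d) ℝ :=
  Matrix.of fun i j => ∫ ω, X.cov T ω i j ∂P

/-- The average expected covariance `Γ_T = E[Σ_T] / T`. -/
def Gam (P : Measure Ω) (T : ℕ) : Matrix (Fin d) (Fin d) ℝ := (T : ℝ)⁻¹ • X.meanCov P T

/-- The idealized risk `Φ_T = tr(H Γ_T⁻¹)`. -/
def idealRisk (H : Matrix (Fin d) (Fin d) ℝ) (P : Measure Ω) (T : ℕ) : ℝ :=
  (H * (X.Gam P T)⁻¹).trace

/-- Regularity of the exploration policy for the upper bound, with failure probability `ε`: for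
every horizon `T ≥ Tse` the covariates are sufficiently excited with probability at least `1 - ε`,
and for every horizon `T ≥ Tcon` they have concentrated around their mean with probability at
least `1 - ε`. The second moments are finite, so that the mean exists. -/
structure PolicyRegular (P : Measure Ω) (ε lam : ℝ) (Gbar : ℕ → Matrix (Fin d) (Fin d) ℝ)
    (Tse Tcon Ccon α : ℝ) : Prop where
  lam_pos : 0 < lam
  Gbar_psd : ∀ T, (Gbar T).PosSemidef
  Ccon_pos : 0 < Ccon
  α_pos : 0 < α
  square_integrable : ∀ t, MemLp (X.z t) 2 P
  excited : ∀ T : ℕ, Tse ≤ T →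
    P {ω | ¬ (lam * T ≤ lamMin (X.cov T ω) ∧ LoewnerLE (X.cov T ω) ((T : ℝ) • Gbar T))}
      ≤ ENNReal.ofReal ε
  concentrated : ∀ T : ℕ, Tcon ≤ T →
    P {ω | ¬ (opNorm (X.cov T ω - X.meanCov P T)
        ≤ Ccon / (T : ℝ) ^ α * lamMin (X.meanCov P T))} ≤ ENNReal.ofReal ε

/-- Sufficient excitation and smooth response of the covariance at the horizon `T`, the regularity
of the exploration policy for the lower bound. -/
structure SmoothResponse (P : Vec d → Measure Ω) (θ₀ : Vec d) (T : ℕ)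
    (lam rcov Lcov Ccov ccov α : ℝ) : Prop where
  lam_pos : 0 < lam
  rcov_pos : 0 < rcov
  Lcov_pos : 0 < Lcov
  Ccov_pos : 0 < Ccov
  ccov_pos : 0 < ccov
  α_pos : 0 < α
  square_integrable : ∀ θ, ‖θ - θ₀‖ ≤ rcov → ∀ t < T, MemLp (X.z t) 2 (P θ)
  excited : lam ≤ lamMin (X.Gam (P θ₀) T)
  response : ∀ θ, ‖θ - θ₀‖ ≤ rcov →
    LoewnerLE (X.Gam (P θ) T)
      (ccov • X.Gam (P θ₀) T + (Lcov * ‖θ - θ₀‖ + Ccov / (T : ℝ) ^ α) • 1)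

/-- The local minimax risk over the set `B` of models: the infimum over the measurable decision
rules of the worst expected excess risk. -/
def minimaxRisk {dₐ : ℕ} (P : Vec d → Measure Ω) (J : Vec d → Vec dₐ → ℝ) (T : ℕ)
    (B : Set (Vec d)) : ℝ≥0∞ :=
  ⨅ (dec : Traj d dᵤ T → Vec dₐ) (_ : Measurable dec),
    ⨆ θ ∈ B, ∫⁻ ω, ENNReal.ofReal (excessRisk J (dec (X.traj T ω)) θ) ∂(P θ)

end Observations

/-- `θhat` is a least-squares estimator: on every trajectory it minimizes
`∑_t (y_t - ⟨θ, z_t⟩)²`. -/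
def IsLeastSquares {T : ℕ} (θhat : Traj d dᵤ T → Vec d) : Prop :=
  ∀ (τ : Traj d dᵤ T) (θ : Vec d),
    ∑ t, ((τ t).2.2 - inner ℝ (θhat τ) (τ t).2.1) ^ 2
      ≤ ∑ t, ((τ t).2.2 - inner ℝ θ (τ t).2.1) ^ 2

end Observations

/-- The complexity `log(1/δ) + d + log det(Γ̄/λ + I)`. -/
def logComplexity {d : ℕ} (δ lam : ℝ) (Gbar : Matrix (Fin d) (Fin d) ℝ) : ℝ :=
  Real.log (1 / δ) + d + Real.log (lam⁻¹ • Gbar + 1).det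

/-- The constant of the lower-order term of the lower bound, up to a universal factor. -/
def lowerConst (d : ℕ) (σ : ℝ) (S : SmoothConstants) : ℝ :=
  (S.La1 * S.La2 * S.LR2 + S.La1 ^ 3 * S.LR3 + S.La1 ^ 2 * S.Lhess) * (d : ℝ) ^ (3 / 2 : ℝ)
    + d * σ ^ 5 * S.La1 ^ 2 * S.LR2 * (S.LR2 / S.μ) ^ (3 / 2 : ℝ)

end MDM

end

namespace MDM

/-! ### Gaussian noise conditionally on the past -/

section Noise

variable {Ω : Type*} [mΩ : MeasurableSpace Ω] {d dᵤ : ℕ} {X : Observations Ω d dᵤ}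
  {σ : ℝ≥0} {θ : Vec d} {P : Measure Ω}

/-! Upper bound. The gradient of the risk vanishes at the optimal decision, so the risk of the
plug-in decision is at most half the quadratic form of `H` at the estimation error `D` plus a cubic
remainder (`excessRisk_plugin_le`). The normal equations say that Σ_T D = ∑ w_t z_t. With E the mean
of Σ_T, concentration allows E⁻¹ Σ_T D to replace D at a relative cost of order T^{-α}
(`inner_op_le_plugin`). If H = ∑ k_i k_iᵀ, the relevant coordinates of the substitute are
martingales in the deterministic directions E⁻¹ k_i, with quadratic variation at most 5/4 · k_iᵀ E⁻¹
k_i on the good event. The exponential martingale gives them Gaussian tails (`tail_direction`), and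
the variances add up to tr(H E⁻¹) = Φ_T / T. The remainders need only ‖D‖, which is bounded by
averaging the exponential martingale over a Gaussian direction after whitening by E
(`tail_whitened`). As E is deterministic, no self-normalised inequality is required, and the
log-determinant in the statement is mere nonnegative slack.

Lower bound. This is a Bayesian argument of van Trees type, with prior density proportional to
max(0, ρ² - ‖η‖²)³ for the model `θ₀ + η`. Since the exploration does not know the model,
trajectories have an explicit Gaussian likelihood ratio (`lintegral_traj_eq`). A decision far from
`aopt θ₀` pays more than the claimed bound by quadratic growth (`le_excessRisk_far`). For a near one
the risk is, up to order ρ³, at least the quadratic loss of estimating A η, where A is the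
derivative of `aopt` (`le_excessRisk_near`). Integrating by parts in η against likelihood times
prior, in the directions given by G = s⁻¹ A Γ⁻¹, produces the constant s⁻¹ tr(H Γ⁻¹); Young's
inequality bounds the same integral by the quadratic loss plus half a second moment of the score
(`ofReal_integral_score_le`). That moment splits orthogonally into the information of the data,
controlled by the smooth response of the covariance, and the information of the prior, of order d /
ρ². The radius keeps the latter below a quarter of T / σ² times Γ, unless lam * T < (3σ)^12; there
the subtracted term exceeds the leading one and nothing is left to prove. -/

lemma lintegral_exp_gaussianReal (v : ℝ≥0) (a : ℝ) :
    ∫⁻ w, ENNReal.ofReal (Real.exp (a * w - v / 2 * a ^ 2)) ∂(gaussianReal 0 v) = 1 := by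
  have hint : Integrable (fun w => Real.exp (a * w - v / 2 * a ^ 2)) (gaussianReal 0 v) := by
    simp_rw [Real.exp_sub]
    exact (integrable_exp_mul_gaussianReal a).div_const _
  rw [← ofReal_integral_eq_lintegral_ofReal hint (ae_of_all _ fun _ => (Real.exp_pos _).le)]
  have h := congrFun (mgf_fun_id_gaussianReal (μ := 0) (v := v)) a
  simp only [mgf] at h
  simp_rw [Real.exp_sub, integral_div, h]
  rw [← Real.exp_sub]
  simp [show (v : ℝ) * a ^ 2 / 2 - v / 2 * a ^ 2 = 0 by ring]

lemma lintegral_sq_gaussianReal (v : ℝ≥0) (a b : ℝ) :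
    ∫⁻ w, ENNReal.ofReal ((a + b * w) ^ 2) ∂(gaussianReal 0 v)
      = ENNReal.ofReal (a ^ 2) + ENNReal.ofReal (v * b ^ 2) := by
  have hm2 : MemLp (fun w : ℝ => w) 2 (gaussianReal 0 v) := memLp_id_gaussianReal 2
  have hi1 : Integrable (fun w : ℝ => w) (gaussianReal 0 v) := hm2.integrable (by norm_num)
  have hi2 : Integrable (fun w : ℝ => w ^ 2) (gaussianReal 0 v) := hm2.integrable_sq
  have hs : ∫ w, w ^ 2 ∂(gaussianReal 0 v) = v := by
    have h := variance_eq_sub hm2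
    rw [variance_fun_id_gaussianReal, integral_id_gaussianReal] at h
    simpa using h.symm
  have he : (fun w : ℝ => (a + b * w) ^ 2)
      = fun w => a ^ 2 + (2 * a * b * w + b ^ 2 * w ^ 2) := by
    ext w; ring
  have hi3 : Integrable (fun w : ℝ => 2 * a * b * w + b ^ 2 * w ^ 2) (gaussianReal 0 v) :=
    (hi1.const_mul (2 * a * b)).add (hi2.const_mul (b ^ 2))
  rw [← ENNReal.ofReal_add (by positivity) (by positivity),
    ← ofReal_integral_eq_lintegral_ofReal _ (ae_of_all _ fun _ => sq_nonneg _)]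
  · congr 1
    rw [he, integral_add (integrable_const _) hi3,
      integral_add (hi1.const_mul _) (hi2.const_mul _), integral_const_mul, integral_const_mul, hs,
      integral_id_gaussianReal]
    simp; ring
  · rw [he]; exact (integrable_const _).add hi3

lemma Observations.measurable_z (X : Observations Ω d dᵤ) (t : ℕ) : Measurable (X.z t) :=
  (X.z_meas t).mono (X.ℱ.le t) le_rfl

lemma Observations.measurable_noise_succ (X : Observations Ω d dᵤ) (θ : Vec d) (t : ℕ) :
    Measurable[X.ℱ (t + 1)] (X.noise θ t) := by
  have hz : Measurable[X.ℱ (t + 1)] (X.z t) := (X.z_meas t).mono (X.ℱ.mono (Nat.le_succ t)) le_rfl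
  have hy := X.y_meas t
  unfold Observations.noise
  fun_prop

lemma Observations.measurable_noise (X : Observations Ω d dᵤ) (θ : Vec d) (t : ℕ) :
    Measurable (X.noise θ t) :=
  (X.measurable_noise_succ θ t).mono (X.ℱ.le _) le_rfl

lemma Observations.measurable_traj (X : Observations Ω d dᵤ) (t : ℕ) :
    Measurable[X.ℱ t] (X.traj t) := by
  refine @measurable_pi_lambda Ω (Fin t) _ (X.ℱ t) _ _ fun s => ?_
  have h : (s : ℕ) + 1 ≤ t := s.2
  have h' : (s : ℕ) ≤ t := s.2.le
  exact ((X.u_meas s).mono (X.ℱ.mono h') le_rfl).prodMk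
    (((X.z_meas s).mono (X.ℱ.mono h') le_rfl).prodMk ((X.y_meas s).mono (X.ℱ.mono h) le_rfl))

/-- Integration over the noise of step `t` conditionally on the past. -/
lemma Observations.IsLaw.lintegral_noise (h : X.IsLaw σ θ P) (t : ℕ) {β : Type*}
    [MeasurableSpace β] {Y : Ω → β} (hY : Measurable[X.ℱ t] Y) {F : β × ℝ → ℝ≥0∞}
    (hF : Measurable F) :
    ∫⁻ ω, F (Y ω, X.noise θ t ω) ∂P = ∫⁻ ω, ∫⁻ w, F (Y ω, w) ∂(gaussianReal 0 (σ ^ 2)) ∂P := by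
  have := h.prob
  have hY' : Measurable Y := hY.mono (X.ℱ.le t) le_rfl
  have hw := X.measurable_noise θ t
  have hind : IndepFun Y (X.noise θ t) P := by
    rw [IndepFun_iff_Indep]
    exact indep_of_indep_of_le_left (h.noise_indep t) hY.comap_le
  have hmap := (indepFun_iff_map_prod_eq_prod_map_map hY'.aemeasurable hw.aemeasurable).1 hind
  rw [h.noise_law t] at hmap
  rw [← lintegral_map (f := F) (g := fun ω => (Y ω, X.noise θ t ω)) hF (hY'.prodMk hw), hmap,
    lintegral_prod _ hF.aemeasurable,
    lintegral_map (f := fun b => ∫⁻ w, F (b, w) ∂(gaussianReal 0 (σ ^ 2)))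
      hF.lintegral_prod_right' hY']

lemma Observations.measurable_sum_noise (X : Observations Ω d dᵤ) (θ v : Vec d) (T : ℕ) :
    Measurable[X.ℱ T] fun ω => ∑ t ∈ Finset.range T, inner ℝ v (X.z t ω) * X.noise θ t ω := by
  refine Finset.measurable_sum _ fun t ht => ?_
  have ht := Finset.mem_range.1 ht
  have hz : Measurable[X.ℱ T] (X.z t) := (X.z_meas t).mono (X.ℱ.mono ht.le) le_rfl
  have hw : Measurable[X.ℱ T] (X.noise θ t) :=
    (X.measurable_noise_succ θ t).mono (X.ℱ.mono ht) le_rfl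
  fun_prop

lemma Observations.measurable_sum_sq (X : Observations Ω d dᵤ) (v : Vec d) (T : ℕ) :
    Measurable[X.ℱ T] fun ω => ∑ t ∈ Finset.range T, inner ℝ v (X.z t ω) ^ 2 := by
  refine Finset.measurable_sum _ fun t ht => ?_
  have hz : Measurable[X.ℱ T] (X.z t) :=
    (X.z_meas t).mono (X.ℱ.mono (Finset.mem_range.1 ht).le) le_rfl
  fun_prop

/-- The exponential martingale of the noise in the direction `v`. -/
lemma Observations.IsLaw.lintegral_exp (h : X.IsLaw σ θ P) (v : Vec d) (T : ℕ) :
    ∫⁻ ω, ENNReal.ofReal (Real.exp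
      (∑ t ∈ Finset.range T, inner ℝ v (X.z t ω) * X.noise θ t ω
        - σ ^ 2 / 2 * ∑ t ∈ Finset.range T, inner ℝ v (X.z t ω) ^ 2)) ∂P = 1 := by
  have := h.prob
  induction T with
  | zero => simp
  | succ T ih =>
    have hS := X.measurable_sum_noise θ v T
    have hQ := X.measurable_sum_sq v T
    have hz := X.z_meas T
    have hY : Measurable[X.ℱ T] fun ω =>
        (∑ t ∈ Finset.range T, inner ℝ v (X.z t ω) * X.noise θ t ω
          - σ ^ 2 / 2 * ∑ t ∈ Finset.range T, inner ℝ v (X.z t ω) ^ 2, inner ℝ v (X.z T ω)) :=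
      (hS.sub (hQ.const_mul _)).prodMk (by fun_prop)
    -- The past enters only through the exponent accumulated so far and ⟨v, z_T⟩; given these, the
    -- last factor integrates to 1.
    have key := h.lintegral_noise T hY
      (F := fun p => ENNReal.ofReal
        (Real.exp (p.1.1 + (p.1.2 * p.2 - ((σ ^ 2 : ℝ≥0) : ℝ) / 2 * p.1.2 ^ 2)))) (by fun_prop)
    simp only [Real.exp_add, ENNReal.ofReal_mul (Real.exp_pos _).le] at key
    simp_rw [lintegral_const_mul' _ _ ENNReal.ofReal_ne_top, lintegral_exp_gaussianReal,
      mul_one, ih] at key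
    rw [← key]
    refine lintegral_congr fun ω => ?_
    rw [← ENNReal.ofReal_mul (Real.exp_pos _).le, ← Real.exp_add, Finset.sum_range_succ,
      Finset.sum_range_succ]
    push_cast
    ring_nf

/-- Orthogonality of the martingale increments. -/
lemma Observations.IsLaw.lintegral_sq (h : X.IsLaw σ θ P) (v : Vec d) (c : ℝ) (T : ℕ) :
    ∫⁻ ω, ENNReal.ofReal
      ((c + ∑ t ∈ Finset.range T, inner ℝ v (X.z t ω) * X.noise θ t ω) ^ 2) ∂P
      = ENNReal.ofReal (c ^ 2) + ENNReal.ofReal (σ ^ 2) *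
        ∫⁻ ω, ENNReal.ofReal (∑ t ∈ Finset.range T, inner ℝ v (X.z t ω) ^ 2) ∂P := by
  have := h.prob
  induction T with
  | zero => simp
  | succ T ih =>
    have hS := X.measurable_sum_noise θ v T
    have hQ := X.measurable_sum_sq v T
    have hz := X.z_meas T
    have hY : Measurable[X.ℱ T] fun ω =>
        (c + ∑ t ∈ Finset.range T, inner ℝ v (X.z t ω) * X.noise θ t ω, inner ℝ v (X.z T ω)) :=
      (hS.const_add _).prodMk (by fun_prop)
    -- Given the past, the new increment is centred with variance σ²⟨v, z_T⟩², so no cross term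
    -- appears. Values in [0, ∞] make moment assumptions unnecessary.
    have key := h.lintegral_noise T hY
      (F := fun p => ENNReal.ofReal ((p.1.1 + p.1.2 * p.2) ^ 2)) (by fun_prop)
    simp only [Finset.sum_range_succ, ← add_assoc]
    rw [key]
    simp_rw [lintegral_sq_gaussianReal]
    have hz' := X.measurable_z T
    rw [lintegral_add_right _ (by fun_prop), ih, add_assoc, ← lintegral_const_mul' _ _ (by simp),
      ← lintegral_const_mul' _ _ (by simp), ← lintegral_add_right _ (by fun_prop)]
    congr 1
    refine lintegral_congr fun ω => ?_
    rw [ENNReal.ofReal_add (Finset.sum_nonneg fun _ _ => sq_nonneg _) (sq_nonneg _), mul_add,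
      ENNReal.ofReal_mul (by positivity)]
    simp

/-- The tail bounds divide by σ; this settles the degenerate case. -/
lemma Observations.IsLaw.noise_eq_zero (h : X.IsLaw 0 θ P) (t : ℕ) :
    ∀ᵐ ω ∂P, X.noise θ t ω = 0 := by
  have hw := X.measurable_noise θ t
  have h1 : ∀ᵐ w ∂(P.map (X.noise θ t)), w = 0 := by
    rw [h.noise_law t, zero_pow two_ne_zero, gaussianReal_zero_var]
    rw [ae_dirac_eq]; rfl
  exact ae_of_ae_map hw.aemeasurable h1

end Noise


/-! ### Matrices as operators and quadratic forms -/

section LinearAlgebra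

variable {d : ℕ} {M N : Matrix (Fin d) (Fin d) ℝ}

/-- The operator on Euclidean space of a matrix. -/
noncomputable abbrev op (M : Matrix (Fin d) (Fin d) ℝ) : Vec d →L[ℝ] Vec d :=
  Matrix.toEuclideanCLM (n := Fin d) (𝕜 := ℝ) M

lemma inner_op (M : Matrix (Fin d) (Fin d) ℝ) (x y : Vec d) :
    inner ℝ x (op M y) = ∑ i, ∑ j, M i j * (x i * y j) := by
  rw [Matrix.inner_toEuclideanCLM]
  simp only [dotProduct, Matrix.mulVec, Finset.mul_sum]
  exact Finset.sum_congr rfl fun i _ => Finset.sum_congr rfl fun j _ => by ring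

lemma inner_vec (x y : Vec d) : inner ℝ x y = ∑ i, x i * y i := by
  simp [PiLp.inner_apply, mul_comm]

lemma inner_op_conjTranspose (M : Matrix (Fin d) (Fin d) ℝ) (x y : Vec d) :
    inner ℝ x (op M.conjTranspose y) = inner ℝ (op M x) y := by
  rw [real_inner_comm y, inner_op, inner_op, Finset.sum_comm]
  refine Finset.sum_congr rfl fun i _ => Finset.sum_congr rfl fun j _ => ?_
  simp only [Matrix.conjTranspose_apply, star_trivial]
  ring

lemma inner_op_comm (hM : M.IsHermitian) (x y : Vec d) :
    inner ℝ x (op M y) = inner ℝ (op M x) y := by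
  rw [← inner_op_conjTranspose, hM]

lemma op_mul_apply (M N : Matrix (Fin d) (Fin d) ℝ) (x : Vec d) : op (M * N) x = op M (op N x) := by
  simp [op]

lemma op_sub_apply (M N : Matrix (Fin d) (Fin d) ℝ) (x : Vec d) :
    op (M - N) x = op M x - op N x := by
  simp [op]

lemma inner_op_nonneg (hM : M.PosSemidef) (x : Vec d) : 0 ≤ inner ℝ x (op M x) := by
  rw [Matrix.inner_toEuclideanCLM]
  simpa using hM.dotProduct_mulVec_nonneg x.ofLp

lemma inner_op_le_of_loewnerLE (h : LoewnerLE M N) (x : Vec d) :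
    inner ℝ x (op M x) ≤ inner ℝ x (op N x) := by
  have := inner_op_nonneg h x
  rw [op_sub_apply, inner_sub_right] at this
  linarith

lemma abs_inner_op_le (M : Matrix (Fin d) (Fin d) ℝ) (x : Vec d) :
    |inner ℝ x (op M x)| ≤ opNorm M * ‖x‖ ^ 2 := by
  have h1 := abs_real_inner_le_norm x (op M x)
  have h2 : ‖op M x‖ ≤ opNorm M * ‖x‖ := (op M).le_opNorm x
  nlinarith [norm_nonneg x]

lemma lamMin_mul_le (M : Matrix (Fin d) (Fin d) ℝ) (x : Vec d) :
    lamMin M * ‖x‖ ^ 2 ≤ inner ℝ x (op M x) := by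
  rcases eq_or_ne x 0 with rfl | hx
  · simp
  have hx' : 0 < ‖x‖ := norm_pos_iff.2 hx
  -- A real infimum means something only for a family bounded below.
  have hbdd : BddBelow (Set.range fun y : Metric.sphere (0 : Vec d) 1 =>
      inner ℝ (y : Vec d) (op M (y : Vec d))) := by
    refine ⟨-opNorm M, ?_⟩
    rintro _ ⟨y, rfl⟩
    have h1 := abs_inner_op_le M y
    have h2 : ‖(y : Vec d)‖ = 1 := by simp
    rw [h2] at h1
    have := neg_abs_le (inner ℝ (y : Vec d) (op M (y : Vec d)))
    simp only
    linarith
  have h := ciInf_le hbdd ⟨‖x‖⁻¹ • x, by simp [norm_smul, hx'.ne']⟩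
  simp only [map_smul, inner_smul_left, inner_smul_right] at h
  have h' : lamMin M ≤ ‖x‖⁻¹ * (‖x‖⁻¹ * inner ℝ x (op M x)) := by simpa [lamMin] using h
  calc lamMin M * ‖x‖ ^ 2 ≤ ‖x‖⁻¹ * (‖x‖⁻¹ * inner ℝ x (op M x)) * ‖x‖ ^ 2 := by gcongr
    _ = inner ℝ x (op M x) := by field_simp

/-- Serves to exclude a mean covariance with nonpositive smallest eigenvalue: concentration would
then force the random covariance to equal its mean. -/
lemma eq_of_opNorm_sub_nonpos (h : opNorm (M - N) ≤ 0) : M = N := by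
  have h0 : Matrix.toEuclideanCLM (n := Fin d) (𝕜 := ℝ) (M - N) = 0 := norm_le_zero_iff.1 h
  have := (map_eq_zero_iff _ (Matrix.toEuclideanCLM (n := Fin d) (𝕜 := ℝ)).injective).1 h0
  exact sub_eq_zero.1 this

lemma posDef_of_lamMin_pos (hM : M.IsHermitian) (h : 0 < lamMin M) : M.PosDef := by
  refine Matrix.PosDef.of_dotProduct_mulVec_pos hM fun x hx => ?_
  have h1 := lamMin_mul_le M (WithLp.toLp 2 x)
  rw [Matrix.inner_toEuclideanCLM] at h1
  have h2 : 0 < ‖WithLp.toLp 2 x‖ := norm_pos_iff.2 (by simpa using hx)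
  have h3 : 0 < lamMin M * ‖WithLp.toLp 2 x‖ ^ 2 := by positivity
  simpa using h3.trans_le h1

lemma op_op_inv (hM : M.PosDef) (x : Vec d) : op M (op M⁻¹ x) = x := by
  rw [← op_mul_apply, Matrix.mul_nonsing_inv _ hM.det_pos.ne'.isUnit]
  simp [op]

/-- A positive semidefinite matrix is a sum of rank-one terms `k kᵀ`. -/
lemma exists_rank_one_sum (hM : M.PosSemidef) : ∃ k : Fin d → Vec d,
    (∀ x y, inner ℝ x (op M y) = ∑ i, inner ℝ (k i) x * inner ℝ (k i) y) ∧
    ∀ N, (M * N).trace = ∑ i, inner ℝ (k i) (op N (k i)) := by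
  obtain ⟨K, rfl⟩ : ∃ K : Matrix (Fin d) (Fin d) ℝ, M = K.conjTranspose * K := by
    open scoped MatrixOrder in
    obtain ⟨K, hK⟩ := CStarAlgebra.nonneg_iff_eq_star_mul_self.mp hM.nonneg
    exact ⟨K, hK⟩
  refine ⟨fun i => WithLp.toLp 2 (K i), fun x y => ?_, fun N => ?_⟩
  · have h : ∀ z : Vec d, ∀ i, inner ℝ (WithLp.toLp 2 (K i) : Vec d) z = op K z i := by
      intro z i
      rw [inner_vec]; rfl
    simp_rw [h]
    rw [← inner_vec, op_mul_apply, inner_op_conjTranspose]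
  · rw [Matrix.mul_assoc, Matrix.trace_mul_comm, Matrix.trace]
    refine Finset.sum_congr rfl fun i _ => ?_
    rw [inner_op]
    simp only [Matrix.diag_apply, Matrix.mul_apply, Matrix.conjTranspose_apply, star_trivial,
      Finset.sum_mul]
    rw [Finset.sum_comm]
    exact Finset.sum_congr rfl fun _ _ => Finset.sum_congr rfl fun _ _ => by ring

lemma trace_eq_sum_norm_sq {k : Fin d → Vec d}
    (hk : ∀ N, (M * N).trace = ∑ i, inner ℝ (k i) (op N (k i))) :
    M.trace = ∑ i, ‖k i‖ ^ 2 := by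
  have := hk 1
  rw [Matrix.mul_one] at this
  rw [this]
  exact Finset.sum_congr rfl fun i _ => by simp [op]

/-- Whitening: coordinates in which a positive definite form is the Euclidean norm. -/
lemma exists_whitening (hM : M.PosDef) : ∃ W V : Vec d →L[ℝ] Vec d,
    (∀ g, inner ℝ (W g) (op M (W g)) = ‖g‖ ^ 2) ∧ ∀ x, W (V x) = x := by
  obtain ⟨K, rfl⟩ : ∃ K : Matrix (Fin d) (Fin d) ℝ, M = K.conjTranspose * K := by
    open scoped MatrixOrder in
    obtain ⟨K, hK⟩ := CStarAlgebra.nonneg_iff_eq_star_mul_self.mp hM.posSemidef.nonneg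
    exact ⟨K, hK⟩
  have hdet : IsUnit K.det := by
    have := hM.det_pos.ne'
    rw [Matrix.det_mul] at this
    exact (right_ne_zero_of_mul this).isUnit
  refine ⟨op K⁻¹, op K, fun g => ?_, fun x => ?_⟩
  · have h : op K (op K⁻¹ g) = g := by
      rw [← op_mul_apply, Matrix.mul_nonsing_inv _ hdet]; simp [op]
    rw [op_mul_apply, inner_op_conjTranspose, h, real_inner_self_eq_norm_sq]
  · rw [← op_mul_apply, Matrix.nonsing_inv_mul _ hdet]; simp [op]

/-- Every eigenvalue of M + 1 is at least 1. Hence the log-determinant in `logComplexity` is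
nonnegative and can be dropped. -/
lemma one_le_det_one_add (hM : M.PosSemidef) : 1 ≤ (M + 1).det := by
  have hH : (M + 1).IsHermitian := hM.isHermitian.add Matrix.isHermitian_one
  rw [hH.det_eq_prod_eigenvalues]
  have : ∀ i, 1 ≤ hH.eigenvalues i := by
    intro i
    have h := hH.mulVec_eigenvectorBasis i
    have h1 : op (M + 1) (hH.eigenvectorBasis i) = hH.eigenvalues i • hH.eigenvectorBasis i := by
      ext j; exact congrFun h j
    have h2 := inner_op_nonneg hM (hH.eigenvectorBasis i)
    have h3 : inner ℝ (hH.eigenvectorBasis i) (op (M + 1) (hH.eigenvectorBasis i))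
        = hH.eigenvalues i := by
      rw [h1, inner_smul_right, real_inner_self_eq_norm_sq, hH.eigenvectorBasis.orthonormal.1]
      simp
    have h4 : op (M + 1) (hH.eigenvectorBasis i)
        = op M (hH.eigenvectorBasis i) + hH.eigenvectorBasis i := by simp [op]
    rw [h4, inner_add_right, real_inner_self_eq_norm_sq, hH.eigenvectorBasis.orthonormal.1] at h3
    linarith
  have h := Finset.prod_le_prod (s := Finset.univ) (f := fun _ : Fin d => (1 : ℝ))
    (g := hH.eigenvalues) (fun _ _ => zero_le_one) fun i _ => this i
  simpa using h

end LinearAlgebra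

/-! ### The random covariance and its mean as quadratic forms -/

section Covariance

variable {Ω : Type*} [mΩ : MeasurableSpace Ω] {d dᵤ : ℕ} {X : Observations Ω d dᵤ}
  {P : Measure Ω} {T : ℕ}

lemma Observations.inner_op_cov (X : Observations Ω d dᵤ) (T : ℕ) (ω : Ω) (x y : Vec d) :
    inner ℝ x (op (X.cov T ω) y)
      = ∑ t ∈ Finset.range T, inner ℝ x (X.z t ω) * inner ℝ y (X.z t ω) := by
  simp_rw [inner_op, Observations.cov, Matrix.of_apply, inner_vec, Finset.sum_mul_sum,
    Finset.sum_mul]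
  rw [Finset.sum_comm' (t' := Finset.univ) (s' := fun _ => Finset.range T) (by simp)]
  refine Finset.sum_congr rfl fun i _ => ?_
  rw [Finset.sum_comm]
  exact Finset.sum_congr rfl fun _ _ => Finset.sum_congr rfl fun _ _ => by ring

lemma Observations.inner_op_cov_self (X : Observations Ω d dᵤ) (T : ℕ) (ω : Ω) (x : Vec d) :
    inner ℝ x (op (X.cov T ω) x) = ∑ t ∈ Finset.range T, inner ℝ x (X.z t ω) ^ 2 := by
  simp_rw [X.inner_op_cov, sq]

lemma Observations.isHermitian_meanCov (X : Observations Ω d dᵤ) (P : Measure Ω) (T : ℕ) :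
    (X.meanCov P T).IsHermitian := by
  ext i j
  simp [Observations.meanCov, Observations.cov, mul_comm]

lemma Observations.integrable_cov (hz : ∀ t < T, MemLp (X.z t) 2 P) (i j : Fin d) :
    Integrable (fun ω => X.cov T ω i j) P := by
  simp only [Observations.cov, Matrix.of_apply]
  refine integrable_finsetSum _ fun t ht => ?_
  have h := hz t (Finset.mem_range.1 ht)
  have hc : ∀ i, MemLp (fun ω => X.z t ω i) 2 P := fun i =>
    h.mono (by have := X.measurable_z t; fun_prop : Measurable fun ω => X.z t ω i).aestronglyMeasurable
      (ae_of_all _ fun ω => PiLp.norm_apply_le _ i)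
  exact (hc i).integrable_mul (hc j)

lemma Observations.inner_op_meanCov (hz : ∀ t < T, MemLp (X.z t) 2 P) (x : Vec d) :
    Integrable (fun ω => ∑ t ∈ Finset.range T, inner ℝ x (X.z t ω) ^ 2) P ∧
    inner ℝ x (op (X.meanCov P T) x)
      = ∫ ω, ∑ t ∈ Finset.range T, inner ℝ x (X.z t ω) ^ 2 ∂P := by
  have hi := Observations.integrable_cov hz
  simp_rw [← X.inner_op_cov_self, inner_op]
  have hi' : ∀ i j, Integrable (fun ω => X.cov T ω i j * (x i * x j)) P :=
    fun i j => (hi i j).mul_const _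
  refine ⟨integrable_finsetSum _ fun i _ => integrable_finsetSum _ fun j _ => hi' i j, ?_⟩
  rw [integral_finsetSum _ fun i _ => integrable_finsetSum _ fun j _ => hi' i j]
  refine Finset.sum_congr rfl fun i _ => ?_
  rw [integral_finsetSum _ fun j _ => hi' i j]
  refine Finset.sum_congr rfl fun j _ => ?_
  rw [integral_mul_const]
  rfl

end Covariance


/-! ### Calculus of the excess risk -/

section Taylor

/-- Integrate the one-sided bound on `g₂` twice by comparing derivatives. No third derivative is
needed, and applying this to -g gives Taylor bounds from below. -/
lemma le_taylor_two {g g₁ g₂ : ℝ → ℝ} {C : ℝ} (h₀ : ∀ s ∈ Set.Icc (0 : ℝ) 1, HasDerivAt g (g₁ s) s)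
    (h₁ : ∀ s ∈ Set.Icc (0 : ℝ) 1, HasDerivAt g₁ (g₂ s) s)
    (h₂ : ∀ s ∈ Set.Icc (0 : ℝ) 1, g₂ s ≤ g₂ 0 + C * s) :
    g 1 ≤ g 0 + g₁ 0 + g₂ 0 / 2 + C / 6 := by
  have hone : (1 : ℝ) ∈ Set.Icc (0 : ℝ) 1 := ⟨zero_le_one, le_rfl⟩
  have step₁ : ∀ s ∈ Set.Icc (0 : ℝ) 1, g₁ s ≤ g₁ 0 + g₂ 0 * s + C / 2 * s ^ 2 := by
    refine image_le_of_deriv_right_le_deriv_boundary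
      (fun s hs => (h₁ s hs).continuousAt.continuousWithinAt)
      (fun s hs => (h₁ s (Set.Ico_subset_Icc_self hs)).hasDerivWithinAt) (by simp)
      (by fun_prop) (B' := fun s => g₂ 0 + C * s) (fun s _ => ?_)
      (fun s hs => h₂ s (Set.Ico_subset_Icc_self hs))
    refine HasDerivAt.hasDerivWithinAt ?_
    have := (((hasDerivAt_id s).const_mul (g₂ 0)).const_add (g₁ 0)).add
      (((hasDerivAt_id s).pow 2).const_mul (C / 2))
    refine this.congr_deriv ?_
    simp; ring
  have step₀ : ∀ s ∈ Set.Icc (0 : ℝ) 1,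
      g s ≤ g 0 + g₁ 0 * s + g₂ 0 / 2 * s ^ 2 + C / 6 * s ^ 3 := by
    refine image_le_of_deriv_right_le_deriv_boundary
      (fun s hs => (h₀ s hs).continuousAt.continuousWithinAt)
      (fun s hs => (h₀ s (Set.Ico_subset_Icc_self hs)).hasDerivWithinAt) (by simp)
      (by fun_prop) (B' := fun s => g₁ 0 + g₂ 0 * s + C / 2 * s ^ 2) (fun s _ => ?_)
      (fun s hs => step₁ s (Set.Ico_subset_Icc_self hs))
    refine HasDerivAt.hasDerivWithinAt ?_
    have := ((((hasDerivAt_id s).const_mul (g₁ 0)).const_add (g 0)).add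
      (((hasDerivAt_id s).pow 2).const_mul (g₂ 0 / 2))).add
      (((hasDerivAt_id s).pow 3).const_mul (C / 6))
    refine this.congr_deriv ?_
    simp; ring
  have := step₀ 1 hone
  linarith

/-- If m < 0, the second derivative test makes 0 a local maximum as well as a minimum, so g is
constant near 0 and m = 0. -/
lemma nonneg_of_hasDerivAt_two {g g₁ : ℝ → ℝ} {m : ℝ} (h₀ : ∀ᶠ s in nhds 0, HasDerivAt g (g₁ s) s)
    (h₁ : HasDerivAt g₁ m 0) (hmin : ∀ s, g 0 ≤ g s) : 0 ≤ m := by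
  by_contra! hm
  have hg₁ : g₁ 0 = 0 :=
    IsLocalMin.hasDerivAt_eq_zero (Filter.Eventually.of_forall hmin) h₀.self_of_nhds
  have hder : deriv (fun s => -g s) =ᶠ[nhds 0] fun s => -g₁ s := by
    filter_upwards [h₀] with s hs using hs.neg.deriv
  have h2 : 0 < deriv (deriv fun s => -g s) 0 := by
    rw [hder.deriv_eq, h₁.fun_neg.deriv]; linarith
  have hmax := isLocalMin_of_deriv_deriv_pos h2 (by rw [hder.self_of_nhds]; simp [hg₁])
    h₀.self_of_nhds.neg.continuousAt
  have hconst : g =ᶠ[nhds 0] fun _ => g 0 := by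
    filter_upwards [hmax] with s hs
    exact le_antisymm (by simpa using hs) (hmin s)
  have hz : g₁ =ᶠ[nhds 0] fun _ => 0 := by
    filter_upwards [h₀, hconst.eventuallyEq_nhds] with s hs hc
    rw [← hs.deriv, hc.deriv_eq]; simp
  have := hz.deriv_eq
  rw [h₁.deriv] at this
  simp at this
  linarith

end Taylor

/-! ### Iterated derivatives and restriction to lines -/

section Higher

set_option maxSynthPendingDepth 3

variable {E F : Type*} [NormedAddCommGroup E] [NormedSpace ℝ E]
    [NormedAddCommGroup F] [NormedSpace ℝ F] {f : E → F} {x : E}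

lemma norm_fderiv_fderiv (f : E → F) (x : E) :
    ‖fderiv ℝ (fderiv ℝ f) x‖ = ‖iteratedFDeriv ℝ 2 f x‖ := by
  rw [← norm_iteratedFDeriv_fderiv, norm_iteratedFDeriv_one]

lemma norm_fderiv_fderiv_fderiv (f : E → F) (x : E) :
    ‖fderiv ℝ (fderiv ℝ (fderiv ℝ f)) x‖ = ‖iteratedFDeriv ℝ 3 f x‖ := by
  rw [← norm_iteratedFDeriv_fderiv, norm_fderiv_fderiv]

lemma ThriceDifferentiableAt.differentiableAt (h : ThriceDifferentiableAt f x) :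
    DifferentiableAt ℝ f x :=
  h.1.differentiableAt (by norm_num)

lemma ThriceDifferentiableAt.differentiableAt_fderiv (h : ThriceDifferentiableAt f x) :
    DifferentiableAt ℝ (fderiv ℝ f) x :=
  (h.1.fderiv_right (m := 1) (by norm_num)).differentiableAt (by norm_num)

/-- The multilinear and the nested second derivative differ by currying isometries, which preserve
differentiability. -/
lemma ThriceDifferentiableAt.differentiableAt_fderiv_fderiv (h : ThriceDifferentiableAt f x) :
    DifferentiableAt ℝ (fderiv ℝ (fderiv ℝ f)) x := by
  have h2 := h.2
  have e₂ : iteratedFDeriv ℝ 2 f = _ := funext fun x => iteratedFDeriv_succ_eq_comp_right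
  have e₁ : iteratedFDeriv ℝ 1 (fderiv ℝ f) = _ :=
    funext fun x => iteratedFDeriv_succ_eq_comp_right
  rw [e₂] at h2
  replace h2 := (LinearIsometryEquiv.comp_differentiableAt_iff _).1 h2
  rw [e₁] at h2
  replace h2 := (LinearIsometryEquiv.comp_differentiableAt_iff _).1 h2
  rw [iteratedFDeriv_zero_eq_comp] at h2
  exact (LinearIsometryEquiv.comp_differentiableAt_iff _).1 h2

lemma hasDerivAt_iteratedFDeriv_line {n : ℕ} {v : E} {s : ℝ}
    (h : DifferentiableAt ℝ (iteratedFDeriv ℝ n f) (x + s • v)) :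
    HasDerivAt (fun s : ℝ => iteratedFDeriv ℝ n f (x + s • v) fun _ => v)
      (iteratedFDeriv ℝ (n + 1) f (x + s • v) fun _ => v) s := by
  have hl : HasDerivAt (fun s : ℝ => x + s • v) v s := by
    simpa using ((hasDerivAt_id s).smul_const v).const_add x
  have h1 := h.hasFDerivAt.comp_hasDerivAt s hl
  have h2 := (ContinuousMultilinearMap.apply ℝ (fun _ : Fin n => E) F
    (fun _ => v)).hasFDerivAt.comp_hasDerivAt s h1
  refine h2.congr_deriv ?_
  rw [iteratedFDeriv_succ_apply_left]
  rfl

lemma norm_iteratedFDeriv_line_le {n : ℕ} (v : E) :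
    ‖iteratedFDeriv ℝ n f x fun _ => v‖ ≤ ‖iteratedFDeriv ℝ n f x‖ * ‖v‖ ^ n := by
  simpa using (iteratedFDeriv ℝ n f x).le_opNorm fun _ => v

/-- On each line through a, subtracting the quadratic c/2 ‖v‖² s² leaves a function minimal at s =
0, whose second derivative there is nonnegative. -/
lemma le_fderiv_fderiv_of_growth {f : E → ℝ} {a : E} {c : ℝ} (hf : ThriceDifferentiableAt f a)
    (hg : ∀ x, f a + c / 2 * ‖x - a‖ ^ 2 ≤ f x) (v : E) :
    c * ‖v‖ ^ 2 ≤ fderiv ℝ (fderiv ℝ f) a v v := by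
  have hl : ∀ s : ℝ, HasDerivAt (fun s : ℝ => a + s • v) v s := fun s => by
    simpa using ((hasDerivAt_id s).smul_const v).const_add a
  have hev : ∀ᶠ s : ℝ in nhds 0, DifferentiableAt ℝ f (a + s • v) := by
    have h1 := (hf.1.eventually (by simp)).mono fun x (hx : ContDiffAt ℝ 2 _ x) =>
      hx.differentiableAt (by norm_num)
    have h2 : Filter.Tendsto (fun s : ℝ => a + s • v) (nhds 0) (nhds a) := by
      simpa using (hl 0).continuousAt.tendsto
    exact h2.eventually h1
  have key := nonneg_of_hasDerivAt_two
    (g := fun s => f (a + s • v) - c / 2 * ‖v‖ ^ 2 * s ^ 2)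
    (g₁ := fun s => fderiv ℝ f (a + s • v) v - c * ‖v‖ ^ 2 * s)
    (m := fderiv ℝ (fderiv ℝ f) a v v - c * ‖v‖ ^ 2) ?_ ?_ ?_
  · linarith
  · filter_upwards [hev] with s hs
    refine ((hs.hasFDerivAt.comp_hasDerivAt s (hl s)).sub
      (((hasDerivAt_id s).pow 2).const_mul (c / 2 * ‖v‖ ^ 2))).congr_deriv ?_
    simp; ring
  · have h1 : HasFDerivAt (fderiv ℝ f) (fderiv ℝ (fderiv ℝ f) a) (a + (0 : ℝ) • v) := by
      simpa using hf.differentiableAt_fderiv.hasFDerivAt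
    have h2 : HasDerivAt (fun s : ℝ => fderiv ℝ f (a + s • v)) (fderiv ℝ (fderiv ℝ f) a v) 0 :=
      h1.comp_hasDerivAt 0 (hl 0)
    have h3 : HasDerivAt (fun s : ℝ => fderiv ℝ f (a + s • v) v) (fderiv ℝ (fderiv ℝ f) a v v) 0 := by
      simpa using h2.clm_apply (hasDerivAt_const (0 : ℝ) v)
    refine (h3.sub ((hasDerivAt_id (0 : ℝ)).const_mul (c * ‖v‖ ^ 2))).congr_deriv ?_
    simp
  · intro s
    have h1 := hg (a + s • v)
    simp only [add_sub_cancel_left, norm_smul, mul_pow, Real.norm_eq_abs, sq_abs] at h1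
    simp only [zero_smul, add_zero]
    nlinarith

end Higher


/-! ### First consequences of smooth decision making -/

section Risk

set_option maxSynthPendingDepth 3

variable {d dₐ : ℕ} {J : Vec d → Vec dₐ → ℝ} {aopt : Vec d → Vec dₐ} {θ₀ θ : Vec d}
  {S : SmoothConstants}

/-- The Hessian of the excess risk under `θ₀` at the optimal decision, as a bilinear form. -/
noncomputable def riskHess (J : Vec d → Vec dₐ → ℝ) (aopt : Vec d → Vec dₐ) (θ₀ : Vec d) :
    Vec dₐ →L[ℝ] Vec dₐ →L[ℝ] ℝ :=
  fderiv ℝ (fderiv ℝ fun a => excessRisk J a θ₀) (aopt θ₀)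

namespace SmoothDecision

lemma norm_sub_self_le (h : SmoothDecision J aopt θ₀ S) :
    ‖θ₀ - θ₀‖ ≤ S.r := by simpa using h.r_pos.le

lemma La1_nonneg (h : SmoothDecision J aopt θ₀ S) :
    0 ≤ S.La1 :=
  (norm_nonneg _).trans (h.opt_bound₁ θ₀ h.norm_sub_self_le)

lemma La2_nonneg (h : SmoothDecision J aopt θ₀ S) :
    0 ≤ S.La2 :=
  (norm_nonneg _).trans (h.opt_bound₂ θ₀ h.norm_sub_self_le)

lemma opt_mem (h : SmoothDecision J aopt θ₀ S) : ‖aopt θ₀ - aopt θ₀‖ ≤ S.La1 * S.r := by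
  simpa using mul_nonneg h.La1_nonneg h.r_pos.le

lemma LR1_nonneg (h : SmoothDecision J aopt θ₀ S) : 0 ≤ S.LR1 :=
  (norm_nonneg _).trans (h.risk_bound₁ θ₀ (aopt θ₀) h.norm_sub_self_le h.opt_mem)

lemma LR2_nonneg (h : SmoothDecision J aopt θ₀ S) : 0 ≤ S.LR2 :=
  (norm_nonneg _).trans (h.risk_bound₂ θ₀ (aopt θ₀) h.norm_sub_self_le h.opt_mem)

lemma LR3_nonneg (h : SmoothDecision J aopt θ₀ S) : 0 ≤ S.LR3 :=
  (norm_nonneg _).trans (h.risk_bound₃ θ₀ (aopt θ₀) h.norm_sub_self_le h.opt_mem)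

lemma La3_nonneg (h : SmoothDecision J aopt θ₀ S) (hd : 1 ≤ d) : 0 ≤ S.La3 :=
  (norm_nonneg _).trans (h.opt_bound₃ θ₀ h.norm_sub_self_le
    (EuclideanSpace.single ⟨0, hd⟩ 1) (by simp))

lemma Lhess_nonneg (h : SmoothDecision J aopt θ₀ S) (hd : 1 ≤ d) : 0 ≤ S.Lhess := by
  -- A second model, at distance exactly r, is what forces the sign of the Lipschitz constant; it
  -- exists because d ≥ 1.
  have hn : ‖θ₀ + EuclideanSpace.single (⟨0, hd⟩ : Fin d) S.r - θ₀‖ = S.r := by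
    simp [abs_of_pos h.r_pos]
  have h1 := (norm_nonneg _).trans
    (h.hess_lipschitz _ θ₀ (aopt θ₀) hn.le h.norm_sub_self_le h.opt_mem)
  rw [hn] at h1
  exact nonneg_of_mul_nonneg_left h1 h.r_pos

lemma excessRisk_opt (h : SmoothDecision J aopt θ₀ S) (hθ : ‖θ - θ₀‖ ≤ S.r) :
    excessRisk J (aopt θ) θ = 0 := by
  have hle := h.optimal θ hθ
  have : ⨅ a, J θ a = J θ (aopt θ) :=
    le_antisymm (ciInf_le ⟨_, by rintro _ ⟨a, rfl⟩; exact hle a⟩ _) (le_ciInf hle)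
  simp [excessRisk, this]

lemma excessRisk_nonneg (h : SmoothDecision J aopt θ₀ S) (hθ : ‖θ - θ₀‖ ≤ S.r) (a : Vec dₐ) :
    0 ≤ excessRisk J a θ :=
  (by have := h.μ_pos; positivity : (0 : ℝ) ≤ S.μ / 2 * ‖a - aopt θ‖ ^ 2).trans (h.growth θ hθ a)

lemma fderiv_risk_opt (h : SmoothDecision J aopt θ₀ S) (hθ : ‖θ - θ₀‖ ≤ S.r) :
    fderiv ℝ (fun a => excessRisk J a θ) (aopt θ) = 0 :=
  IsLocalMin.fderiv_eq_zero (Filter.Eventually.of_forall fun a => by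
    simpa [h.excessRisk_opt hθ] using h.excessRisk_nonneg hθ a)

lemma norm_opt_sub_le (h : SmoothDecision J aopt θ₀ S) (hθ : ‖θ - θ₀‖ ≤ S.r) :
    ‖aopt θ - aopt θ₀‖ ≤ S.La1 * ‖θ - θ₀‖ := by
  refine (convex_closedBall θ₀ S.r).norm_image_sub_le_of_norm_fderiv_le (𝕜 := ℝ)
    (fun x hx => (h.opt_diff x (mem_closedBall_iff_norm.1 hx)).differentiableAt)
    (fun x hx => ?_) (Metric.mem_closedBall_self h.r_pos.le) (mem_closedBall_iff_norm.2 hθ)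
  rw [← norm_iteratedFDeriv_one]
  exact h.opt_bound₁ x (mem_closedBall_iff_norm.1 hx)

lemma opt_mem_of (h : SmoothDecision J aopt θ₀ S) (hθ : ‖θ - θ₀‖ ≤ S.r) :
    ‖aopt θ - aopt θ₀‖ ≤ S.La1 * S.r :=
  (h.norm_opt_sub_le hθ).trans (mul_le_mul_of_nonneg_left hθ h.La1_nonneg)

/-- Two applications of the mean value inequality: the derivative moves by at most La2 ‖θ - θ₀‖ on
the ball through θ. The factor 1/2 of Taylor's formula is given up. -/
lemma norm_opt_sub_linear_le (h : SmoothDecision J aopt θ₀ S) (hθ : ‖θ - θ₀‖ ≤ S.r) :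
    ‖aopt θ - aopt θ₀ - fderiv ℝ aopt θ₀ (θ - θ₀)‖ ≤ S.La2 * ‖θ - θ₀‖ ^ 2 := by
  have hsub : ∀ x ∈ Metric.closedBall θ₀ ‖θ - θ₀‖, ‖x - θ₀‖ ≤ S.r := fun x hx =>
    (mem_closedBall_iff_norm.1 hx).trans hθ
  have key := (convex_closedBall θ₀ ‖θ - θ₀‖).norm_image_sub_le_of_norm_fderiv_le' (𝕜 := ℝ)
    (f := aopt) (φ := fderiv ℝ aopt θ₀) (C := S.La2 * ‖θ - θ₀‖)
    (fun x hx => (h.opt_diff x (hsub x hx)).differentiableAt)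
    (fun x hx => ?_) (Metric.mem_closedBall_self (norm_nonneg _))
    (mem_closedBall_iff_norm.2 (le_refl ‖θ - θ₀‖))
  · rw [mul_assoc, ← sq] at key; exact key
  · have := (convex_closedBall θ₀ ‖θ - θ₀‖).norm_image_sub_le_of_norm_fderiv_le (𝕜 := ℝ)
      (f := fderiv ℝ aopt) (C := S.La2)
      (fun y hy => (h.opt_diff y (hsub y hy)).differentiableAt_fderiv)
      (fun y hy => by rw [norm_fderiv_fderiv]; exact h.opt_bound₂ y (hsub y hy))
      (Metric.mem_closedBall_self (norm_nonneg _)) hx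
    exact this.trans (mul_le_mul_of_nonneg_left (mem_closedBall_iff_norm.1 hx) h.La2_nonneg)

lemma norm_riskHess_le (h : SmoothDecision J aopt θ₀ S) : ‖riskHess J aopt θ₀‖ ≤ S.LR2 := by
  rw [riskHess, norm_fderiv_fderiv]
  exact h.risk_bound₂ θ₀ _ h.norm_sub_self_le h.opt_mem

lemma riskHess_comm (h : SmoothDecision J aopt θ₀ S) (x y : Vec dₐ) :
    riskHess J aopt θ₀ x y = riskHess J aopt θ₀ y x :=
  ((h.risk_diff θ₀ _ h.norm_sub_self_le h.opt_mem).1.isSymmSndFDerivAt (by simp)).eq x y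

lemma le_riskHess (h : SmoothDecision J aopt θ₀ S) (v : Vec dₐ) :
    S.μ * ‖v‖ ^ 2 ≤ riskHess J aopt θ₀ v v :=
  le_fderiv_fderiv_of_growth (h.risk_diff θ₀ _ h.norm_sub_self_le h.opt_mem)
    (fun a => by simpa [h.excessRisk_opt h.norm_sub_self_le] using h.growth θ₀ h.norm_sub_self_le a)
    v

lemma riskHess_nonneg (h : SmoothDecision J aopt θ₀ S) (v : Vec dₐ) :
    0 ≤ riskHess J aopt θ₀ v v :=
  (by have := h.μ_pos; positivity : (0 : ℝ) ≤ S.μ * ‖v‖ ^ 2).trans (h.le_riskHess v)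

/-- In the second derivative of the composition, the term with the second derivative of `aopt` is
multiplied by the gradient of the risk at its minimizer, which is zero. The task Hessian is thus the
pullback of `riskHess` by the derivative of `aopt`. -/
lemma taskHessian_apply (h : SmoothDecision J aopt θ₀ S) (i j : Fin d) : taskHessian J aopt θ₀ i j
    = riskHess J aopt θ₀ (fderiv ℝ aopt θ₀ (EuclideanSpace.single i 1))
        (fderiv ℝ aopt θ₀ (EuclideanSpace.single j 1)) := by
  have hC := h.risk_diff θ₀ _ h.norm_sub_self_le h.opt_mem
  have hA := h.opt_diff θ₀ h.norm_sub_self_le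
  have hev : (fderiv ℝ fun θ => excessRisk J (aopt θ) θ₀) =ᶠ[nhds θ₀]
      fun θ => (fderiv ℝ (fun a => excessRisk J a θ₀) (aopt θ)).comp (fderiv ℝ aopt θ) := by
    have h1 := hA.1.continuousAt.tendsto.eventually (hC.1.eventually (by simp))
    filter_upwards [h1, hA.1.eventually (by simp)] with θ h2 h3
    exact fderiv_comp (g := fun a => excessRisk J a θ₀) θ (h2.differentiableAt (by norm_num))
      (h3.differentiableAt (by norm_num))
  have hd : HasFDerivAt (fun θ =>
      (fderiv ℝ (fun a => excessRisk J a θ₀) (aopt θ)).comp (fderiv ℝ aopt θ)) _ θ₀ :=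
    (hC.differentiableAt_fderiv.hasFDerivAt.comp θ₀ hA.differentiableAt.hasFDerivAt).clm_comp
      hA.differentiableAt_fderiv.hasFDerivAt
  rw [taskHessian, Matrix.of_apply, iteratedFDeriv_two_apply, hev.fderiv_eq, hd.fderiv]
  simp [h.fderiv_risk_opt h.norm_sub_self_le, riskHess]

lemma inner_op_taskHessian (h : SmoothDecision J aopt θ₀ S) (x y : Vec d) :
    inner ℝ x (op (taskHessian J aopt θ₀) y)
    = riskHess J aopt θ₀ (fderiv ℝ aopt θ₀ x) (fderiv ℝ aopt θ₀ y) := by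
  have hx : ∀ x : Vec d, x = ∑ i, x i • EuclideanSpace.single i (1 : ℝ) := fun x => by
    simpa using ((EuclideanSpace.basisFun (Fin d) ℝ).sum_repr x).symm
  conv_rhs => rw [hx x, hx y]
  simp only [map_sum, map_smul, sum_apply, smul_apply,
    smul_eq_mul, inner_op, h.taskHessian_apply]
  rw [Finset.sum_comm]
  refine Finset.sum_congr rfl fun i _ => ?_
  rw [Finset.mul_sum]
  exact Finset.sum_congr rfl fun j _ => by ring

lemma posSemidef_taskHessian (h : SmoothDecision J aopt θ₀ S) :
    (taskHessian J aopt θ₀).PosSemidef := by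
  refine Matrix.PosSemidef.of_dotProduct_mulVec_nonneg ?_ fun x => ?_
  · ext i j
    simp [h.taskHessian_apply, h.riskHess_comm]
  · have := h.riskHess_nonneg (fderiv ℝ aopt θ₀ (WithLp.toLp 2 x))
    rw [← h.inner_op_taskHessian, Matrix.inner_toEuclideanCLM] at this
    simpa using this

lemma trace_taskHessian_le (h : SmoothDecision J aopt θ₀ S) :
    (taskHessian J aopt θ₀).trace ≤ d * (S.LR2 * S.La1 ^ 2) := by
  have hA : ‖fderiv ℝ aopt θ₀‖ ≤ S.La1 := by
    rw [← norm_iteratedFDeriv_one]; exact h.opt_bound₁ θ₀ h.norm_sub_self_le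
  have hi : ∀ i, taskHessian J aopt θ₀ i i ≤ S.LR2 * S.La1 ^ 2 := by
    intro i
    set a := fderiv ℝ aopt θ₀ (EuclideanSpace.single i 1) with ha
    have h1 : ‖a‖ ≤ S.La1 := by
      simpa using (fderiv ℝ aopt θ₀).le_of_opNorm_le hA (EuclideanSpace.single i (1 : ℝ))
    rw [h.taskHessian_apply, ← ha]
    calc riskHess J aopt θ₀ a a ≤ ‖riskHess J aopt θ₀ a a‖ := le_abs_self _
      _ ≤ ‖riskHess J aopt θ₀‖ * ‖a‖ * ‖a‖ := (riskHess J aopt θ₀).le_opNorm₂ a a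
      _ ≤ S.LR2 * S.La1 * S.La1 := by
        have := h.norm_riskHess_le
        have := h.LR2_nonneg
        have := h.La1_nonneg
        gcongr
      _ = _ := by ring
  calc (taskHessian J aopt θ₀).trace ≤ ∑ _i : Fin d, S.LR2 * S.La1 ^ 2 :=
        Finset.sum_le_sum fun i _ => hi i
    _ = _ := by simp

end SmoothDecision

end Risk


/-! ### Taylor bounds for a function along a curve -/

section CompLine

set_option maxSynthPendingDepth 3

variable {E F : Type*} [NormedAddCommGroup E] [NormedSpace ℝ E]
    [NormedAddCommGroup F] [NormedSpace ℝ F]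

lemma le_of_hasDerivAt_le {g g' : ℝ → ℝ} {C : ℝ}
    (h : ∀ s ∈ Set.Icc (0 : ℝ) 1, HasDerivAt g (g' s) s) (hC : ∀ s ∈ Set.Icc (0 : ℝ) 1, g' s ≤ C) :
    ∀ s ∈ Set.Icc (0 : ℝ) 1, g s ≤ g 0 + C * s := by
  refine image_le_of_deriv_right_le_deriv_boundary
    (fun s hs => (h s hs).continuousAt.continuousWithinAt)
    (fun s hs => (h s (Set.Ico_subset_Icc_self hs)).hasDerivWithinAt) (by simp)
    (by fun_prop) (B' := fun _ => C) (fun s _ => ?_) (fun s hs => hC s (Set.Ico_subset_Icc_self hs))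
  simpa using (((hasDerivAt_id s).const_mul C).const_add (g 0)).hasDerivWithinAt

/-- Third-order Taylor bound for a function along a curve. -/
lemma comp_curve_le {f : F → ℝ} {c c₁ c₂ c₃ : ℝ → F} {B₁ B₂ B₃ A₁ A₂ A₃ : ℝ}
    (hf : ∀ s ∈ Set.Icc (0 : ℝ) 1, ThriceDifferentiableAt f (c s))
    (hB₁ : ∀ s ∈ Set.Icc (0 : ℝ) 1, ‖fderiv ℝ f (c s)‖ ≤ B₁)
    (hB₂ : ∀ s ∈ Set.Icc (0 : ℝ) 1, ‖fderiv ℝ (fderiv ℝ f) (c s)‖ ≤ B₂)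
    (hB₃ : ∀ s ∈ Set.Icc (0 : ℝ) 1, ‖fderiv ℝ (fderiv ℝ (fderiv ℝ f)) (c s)‖ ≤ B₃)
    (h₀ : ∀ s ∈ Set.Icc (0 : ℝ) 1, HasDerivAt c (c₁ s) s)
    (h₁ : ∀ s ∈ Set.Icc (0 : ℝ) 1, HasDerivAt c₁ (c₂ s) s)
    (h₂ : ∀ s ∈ Set.Icc (0 : ℝ) 1, HasDerivAt c₂ (c₃ s) s)
    (hA₁ : ∀ s ∈ Set.Icc (0 : ℝ) 1, ‖c₁ s‖ ≤ A₁) (hA₂ : ∀ s ∈ Set.Icc (0 : ℝ) 1, ‖c₂ s‖ ≤ A₂)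
    (hA₃ : ∀ s ∈ Set.Icc (0 : ℝ) 1, ‖c₃ s‖ ≤ A₃) :
    f (c 1) ≤ f (c 0) + fderiv ℝ f (c 0) (c₁ 0)
      + (fderiv ℝ (fderiv ℝ f) (c 0) (c₁ 0) (c₁ 0) + fderiv ℝ f (c 0) (c₂ 0)) / 2
      + (B₃ * A₁ ^ 3 + 3 * B₂ * A₂ * A₁ + B₁ * A₃) / 6 := by
  set D₁ := fderiv ℝ f with hD₁
  set D₂ := fderiv ℝ D₁ with hD₂
  set D₃ := fderiv ℝ D₂ with hD₃
  have e₁ : ∀ s ∈ Set.Icc (0 : ℝ) 1, HasDerivAt (fun s => D₁ (c s)) (D₂ (c s) (c₁ s)) s :=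
    fun s hs => (hf s hs).differentiableAt_fderiv.hasFDerivAt.comp_hasDerivAt s (h₀ s hs)
  have e₂ : ∀ s ∈ Set.Icc (0 : ℝ) 1, HasDerivAt (fun s => D₂ (c s)) (D₃ (c s) (c₁ s)) s :=
    fun s hs => (hf s hs).differentiableAt_fderiv_fderiv.hasFDerivAt.comp_hasDerivAt s (h₀ s hs)
  have k₁ : ∀ s ∈ Set.Icc (0 : ℝ) 1, HasDerivAt (fun s => D₁ (c s) (c₁ s))
      (D₂ (c s) (c₁ s) (c₁ s) + D₁ (c s) (c₂ s)) s :=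
    fun s hs => (e₁ s hs).clm_apply (h₁ s hs)
  have k₂ : ∀ s ∈ Set.Icc (0 : ℝ) 1, HasDerivAt (fun s => D₁ (c s) (c₂ s))
      (D₂ (c s) (c₁ s) (c₂ s) + D₁ (c s) (c₃ s)) s :=
    fun s hs => (e₁ s hs).clm_apply (h₂ s hs)
  have k₃ : ∀ s ∈ Set.Icc (0 : ℝ) 1, HasDerivAt (fun s => D₂ (c s) (c₁ s))
      (D₃ (c s) (c₁ s) (c₁ s) + D₂ (c s) (c₂ s)) s :=
    fun s hs => (e₂ s hs).clm_apply (h₁ s hs)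
  have k₄ : ∀ s ∈ Set.Icc (0 : ℝ) 1, HasDerivAt (fun s => D₂ (c s) (c₁ s) (c₁ s))
      ((D₃ (c s) (c₁ s) (c₁ s) + D₂ (c s) (c₂ s)) (c₁ s) + D₂ (c s) (c₁ s) (c₂ s)) s :=
    fun s hs => (k₃ s hs).clm_apply (h₁ s hs)
  refine le_taylor_two (g := fun s => f (c s)) (g₁ := fun s => D₁ (c s) (c₁ s))
    (g₂ := fun s => D₂ (c s) (c₁ s) (c₁ s) + D₁ (c s) (c₂ s))
    (fun s hs => (hf s hs).differentiableAt.hasFDerivAt.comp_hasDerivAt s (h₀ s hs)) k₁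
    (le_of_hasDerivAt_le (fun s hs => (k₄ s hs).add (k₂ s hs)) fun s hs => ?_)
  -- The derivative of `g₂` is D₃(c₁,c₁,c₁) + D₂(c₂,c₁) + 2 D₂(c₁,c₂) + D₁(c₃), whence the factor 3.
  -- Both orders of the arguments of D₂ are bounded directly, so symmetry is not used.
  have n₁ := hA₁ s hs
  have n₂ := hA₂ s hs
  have n₃ := hA₃ s hs
  have b₁ := hB₁ s hs
  have b₂ := hB₂ s hs
  have b₃ := hB₃ s hs
  have p₁ := (norm_nonneg _).trans n₁
  have p₂ := (norm_nonneg _).trans n₂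
  have p₃ := (norm_nonneg _).trans n₃
  have q₁ := (norm_nonneg _).trans b₁
  have q₂ := (norm_nonneg _).trans b₂
  have q₃ := (norm_nonneg _).trans b₃
  have t₁ : D₁ (c s) (c₃ s) ≤ B₁ * A₃ :=
    (le_abs_self _).trans (((D₁ (c s)).le_opNorm _).trans (by gcongr))
  have t₂ : ∀ {x y : F} {a b : ℝ}, ‖x‖ ≤ a → ‖y‖ ≤ b → D₂ (c s) x y ≤ B₂ * a * b := by
    intro x y a b hx hy
    have ha := (norm_nonneg _).trans hx
    exact (le_abs_self _).trans (((D₂ (c s)).le_opNorm₂ x y).trans (by gcongr))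
  have t₃ : D₃ (c s) (c₁ s) (c₁ s) (c₁ s) ≤ B₃ * A₁ * A₁ * A₁ := by
    refine (le_abs_self _).trans (((D₃ (c s) (c₁ s)).le_opNorm₂ _ _).trans ?_)
    have := (D₃ (c s)).le_opNorm (c₁ s)
    have : ‖D₃ (c s) (c₁ s)‖ ≤ B₃ * A₁ := this.trans (by gcongr)
    gcongr
  have u₁ := t₂ n₂ n₁
  have u₂ := t₂ n₁ n₂
  simp only [add_apply]
  nlinarith

end CompLine

/-! ### Quadratic bounds on the excess risk -/

section RiskBounds

set_option maxSynthPendingDepth 3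

variable {d dₐ : ℕ} {J : Vec d → Vec dₐ → ℝ} {aopt : Vec d → Vec dₐ} {θ₀ θ : Vec d}
  {S : SmoothConstants}

/-- Quadratic approximation from above of the risk of the plug-in decision. -/
lemma SmoothDecision.excessRisk_plugin_le (h : SmoothDecision J aopt θ₀ S)
    (hθ : ‖θ - θ₀‖ ≤ S.r) :
    excessRisk J (aopt θ) θ₀ ≤ inner ℝ (θ - θ₀) (op (taskHessian J aopt θ₀) (θ - θ₀)) / 2
      + S.Lquad * ‖θ - θ₀‖ ^ 3 := by
  set η := θ - θ₀ with hη
  have hball : ∀ s ∈ Set.Icc (0 : ℝ) 1, ‖θ₀ + s • η - θ₀‖ ≤ S.r := by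
    intro s hs
    rw [add_sub_cancel_left, norm_smul, Real.norm_of_nonneg hs.1]
    nlinarith [norm_nonneg η, hs.2]
  have hdiff := fun s hs => h.opt_diff _ (hball s hs)
  have hmem := fun s hs => h.opt_mem_of (hball s hs)
  have key := comp_curve_le (f := fun a => excessRisk J a θ₀)
    (c := fun s => aopt (θ₀ + s • η))
    (c₁ := fun s => iteratedFDeriv ℝ 1 aopt (θ₀ + s • η) fun _ => η)
    (c₂ := fun s => iteratedFDeriv ℝ 2 aopt (θ₀ + s • η) fun _ => η)
    (c₃ := fun s => iteratedFDeriv ℝ 3 aopt (θ₀ + s • η) fun _ => η)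
    (B₁ := S.LR1) (B₂ := S.LR2) (B₃ := S.LR3) (A₁ := S.La1 * ‖η‖) (A₂ := S.La2 * ‖η‖ ^ 2)
    (A₃ := S.La3 * ‖η‖ ^ 3)
    (fun s hs => h.risk_diff θ₀ _ h.norm_sub_self_le (hmem s hs))
    (fun s hs => by
      rw [← norm_iteratedFDeriv_one]
      exact h.risk_bound₁ θ₀ _ h.norm_sub_self_le (hmem s hs))
    (fun s hs => by
      rw [norm_fderiv_fderiv]
      exact h.risk_bound₂ θ₀ _ h.norm_sub_self_le (hmem s hs))
    (fun s hs => by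
      rw [norm_fderiv_fderiv_fderiv]
      exact h.risk_bound₃ θ₀ _ h.norm_sub_self_le (hmem s hs))
    (fun s hs => by
      have hl : HasDerivAt (fun s : ℝ => θ₀ + s • η) η s := by
        simpa using ((hasDerivAt_id s).smul_const η).const_add θ₀
      simpa [Function.comp_def] using
        (hdiff s hs).differentiableAt.hasFDerivAt.comp_hasDerivAt s hl)
    (fun s hs => hasDerivAt_iteratedFDeriv_line
      ((hdiff s hs).1.differentiableAt_iteratedFDeriv (by norm_num)))
    (fun s hs => hasDerivAt_iteratedFDeriv_line (hdiff s hs).2)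
    (fun s hs => by
      have := norm_iteratedFDeriv_line_le (f := aopt) (x := θ₀ + s • η) (n := 1) η
      rw [pow_one] at this
      exact this.trans (by have := h.opt_bound₁ _ (hball s hs); gcongr))
    (fun s hs => by
      have := norm_iteratedFDeriv_line_le (f := aopt) (x := θ₀ + s • η) (n := 2) η
      exact this.trans (by have := h.opt_bound₂ _ (hball s hs); gcongr))
    (fun s hs => by
      -- The third derivative of `aopt` is bounded on unit vectors only; the direction is rescaled,
      -- which requires η ≠ 0.
      rcases eq_or_ne η 0 with h0 | h0
      · simp only [h0]
        rw [ContinuousMultilinearMap.map_coord_zero _ (0 : Fin 3) rfl]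
        simp
      · have hn : 0 < ‖η‖ := norm_pos_iff.2 h0
        have hu := h.opt_bound₃ _ (hball s hs) (‖η‖⁻¹ • η) (by simp [norm_smul, hn.ne'])
        have he : (fun _ : Fin 3 => η) = fun _ => ‖η‖ • (‖η‖⁻¹ • η) := by
          funext _; rw [smul_smul, mul_inv_cancel₀ hn.ne', one_smul]
        rw [he, ContinuousMultilinearMap.map_smul_univ, norm_smul]
        simp only [Finset.prod_const, Finset.card_univ, Fintype.card_fin, norm_pow, norm_norm]
        rw [mul_comm]
        gcongr)
  have hz : (θ₀ + (0 : ℝ) • η) = θ₀ := by simp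
  have ho : (θ₀ + (1 : ℝ) • η) = θ := by simp [hη]
  -- The gradient at `aopt θ₀` is zero, which removes the linear term and the curvature term of the
  -- curve.
  simp only [hz, ho, h.fderiv_risk_opt h.norm_sub_self_le, iteratedFDeriv_one_apply,
    h.excessRisk_opt h.norm_sub_self_le] at key
  rw [h.inner_op_taskHessian]
  refine key.trans (le_of_eq ?_)
  simp [riskHess, SmoothConstants.Lquad]
  ring

/-- The constant of the cubic error in the local quadratic lower bound on the risk. -/
def SmoothConstants.Lcubic (S : SmoothConstants) : ℝ :=
  4 * S.La1 * S.La2 * S.LR2 + 19 * S.La1 ^ 3 * S.LR3 + 8 * S.La1 ^ 2 * S.Lhess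

/-- Quadratic approximation from below of the risk of a decision near the optimal one. -/
lemma SmoothDecision.le_excessRisk_near (h : SmoothDecision J aopt θ₀ S) (hd : 1 ≤ d)
    {η : Vec d} {a : Vec dₐ} {ρ : ℝ} (hρ : 4 * ρ ≤ S.r) (hη : ‖η‖ ≤ ρ)
    (ha : ‖a - aopt θ₀‖ ≤ 3 * S.La1 * ρ) :
    riskHess J aopt θ₀ (a - aopt θ₀ - fderiv ℝ aopt θ₀ η) (a - aopt θ₀ - fderiv ℝ aopt θ₀ η) / 2
      ≤ excessRisk J a (θ₀ + η) + S.Lcubic * ρ ^ 3 := by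
  have hρ0 : 0 ≤ ρ := (norm_nonneg _).trans hη
  have hL1 := h.La1_nonneg
  have hL2 := h.La2_nonneg
  have hR2 := h.LR2_nonneg
  have hR3 := h.LR3_nonneg
  have hLh := h.Lhess_nonneg hd
  set θ := θ₀ + η with hθdef
  have hθη : θ - θ₀ = η := by simp [hθdef]
  have hθ : ‖θ - θ₀‖ ≤ S.r := by rw [hθη]; linarith
  set v := a - aopt θ with hv
  set x := a - aopt θ₀ - fderiv ℝ aopt θ₀ η with hx
  set f := fun a => excessRisk J a θ with hf
  have ho : ‖aopt θ - aopt θ₀‖ ≤ S.La1 * ρ :=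
    (h.norm_opt_sub_le hθ).trans (by rw [hθη]; gcongr)
  have hAn : ‖fderiv ℝ aopt θ₀‖ ≤ S.La1 := by
    rw [← norm_iteratedFDeriv_one]; exact h.opt_bound₁ θ₀ h.norm_sub_self_le
  have hAη : ‖fderiv ℝ aopt θ₀ η‖ ≤ S.La1 * ρ :=
    ((fderiv ℝ aopt θ₀).le_of_opNorm_le hAn η).trans (by gcongr)
  have hvn : ‖v‖ ≤ 4 * S.La1 * ρ := by
    have : v = (a - aopt θ₀) - (aopt θ - aopt θ₀) := by rw [hv]; abel
    rw [this]
    exact (norm_sub_le _ _).trans (by linarith)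
  have hxn : ‖x‖ ≤ 4 * S.La1 * ρ := (norm_sub_le _ _).trans (by linarith)
  have hvx : ‖v - x‖ ≤ S.La2 * ρ ^ 2 := by
    have h1 := h.norm_opt_sub_linear_le hθ
    rw [hθη] at h1
    have : v - x = -(aopt θ - aopt θ₀ - fderiv ℝ aopt θ₀ η) := by rw [hv, hx]; abel
    rw [this, norm_neg]
    exact h1.trans (by gcongr)
  -- All points used lie in this ball, and 4ρ ≤ r places it inside the region where the derivative
  -- bounds hold.
  have hconv := convex_closedBall (aopt θ₀) (3 * S.La1 * ρ)
  have hdom : ∀ b ∈ Metric.closedBall (aopt θ₀) (3 * S.La1 * ρ), ‖b - aopt θ₀‖ ≤ S.La1 * S.r := by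
    intro b hb
    refine (mem_closedBall_iff_norm.1 hb).trans ?_
    nlinarith
  have hmo : aopt θ ∈ Metric.closedBall (aopt θ₀) (3 * S.La1 * ρ) :=
    mem_closedBall_iff_norm.2 (ho.trans (by nlinarith [mul_nonneg hL1 hρ0]))
  have hm0 : aopt θ₀ ∈ Metric.closedBall (aopt θ₀) (3 * S.La1 * ρ) :=
    Metric.mem_closedBall_self (by positivity)
  have hma : a ∈ Metric.closedBall (aopt θ₀) (3 * S.La1 * ρ) := mem_closedBall_iff_norm.2 ha
  have hseg : ∀ s ∈ Set.Icc (0 : ℝ) 1,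
      aopt θ + s • v ∈ Metric.closedBall (aopt θ₀) (3 * S.La1 * ρ) := by
    intro s hs
    exact hconv.add_smul_sub_mem hmo hma hs
  have hlip : ∀ b ∈ Metric.closedBall (aopt θ₀) (3 * S.La1 * ρ),
      ∀ b' ∈ Metric.closedBall (aopt θ₀) (3 * S.La1 * ρ),
      ‖fderiv ℝ (fderiv ℝ f) b' - fderiv ℝ (fderiv ℝ f) b‖ ≤ S.LR3 * ‖b' - b‖ := by
    intro b hb b' hb'
    refine hconv.norm_image_sub_le_of_norm_fderiv_le (𝕜 := ℝ)
      (fun y hy => (h.risk_diff θ y hθ (hdom y hy)).differentiableAt_fderiv_fderiv)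
      (fun y hy => ?_) hb hb'
    rw [norm_fderiv_fderiv_fderiv]
    exact h.risk_bound₃ θ y hθ (hdom y hy)
  have happ : ∀ (B : Vec dₐ →L[ℝ] Vec dₐ →L[ℝ] ℝ) (y : Vec dₐ), |B y y| ≤ ‖B‖ * ‖y‖ ^ 2 := by
    intro B y
    have := B.le_opNorm₂ y y
    rw [mul_assoc, ← sq] at this
    exact this
  -- Taylor expansion at the optimal decision of `θ`
  have taylor : fderiv ℝ (fderiv ℝ f) (aopt θ) v v / 2
      ≤ excessRisk J a θ + S.LR3 * ‖v‖ ^ 3 / 6 := by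
    have hl : ∀ s : ℝ, HasDerivAt (fun s : ℝ => aopt θ + s • v) v s := fun s => by
      simpa using ((hasDerivAt_id s).smul_const v).const_add (aopt θ)
    have d₁ : ∀ s ∈ Set.Icc (0 : ℝ) 1, HasDerivAt (fun s : ℝ => f (aopt θ + s • v))
        (fderiv ℝ f (aopt θ + s • v) v) s := by
      intro s hs
      have h1 : HasFDerivAt f (fderiv ℝ f (aopt θ + s • v)) (aopt θ + s • v) :=
        (h.risk_diff θ _ hθ (hdom _ (hseg s hs))).differentiableAt.hasFDerivAt
      exact h1.comp_hasDerivAt s (hl s)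
    have d₂ : ∀ s ∈ Set.Icc (0 : ℝ) 1, HasDerivAt (fun s : ℝ => fderiv ℝ f (aopt θ + s • v) v)
        (fderiv ℝ (fderiv ℝ f) (aopt θ + s • v) v v) s := by
      intro s hs
      have h2 : HasDerivAt (fun s : ℝ => fderiv ℝ f (aopt θ + s • v))
          (fderiv ℝ (fderiv ℝ f) (aopt θ + s • v) v) s :=
        (h.risk_diff θ _ hθ (hdom _ (hseg s hs))).differentiableAt_fderiv.hasFDerivAt.comp_hasDerivAt
          s (hl s)
      simpa using h2.clm_apply (hasDerivAt_const s v)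
    -- The expansion is applied to -f, with the Lipschitz bound on the Hessian as the one-sided
    -- hypothesis.
    have key := le_taylor_two (C := S.LR3 * ‖v‖ ^ 3) (fun s hs => (d₁ s hs).fun_neg)
      (fun s hs => (d₂ s hs).fun_neg) (fun s hs => ?_)
    · have e1 : f (aopt θ) = 0 := h.excessRisk_opt hθ
      have e2 : fderiv ℝ f (aopt θ) = 0 := h.fderiv_risk_opt hθ
      have e3 : aopt θ + v = a := by rw [hv]; abel
      have e4 : f a = excessRisk J a θ := rfl
      simp only [one_smul, zero_smul, add_zero, e1, e2, e3, e4, zero_apply] at key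
      linarith
    · have h1 := hlip _ hmo _ (hseg s hs)
      rw [add_sub_cancel_left, norm_smul, Real.norm_of_nonneg hs.1] at h1
      have h2 := happ (fderiv ℝ (fderiv ℝ f) (aopt θ + s • v) - fderiv ℝ (fderiv ℝ f) (aopt θ)) v
      simp only [sub_apply] at h2
      have h3 := neg_abs_le (fderiv ℝ (fderiv ℝ f) (aopt θ + s • v) v v
        - fderiv ℝ (fderiv ℝ f) (aopt θ) v v)
      have h4 := mul_le_mul_of_nonneg_right h1 (sq_nonneg ‖v‖)
      simp only [zero_smul, add_zero]
      nlinarith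
  -- exchange of the Hessian for the one at `θ₀`
  have exch : riskHess J aopt θ₀ v v
      ≤ fderiv ℝ (fderiv ℝ f) (aopt θ) v v + (S.LR3 * (S.La1 * ρ) + S.Lhess * ρ) * ‖v‖ ^ 2 := by
    have h1 := hlip _ hm0 _ hmo
    have h2 := happ (fderiv ℝ (fderiv ℝ f) (aopt θ) - fderiv ℝ (fderiv ℝ f) (aopt θ₀)) v
    simp only [sub_apply] at h2
    have h3 := h.hess_lipschitz θ θ₀ (aopt θ₀) hθ h.norm_sub_self_le h.opt_mem
    rw [hθη] at h3
    have h4 := (iteratedFDeriv ℝ 2 f (aopt θ₀)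
      - iteratedFDeriv ℝ 2 (fun a => excessRisk J a θ₀) (aopt θ₀)).le_opNorm fun _ => v
    simp only [sub_apply, Finset.prod_const, Finset.card_univ, Fintype.card_fin,
      iteratedFDeriv_two_apply] at h4
    have h5 := neg_abs_le (fderiv ℝ (fderiv ℝ f) (aopt θ) v v
        - fderiv ℝ (fderiv ℝ f) (aopt θ₀) v v)
    have h6 := neg_abs_le (fderiv ℝ (fderiv ℝ f) (aopt θ₀) v v - riskHess J aopt θ₀ v v)
    have h7 : |fderiv ℝ (fderiv ℝ f) (aopt θ₀) v v - riskHess J aopt θ₀ v v|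
        ≤ S.Lhess * ρ * ‖v‖ ^ 2 := by
      refine h4.trans ?_
      have := h3.trans (mul_le_mul_of_nonneg_left hη hLh)
      gcongr
    have h8 : ‖fderiv ℝ (fderiv ℝ f) (aopt θ) - fderiv ℝ (fderiv ℝ f) (aopt θ₀)‖ * ‖v‖ ^ 2
        ≤ S.LR3 * (S.La1 * ρ) * ‖v‖ ^ 2 := by
      have := h1.trans (mul_le_mul_of_nonneg_left ho hR3)
      gcongr
    linarith
  -- linearization of the optimal decision
  have lin : riskHess J aopt θ₀ x x ≤ riskHess J aopt θ₀ v v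
      + S.LR2 * (S.La2 * ρ ^ 2) * (8 * S.La1 * ρ) := by
    -- By symmetry of the form, a difference of squares factors as M(v - x, v + x), where v - x is
    -- of second order in ρ.
    have e : riskHess J aopt θ₀ x x
        = riskHess J aopt θ₀ v v - riskHess J aopt θ₀ (v - x) (v + x) := by
      simp only [map_add, map_sub, sub_apply, h.riskHess_comm x v]
      ring
    have h1 := (riskHess J aopt θ₀).le_opNorm₂ (v - x) (v + x)
    have h2 := neg_abs_le (riskHess J aopt θ₀ (v - x) (v + x))
    have h3 : ‖v + x‖ ≤ 8 * S.La1 * ρ := (norm_add_le _ _).trans (by linarith)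
    have h4 := h.norm_riskHess_le
    have h5 : ‖riskHess J aopt θ₀‖ * ‖v - x‖ * ‖v + x‖
        ≤ S.LR2 * (S.La2 * ρ ^ 2) * (8 * S.La1 * ρ) := by gcongr
    rw [Real.norm_eq_abs] at h1
    linarith
  have hv2 : ‖v‖ ^ 2 ≤ (4 * S.La1 * ρ) ^ 2 := by gcongr
  have hv3 : ‖v‖ ^ 3 ≤ (4 * S.La1 * ρ) ^ 3 := by gcongr
  have f1 := mul_le_mul_of_nonneg_left hv3 hR3
  have f2 := mul_le_mul_of_nonneg_left hv2 (by positivity : 0 ≤ S.LR3 * (S.La1 * ρ) + S.Lhess * ρ)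
  have f3 : 0 ≤ S.LR3 * S.La1 ^ 3 * ρ ^ 3 := by positivity
  -- With ‖v‖ ≤ 4 La1 ρ: the LR3 terms give 64/6 + 16/2 ≤ 19, the Lhess term 16/2 = 8, and the
  -- linearization 8/2 = 4.
  have goal : S.LR3 * (4 * S.La1 * ρ) ^ 3 / 6
      + (S.LR3 * (S.La1 * ρ) + S.Lhess * ρ) * (4 * S.La1 * ρ) ^ 2 / 2
      + S.LR2 * (S.La2 * ρ ^ 2) * (8 * S.La1 * ρ) / 2 ≤ S.Lcubic * ρ ^ 3 := by
    simp only [SmoothConstants.Lcubic]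
    nlinarith
  linarith

/-- The optimal decision of the model moves by at most La1 ρ, so a stays at distance at least 2 La1
ρ from it, and quadratic growth applies. -/
lemma SmoothDecision.le_excessRisk_far (h : SmoothDecision J aopt θ₀ S)
    {η : Vec d} {a : Vec dₐ} {ρ : ℝ} (hρ : 4 * ρ ≤ S.r) (hη : ‖η‖ ≤ ρ)
    (ha : 3 * S.La1 * ρ < ‖a - aopt θ₀‖) :
    2 * S.μ * S.La1 ^ 2 * ρ ^ 2 ≤ excessRisk J a (θ₀ + η) := by
  have hρ0 : 0 ≤ ρ := (norm_nonneg _).trans hη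
  have hL1 := h.La1_nonneg
  have hθη : θ₀ + η - θ₀ = η := by simp
  have hθ : ‖θ₀ + η - θ₀‖ ≤ S.r := by rw [hθη]; linarith
  have ho : ‖aopt (θ₀ + η) - aopt θ₀‖ ≤ S.La1 * ρ :=
    (h.norm_opt_sub_le hθ).trans (by rw [hθη]; gcongr)
  have h1 : 2 * (S.La1 * ρ) ≤ ‖a - aopt (θ₀ + η)‖ := by
    have := norm_sub_norm_le (a - aopt θ₀) (aopt (θ₀ + η) - aopt θ₀)
    rw [sub_sub_sub_cancel_right] at this
    linarith
  have h2 : (2 * (S.La1 * ρ)) ^ 2 ≤ ‖a - aopt (θ₀ + η)‖ ^ 2 := by gcongr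
  have h3 := h.growth _ hθ a
  have := mul_le_mul_of_nonneg_left h2 (half_pos h.μ_pos).le
  linarith

end RiskBounds


/-! ### Deviations of the noise -/

section Tails

variable {Ω : Type*} [mΩ : MeasurableSpace Ω] {d dᵤ : ℕ} {X : Observations Ω d dᵤ}
  {σ : ℝ≥0} {θ : Vec d} {P : Measure Ω}

/-- Markov's inequality; the total mass K admits mixtures over an unnormalised Gaussian weight. -/
lemma meas_le_exp_neg {f : Ω → ℝ≥0∞} (hf : AEMeasurable f P) {K : ℝ≥0∞} (hK : ∫⁻ ω, f ω ∂P ≤ K)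
    (hK0 : K ≠ 0) (hKt : K ≠ ∞) (ℓ : ℝ) {A : Set Ω}
    (hA : ∀ ω ∈ A, K * ENNReal.ofReal (Real.exp ℓ) ≤ f ω) :
    P A ≤ ENNReal.ofReal (Real.exp (-ℓ)) := by
  have h1 := mul_meas_ge_le_lintegral₀ hf (K * ENNReal.ofReal (Real.exp ℓ))
  have h2 : K * ENNReal.ofReal (Real.exp ℓ) * P A ≤ K * 1 := by
    rw [mul_one]
    exact (mul_le_mul_right (measure_mono hA) _).trans (h1.trans hK)
  rw [mul_assoc] at h2
  have h3 := (ENNReal.mul_le_mul_iff_right hK0 hKt).1 h2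
  rw [Real.exp_neg, ENNReal.ofReal_inv_of_pos (Real.exp_pos _)]
  exact ENNReal.le_inv_iff_mul_le.2 (by rwa [mul_comm])

lemma measurable_expMartingale (X : Observations Ω d dᵤ) (σ : ℝ≥0) (θ : Vec d) (T : ℕ) :
    Measurable fun p : Ω × Vec d => ENNReal.ofReal (Real.exp
      (∑ t ∈ Finset.range T, inner ℝ p.2 (X.z t p.1) * X.noise θ t p.1
        - σ ^ 2 / 2 * ∑ t ∈ Finset.range T, inner ℝ p.2 (X.z t p.1) ^ 2)) := by
  have hz := X.measurable_z
  have hw := X.measurable_noise θ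
  fun_prop

/-- Deviations in a fixed direction. -/
lemma Observations.IsLaw.tail_direction (h : X.IsLaw σ θ P) (v : Vec d) (T : ℕ) {q ℓ : ℝ}
    (hq : 0 ≤ q) (hℓ : 0 ≤ ℓ) :
    P {ω | ∑ t ∈ Finset.range T, inner ℝ v (X.z t ω) ^ 2 ≤ q ∧
        2 * σ ^ 2 * q * ℓ < (∑ t ∈ Finset.range T, inner ℝ v (X.z t ω) * X.noise θ t ω) ^ 2}
      ≤ 2 * ENNReal.ofReal (Real.exp (-ℓ)) := by
  rcases eq_or_ne σ 0 with rfl | hσ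
  · have h0 : ∀ᵐ ω ∂P, ∀ t, X.noise θ t ω = 0 := ae_all_iff.2 h.noise_eq_zero
    have hz : P {ω | ∑ t ∈ Finset.range T, inner ℝ v (X.z t ω) ^ 2 ≤ q ∧
        2 * ((0 : ℝ≥0) : ℝ) ^ 2 * q * ℓ
          < (∑ t ∈ Finset.range T, inner ℝ v (X.z t ω) * X.noise θ t ω) ^ 2} = 0 := by
      refine measure_mono_null ?_ h0
      intro ω hω (hc : ∀ t, X.noise θ t ω = 0)
      have := hω.2
      simp [hc] at this
    rw [hz]; exact zero_le
  -- For q = 0 every ⟨v, z_t⟩ vanishes on the event, hence so does the martingale, and the event is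
  -- empty.
  rcases hq.eq_or_lt with rfl | hq
  · refine le_of_eq_of_le ?_ zero_le
    convert measure_empty (μ := P)
    refine Set.eq_empty_iff_forall_notMem.2 fun ω hω => ?_
    have h1 := (Finset.sum_eq_zero_iff_of_nonneg fun t _ => sq_nonneg _).1
      (le_antisymm hω.1 (Finset.sum_nonneg fun t _ => sq_nonneg (inner ℝ v (X.z t ω))))
    have h2 : ∑ t ∈ Finset.range T, inner ℝ v (X.z t ω) * X.noise θ t ω = 0 :=
      Finset.sum_eq_zero fun t ht => by rw [pow_eq_zero_iff two_ne_zero |>.1 (h1 t ht), zero_mul]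
    have := hω.2
    simp [h2] at this
  have hσ' : 0 < (σ : ℝ) := by positivity
  -- The optimal Chernoff parameter: with |∑ ⟨v, z_t⟩ w_t| ≥ √(2σ²qℓ) the exponent is at least 2ℓ -
  -- ℓ = ℓ.
  set l := √(2 * ℓ / (σ ^ 2 * q)) with hl
  have hl0 : 0 ≤ l := Real.sqrt_nonneg _
  have hl2 : l ^ 2 * (σ ^ 2 * q) = 2 * ℓ := by
    rw [hl, Real.sq_sqrt (by positivity)]; field_simp
  have half : ∀ e : ℝ, e ^ 2 = 1 →
      P {ω | ∑ t ∈ Finset.range T, inner ℝ v (X.z t ω) ^ 2 ≤ q ∧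
        2 * ℓ ≤ l * (e * ∑ t ∈ Finset.range T, inner ℝ v (X.z t ω) * X.noise θ t ω)}
      ≤ ENNReal.ofReal (Real.exp (-ℓ)) := by
    intro e he
    refine meas_le_exp_neg ((measurable_expMartingale X σ θ T).comp
      (measurable_id.prodMk measurable_const)).aemeasurable (h.lintegral_exp ((l * e) • v) T).le
      one_ne_zero ENNReal.one_ne_top ℓ ?_
    rintro ω ⟨h1, h2⟩
    rw [one_mul]
    refine ENNReal.ofReal_le_ofReal (Real.exp_le_exp.2 ?_)
    have e1 : ∑ t ∈ Finset.range T, inner ℝ ((l * e) • v) (X.z t ω) * X.noise θ t ω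
        = l * (e * ∑ t ∈ Finset.range T, inner ℝ v (X.z t ω) * X.noise θ t ω) := by
      rw [Finset.mul_sum, Finset.mul_sum]
      refine Finset.sum_congr rfl fun t _ => ?_
      rw [real_inner_smul_left]; ring
    have e2 : ∑ t ∈ Finset.range T, inner ℝ ((l * e) • v) (X.z t ω) ^ 2
        = l ^ 2 * ∑ t ∈ Finset.range T, inner ℝ v (X.z t ω) ^ 2 := by
      rw [Finset.mul_sum]
      refine Finset.sum_congr rfl fun t _ => ?_
      rw [real_inner_smul_left, mul_pow, mul_pow, he, mul_one]
    simp only [id, e1, e2]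
    have h3 : l ^ 2 * (σ ^ 2 * ∑ t ∈ Finset.range T, inner ℝ v (X.z t ω) ^ 2)
        ≤ l ^ 2 * (σ ^ 2 * q) := by gcongr
    nlinarith
  rw [two_mul (ENNReal.ofReal _)]
  refine (measure_mono ?_).trans ((measure_union_le _ _).trans
    (add_le_add (half 1 (by norm_num)) (half (-1) (by norm_num))))
  rintro ω ⟨h1, h2⟩
  set s := ∑ t ∈ Finset.range T, inner ℝ v (X.z t ω) * X.noise θ t ω
  have h3 : 2 * ℓ ≤ l * |s| := by
    refine le_of_sq_le_sq ?_ (by positivity)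
    rw [mul_pow l, sq_abs]
    calc (2 * ℓ) ^ 2 = l ^ 2 * (2 * σ ^ 2 * q * ℓ) := by linear_combination (-(2 * ℓ)) * hl2
      _ ≤ l ^ 2 * s ^ 2 := by gcongr
  rcases abs_cases s with ⟨hs, _⟩ | ⟨hs, _⟩
  · exact Or.inl ⟨h1, by rw [hs] at h3; simpa using h3⟩
  · exact Or.inr ⟨h1, by rw [hs] at h3; simpa using h3⟩

/-- Complete the square and translate by w / (2b). -/
lemma lintegral_exp_neg_mul_sq_norm_add (d : ℕ) {b : ℝ} (hb : 0 < b) (w : Vec d) :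
    ∫⁻ g : Vec d, ENNReal.ofReal (Real.exp (inner ℝ g w - b * ‖g‖ ^ 2))
      = ENNReal.ofReal ((Real.pi / b) ^ (d / 2 : ℝ) * Real.exp (‖w‖ ^ 2 / (4 * b))) := by
  have h0 : ∫⁻ g : Vec d, ENNReal.ofReal (Real.exp (-b * ‖g‖ ^ 2))
      = ENNReal.ofReal ((Real.pi / b) ^ (d / 2 : ℝ)) := by
    have h1 := GaussianFourier.integral_rexp_neg_mul_sq_norm (V := Vec d) hb
    have hint : Integrable fun g : Vec d => Real.exp (-b * ‖g‖ ^ 2) := by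
      -- A non-integrable function has Bochner integral 0, whereas the Gaussian formula is positive.
      by_contra hc
      rw [integral_undef hc] at h1
      have : 0 < (Real.pi / b) ^ ((Module.finrank ℝ (Vec d) : ℝ) / 2) := by positivity
      linarith
    rw [← ofReal_integral_eq_lintegral_ofReal hint (ae_of_all _ fun _ => (Real.exp_pos _).le), h1]
    simp
  rw [ENNReal.ofReal_mul (by positivity), ← h0,
    ← lintegral_sub_right_eq_self (fun g : Vec d => ENNReal.ofReal (Real.exp (-b * ‖g‖ ^ 2)))
      ((2 * b)⁻¹ • w), ← lintegral_mul_const' _ _ ENNReal.ofReal_ne_top]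
  refine lintegral_congr fun g => ?_
  rw [← ENNReal.ofReal_mul (Real.exp_pos _).le, ← Real.exp_add, norm_sub_sq_real,
    real_inner_smul_right, norm_smul, mul_pow, Real.norm_eq_abs, sq_abs]
  congr 2
  field_simp
  ring

/-- Deviations of the whitened noise. -/
lemma Observations.IsLaw.tail_whitened (h : X.IsLaw σ θ P) (W : Vec d →L[ℝ] Vec d) (T : ℕ)
    {ℓ : ℝ} {A : Set Ω} {N : Ω → Vec d}
    (hN : ∀ ω g, inner ℝ g (N ω) = ∑ t ∈ Finset.range T, inner ℝ (W g) (X.z t ω) * X.noise θ t ω)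
    (hA : ∀ ω ∈ A, ∀ g, ∑ t ∈ Finset.range T, inner ℝ (W g) (X.z t ω) ^ 2 ≤ 5 / 4 * ‖g‖ ^ 2)
    (hA' : ∀ ω ∈ A, 9 / 2 * σ ^ 2 * (d + ℓ) < ‖N ω‖ ^ 2) :
    P A ≤ ENNReal.ofReal (Real.exp (-ℓ)) := by
  rcases eq_or_ne σ 0 with rfl | hσ
  · have h0 : ∀ᵐ ω ∂P, ∀ t, X.noise θ t ω = 0 := ae_all_iff.2 h.noise_eq_zero
    have hz : P A = 0 := by
      refine measure_mono_null ?_ h0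
      intro ω hω (hc : ∀ t, X.noise θ t ω = 0)
      have h1 := hN ω (N ω)
      simp only [hc, mul_zero, Finset.sum_const_zero, real_inner_self_eq_norm_sq] at h1
      have := hA' ω hω
      simp [h1] at this
    rw [hz]; exact zero_le
  have := h.prob
  have hσ' : 0 < (σ : ℝ) := by positivity
  -- Method of mixtures: the exponential martingale in the direction W g / σ, weighted by exp(-‖g‖²
  -- / 2). Its mean over ω and g is the mass (2π)^{d/2} of the weight.
  set F : Ω × Vec d → ℝ≥0∞ := fun p => ENNReal.ofReal (Real.exp
      (∑ t ∈ Finset.range T, inner ℝ ((σ : ℝ)⁻¹ • W p.2) (X.z t p.1) * X.noise θ t p.1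
        - σ ^ 2 / 2 * ∑ t ∈ Finset.range T, inner ℝ ((σ : ℝ)⁻¹ • W p.2) (X.z t p.1) ^ 2))
      * ENNReal.ofReal (Real.exp (-(1 / 2) * ‖p.2‖ ^ 2)) with hF
  have hFm : Measurable F := by
    refine ((measurable_expMartingale X σ θ T).comp
      (g := fun p : Ω × Vec d => ENNReal.ofReal (Real.exp
      (∑ t ∈ Finset.range T, inner ℝ p.2 (X.z t p.1) * X.noise θ t p.1
        - σ ^ 2 / 2 * ∑ t ∈ Finset.range T, inner ℝ p.2 (X.z t p.1) ^ 2)))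
      (f := fun p : Ω × Vec d => (p.1, (σ : ℝ)⁻¹ • W p.2)) (by fun_prop)).mul (by fun_prop)
  have hbase := lintegral_exp_neg_mul_sq_norm_add d (b := 1 / 2) (by norm_num) 0
  simp only [inner_zero_right, zero_sub, norm_zero] at hbase
  refine meas_le_exp_neg (K := ENNReal.ofReal ((Real.pi / (1 / 2)) ^ (d / 2 : ℝ)))
    (f := fun ω => ∫⁻ g, F (ω, g)) hFm.lintegral_prod_right'.aemeasurable ?_ ?_
    ENNReal.ofReal_ne_top ℓ ?_
  · rw [lintegral_lintegral_swap hFm.aemeasurable]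
    refine le_of_eq ?_
    rw [show ENNReal.ofReal ((Real.pi / (1 / 2)) ^ (d / 2 : ℝ))
      = ∫⁻ g : Vec d, ENNReal.ofReal (Real.exp (-(1 / 2 * ‖g‖ ^ 2))) by simpa using hbase.symm]
    refine lintegral_congr fun g => ?_
    simp only [hF]
    rw [lintegral_mul_const' _ _ ENNReal.ofReal_ne_top, h.lintegral_exp, one_mul, neg_mul]
  · simp only [ne_eq, ENNReal.ofReal_eq_zero, not_le]
    positivity
  · intro ω hω
    -- On A the variation costs at most 1/2 · 5/4 · ‖g‖², and the weight a further ‖g‖² / 2; this is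
    -- the 9/8. The Gaussian integral then contains exp(‖N‖² / (9/2 σ²)).
    have hlow : ∫⁻ g : Vec d, ENNReal.ofReal (Real.exp
        (inner ℝ g ((σ : ℝ)⁻¹ • N ω) - 9 / 8 * ‖g‖ ^ 2)) ≤ ∫⁻ g, F (ω, g) := by
      refine lintegral_mono fun g => ?_
      simp only [hF]
      rw [← ENNReal.ofReal_mul (Real.exp_pos _).le, ← Real.exp_add]
      refine ENNReal.ofReal_le_ofReal (Real.exp_le_exp.2 ?_)
      have e1 : ∑ t ∈ Finset.range T, inner ℝ ((σ : ℝ)⁻¹ • W g) (X.z t ω) * X.noise θ t ω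
          = inner ℝ g ((σ : ℝ)⁻¹ • N ω) := by
        rw [real_inner_smul_right, hN, Finset.mul_sum]
        refine Finset.sum_congr rfl fun t _ => ?_
        rw [real_inner_smul_left]; ring
      have e2 : σ ^ 2 / 2 * ∑ t ∈ Finset.range T, inner ℝ ((σ : ℝ)⁻¹ • W g) (X.z t ω) ^ 2
          = 1 / 2 * ∑ t ∈ Finset.range T, inner ℝ (W g) (X.z t ω) ^ 2 := by
        simp_rw [real_inner_smul_left, mul_pow, ← Finset.mul_sum]
        field_simp
      rw [e1, e2]
      have := hA ω hω g
      linarith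
    refine le_trans ?_ hlow
    rw [lintegral_exp_neg_mul_sq_norm_add d (by norm_num), ← ENNReal.ofReal_mul (by positivity)]
    refine ENNReal.ofReal_le_ofReal ?_
    have hpi := Real.pi_pos
    have k1 : (d : ℝ) + ℓ ≤ ‖(σ : ℝ)⁻¹ • N ω‖ ^ 2 / (4 * (9 / 8)) := by
      have := (hA' ω hω).le
      rw [norm_smul, mul_pow, Real.norm_eq_abs, sq_abs, le_div_iff₀ (by norm_num), inv_pow,
        inv_mul_eq_div, le_div_iff₀ (by positivity)]
      linarith
    -- The ratio of the two Gaussian masses is (9/4)^{d/2}, at most e^d; this accounts for d in the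
    -- threshold.
    have k2 : (Real.pi / (1 / 2)) ^ (d / 2 : ℝ)
        ≤ (Real.pi / (9 / 8)) ^ (d / 2 : ℝ) * Real.exp d := by
      have e : Real.exp (d : ℝ) = (Real.exp 2) ^ (d / 2 : ℝ) := by
        rw [← Real.exp_mul]; congr 1; ring
      rw [e, ← Real.mul_rpow (by positivity) (Real.exp_pos _).le]
      refine Real.rpow_le_rpow (by positivity) ?_ (by positivity)
      have := Real.add_one_le_exp (2 : ℝ)
      nlinarith
    calc (Real.pi / (1 / 2)) ^ (d / 2 : ℝ) * Real.exp ℓ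
        ≤ (Real.pi / (9 / 8)) ^ (d / 2 : ℝ) * Real.exp d * Real.exp ℓ := by gcongr
      _ = (Real.pi / (9 / 8)) ^ (d / 2 : ℝ) * Real.exp (d + ℓ) := by rw [Real.exp_add]; ring
      _ ≤ _ := by gcongr

end Tails


/-! ### Upper bound for certainty equivalence -/

section LeastSquares

variable {Ω : Type*} [mΩ : MeasurableSpace Ω] {d dᵤ : ℕ}

lemma eq_zero_of_forall_quadratic_nonneg {p q : ℝ} (hq : 0 ≤ q)
    (h : ∀ s : ℝ, 0 ≤ -2 * s * p + s ^ 2 * q) : p = 0 := by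
  -- Dividing by q + 1 instead of q includes the case q = 0.
  have h1 := h (p / (q + 1))
  have h2 : -2 * (p / (q + 1)) * p + (p / (q + 1)) ^ 2 * q
      = -(p ^ 2 * (q + 2)) / (q + 1) ^ 2 := by
    field_simp; ring
  rw [h2, le_div_iff₀ (by positivity)] at h1
  have h3 : 0 ≤ p ^ 2 * q := by positivity
  exact pow_eq_zero_iff two_ne_zero |>.1 (by nlinarith [sq_nonneg p])

/-- The normal equations of a least-squares estimator. -/
lemma IsLeastSquares.normal_equations {T : ℕ} {θhat : Traj d dᵤ T → Vec d}
    (h : IsLeastSquares θhat) (X : Observations Ω d dᵤ) (θ : Vec d) (ω : Ω) (x : Vec d) :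
    inner ℝ x (op (X.cov T ω) (θhat (X.traj T ω) - θ))
      = ∑ t ∈ Finset.range T, inner ℝ x (X.z t ω) * X.noise θ t ω := by
  set τ := X.traj T ω
  have h1 : ∑ t ∈ Finset.range T, (X.y t ω - inner ℝ (θhat τ) (X.z t ω)) * inner ℝ x (X.z t ω)
      = 0 := by
    refine eq_zero_of_forall_quadratic_nonneg
      (q := ∑ t ∈ Finset.range T, inner ℝ x (X.z t ω) ^ 2)
      (Finset.sum_nonneg fun _ _ => sq_nonneg _) fun s => ?_
    have h2 := h τ (θhat τ + s • x)
    have e : ∀ θ, ∑ t, ((τ t).2.2 - inner ℝ θ (τ t).2.1) ^ 2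
        = ∑ t ∈ Finset.range T, (X.y t ω - inner ℝ θ (X.z t ω)) ^ 2 := fun θ =>
      (Finset.sum_range fun t => (X.y t ω - inner ℝ θ (X.z t ω)) ^ 2).symm
    rw [e, e, ← sub_nonneg, ← Finset.sum_sub_distrib] at h2
    refine h2.trans (le_of_eq ?_)
    rw [Finset.mul_sum, Finset.mul_sum, ← Finset.sum_add_distrib]
    refine Finset.sum_congr rfl fun t _ => ?_
    rw [inner_add_left, real_inner_smul_left]
    ring
  rw [X.inner_op_cov, ← sub_eq_zero, ← Finset.sum_sub_distrib, ← neg_eq_zero, ← h1,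
    ← Finset.sum_neg_distrib]
  refine Finset.sum_congr rfl fun t _ => ?_
  rw [inner_sub_left, Observations.noise]
  ring

variable {M E : Matrix (Fin d) (Fin d) ℝ} {ε : ℝ}

/-- Measuring the deviation against the smallest eigenvalue of E turns an operator norm bound into
the relative bound (1 ± ε) E. -/
lemma abs_inner_op_sub_le (hcon : opNorm (M - E) ≤ ε * lamMin E) (hε : 0 ≤ ε) (x : Vec d) :
    |inner ℝ x (op M x) - inner ℝ x (op E x)| ≤ ε * inner ℝ x (op E x) := by
  have h1 := abs_inner_op_le (M - E) x
  rw [op_sub_apply, inner_sub_right] at h1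
  refine h1.trans ((mul_le_mul_of_nonneg_right hcon (sq_nonneg _)).trans ?_)
  rw [mul_assoc]
  exact mul_le_mul_of_nonneg_left (lamMin_mul_le E x) hε

/-- Let q be the form of M at D. Then q = ⟨V D, N⟩ ≤ ‖V D‖ ‖N‖, while ‖V D‖² is the form of E at D
and is at most 4/3 q. Together q ≤ 4/3 ‖N‖². -/
lemma norm_sq_le_whitened (hcon : opNorm (M - E) ≤ ε * lamMin E) (hε : 0 ≤ ε) (hε' : ε ≤ 1 / 4)
    {c : ℝ} (hE : ∀ x, 0 ≤ inner ℝ x (op E x)) (hc : ∀ x, c * ‖x‖ ^ 2 ≤ inner ℝ x (op M x))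
    {W V : Vec d →L[ℝ] Vec d} (hW : ∀ g, inner ℝ (W g) (op E (W g)) = ‖g‖ ^ 2)
    (hV : ∀ x, W (V x) = x) {N D : Vec d} (hN : ∀ g, inner ℝ g N = inner ℝ (W g) (op M D)) :
    c * ‖D‖ ^ 2 ≤ 4 / 3 * ‖N‖ ^ 2 := by
  refine (hc D).trans ?_
  have h1 := (abs_le.1 (abs_inner_op_sub_le hcon hε D)).1
  have h2 := hN (V D)
  have h3 := hW (V D)
  rw [hV] at h2 h3
  have h4 := real_inner_le_norm (V D) N
  rw [h2] at h4
  have h5 := hE D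
  set q := inner ℝ D (op M D)
  rw [h3] at h1 h5
  have hq : ‖V D‖ ^ 2 ≤ 4 / 3 * q := by nlinarith
  nlinarith [sq_nonneg (‖V D‖ - ‖N‖), sq_nonneg (3 * ‖V D‖ - 4 * ‖N‖), norm_nonneg N,
    norm_nonneg (V D), sq_nonneg (‖V D‖ - 2 * ‖N‖)]

/-- The vector y = E⁻¹ M D - D solves E y = (M - E) D, so the relative concentration bound gives ‖y‖
≤ ε ‖D‖. The rest is (a - b)² ≤ 2a² + 2b² in each direction k_i. The gain is that E⁻¹ k_i is
deterministic and M D is the noise. -/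
lemma inner_op_le_plugin (hEp : E.PosDef) (hlam : 0 < lamMin E)
    (hcon : opNorm (M - E) ≤ ε * lamMin E) (hε : 0 ≤ ε) {H : Matrix (Fin d) (Fin d) ℝ}
    {k : Fin d → Vec d}
    (hk : ∀ x y, inner ℝ x (op H y) = ∑ i, inner ℝ (k i) x * inner ℝ (k i) y)
    (hk' : ∀ N, (H * N).trace = ∑ i, inner ℝ (k i) (op N (k i))) (D : Vec d) :
    inner ℝ D (op H D) ≤ 2 * ∑ i, inner ℝ (op E⁻¹ (k i)) (op M D) ^ 2
      + 2 * H.trace * ε ^ 2 * ‖D‖ ^ 2 := by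
  set y := op E⁻¹ (op M D) - D with hy
  have hEy : op E y = op (M - E) D := by
    rw [hy, map_sub, op_op_inv hEp, op_sub_apply]
  have hyn : ‖y‖ ≤ ε * ‖D‖ := by
    have h1 := lamMin_mul_le E y
    have h2 := real_inner_le_norm y (op E y)
    have h3 : ‖op E y‖ ≤ opNorm (M - E) * ‖D‖ := by rw [hEy]; exact (op (M - E)).le_opNorm D
    have h4 : ‖op E y‖ ≤ ε * lamMin E * ‖D‖ :=
      h3.trans (mul_le_mul_of_nonneg_right hcon (norm_nonneg _))
    rcases (norm_nonneg y).eq_or_lt with h0 | h0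
    · rw [← h0]; positivity
    · have h5 : lamMin E * ‖y‖ ^ 2 ≤ ‖y‖ * (ε * lamMin E * ‖D‖) :=
        h1.trans (h2.trans (mul_le_mul_of_nonneg_left h4 h0.le))
      have h6 : (lamMin E * ‖y‖) * ‖y‖ ≤ (lamMin E * ‖y‖) * (ε * ‖D‖) := by nlinarith
      exact le_of_mul_le_mul_left h6 (by positivity)
  have hinv : (E⁻¹).IsHermitian := hEp.isHermitian.inv
  have hterm : ∀ i, inner ℝ (k i) D * inner ℝ (k i) D
      ≤ 2 * inner ℝ (op E⁻¹ (k i)) (op M D) ^ 2 + 2 * (‖k i‖ ^ 2 * (ε ^ 2 * ‖D‖ ^ 2)) := by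
    intro i
    have e : inner ℝ (k i) D = inner ℝ (op E⁻¹ (k i)) (op M D) - inner ℝ (k i) y := by
      rw [← inner_op_comm hinv, hy, inner_sub_right]; ring
    have h1 : inner ℝ (k i) y ^ 2 ≤ ‖k i‖ ^ 2 * (ε ^ 2 * ‖D‖ ^ 2) := by
      rw [← sq_abs]
      calc |inner ℝ (k i) y| ^ 2 ≤ (‖k i‖ * ‖y‖) ^ 2 := by
            gcongr; exact abs_real_inner_le_norm _ _
        _ ≤ (‖k i‖ * (ε * ‖D‖)) ^ 2 := by gcongr
        _ = _ := by ring
    rw [e]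
    nlinarith [sq_nonneg (inner ℝ (op E⁻¹ (k i)) (op M D) + inner ℝ (k i) y)]
  rw [hk]
  calc ∑ i, inner ℝ (k i) D * inner ℝ (k i) D
      ≤ ∑ i, (2 * inner ℝ (op E⁻¹ (k i)) (op M D) ^ 2 + 2 * (‖k i‖ ^ 2 * (ε ^ 2 * ‖D‖ ^ 2))) :=
        Finset.sum_le_sum fun i _ => hterm i
    _ = _ := by
      rw [Finset.sum_add_distrib, ← Finset.mul_sum, ← Finset.mul_sum, ← Finset.sum_mul,
        trace_eq_sum_norm_sq hk']
      ring

end LeastSquares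


/-! ### Assembly of the upper bound -/

section Upper

variable {Ω : Type*} [mΩ : MeasurableSpace Ω] {d dₐ dᵤ : ℕ}

lemma Observations.idealRisk_div (X : Observations Ω d dᵤ) (P : Measure Ω) {T : ℕ} (hT : 0 < T)
    (H : Matrix (Fin d) (Fin d) ℝ) (hE : IsUnit (X.meanCov P T).det) :
    X.idealRisk H P T / T = (H * (X.meanCov P T)⁻¹).trace := by
  have hT' : (T : ℝ) ≠ 0 := by positivity
  have : Invertible (T : ℝ)⁻¹ := invertibleOfNonzero (inv_ne_zero hT')
  rw [Observations.idealRisk, Observations.Gam, Matrix.inv_smul _ _ hE, Matrix.mul_smul,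
    Matrix.trace_smul, invOf_eq_inv, inv_inv, smul_eq_mul, mul_div_cancel_left₀ _ hT']

/-- The log-determinant is discarded and log 4 ≤ 1.4 ≤ 1.4 d, so 6 · 2.4 < 16 suffices. -/
lemma logComplexity_bounds {δ lam : ℝ} (hδ : 0 < δ) (hδ' : δ < 1) (hd : 1 ≤ d) (hlam : 0 < lam)
    {G : Matrix (Fin d) (Fin d) ℝ} (hG : G.PosSemidef) :
    6 * (d + Real.log (4 / δ)) ≤ 16 * logComplexity δ lam G := by
  have h1 : 0 ≤ Real.log (lam⁻¹ • G + 1).det :=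
    Real.log_nonneg (one_le_det_one_add (hG.smul (inv_pos.2 hlam).le))
  have h2 : Real.log (4 / δ) = Real.log 4 + Real.log (1 / δ) := by
    rw [← Real.log_mul (by norm_num) (by positivity)]; congr 1; ring
  have h3 : Real.log 4 ≤ 1.4 := by
    rw [show (4 : ℝ) = 2 ^ 2 by norm_num, Real.log_pow]
    have := Real.log_two_lt_d9; push_cast; linarith
  have h4 : (1 : ℝ) ≤ d := by exact_mod_cast hd
  have h5 : 0 ≤ Real.log (1 / δ) := Real.log_nonneg (by rw [le_div_iff₀ hδ]; linarith)
  unfold logComplexity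
  linarith

set_option maxHeartbeats 1000000 in
-- Four failure events of probability at most δ/4 each: lack of excitation, lack of concentration, a
-- large deviation in one of the d directions E⁻¹ k_i, and a large whitened noise. Off their union
-- the bound is deterministic.
theorem excessRisk_certaintyEquivalence_le (hd : 1 ≤ d) {σ : ℝ≥0}
    {J : Vec d → Vec dₐ → ℝ} {aopt : Vec d → Vec dₐ} {θ₀ : Vec d} {S : SmoothConstants}
    (hS : SmoothDecision J aopt θ₀ S) {X : Observations Ω d dᵤ} {P : Measure Ω} {T : ℕ}
    {δ lam Tse Tcon Ccon α : ℝ} {Gbar : ℕ → Matrix (Fin d) (Fin d) ℝ}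
    {θhat : Traj d dᵤ T → Vec d} (hδ : 0 < δ) (hδ' : δ < 1 / 2) (law : X.IsLaw σ θ₀ P)
    (reg : X.PolicyRegular P (δ / 4) lam Gbar Tse Tcon Ccon α) (hls : IsLeastSquares θhat)
    (hTcon : Tcon < T) (hTse : Tse < T) (hTC : (4 * Ccon) ^ (1 / α) < T)
    (hTr : 16 * (σ : ℝ) ^ 2 * logComplexity δ lam (Gbar T) / (lam * S.r ^ 2) < T) :
    P {ω | ¬ (excessRisk J (aopt (θhat (X.traj T ω))) θ₀
          ≤ 5 * (σ : ℝ) ^ 2 * Real.log (24 * d / δ)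
              * (X.idealRisk (taskHessian J aopt θ₀) P T / T)
            + 64 * S.Lquad * (σ : ℝ) ^ 3 / lam ^ (3 / 2 : ℝ)
              * logComplexity δ lam (Gbar T) ^ (3 / 2 : ℝ) / (T : ℝ) ^ (3 / 2 : ℝ)
            + 30 * (σ : ℝ) ^ 2 * Ccon ^ 2 * d * (taskHessian J aopt θ₀).trace / lam
              * Real.log (d / δ) / (T : ℝ) ^ (1 + 2 * α))}
        ≤ ENNReal.ofReal δ := by
  have := law.prob
  have hlam := reg.lam_pos
  have hC := reg.Ccon_pos
  have hα := reg.α_pos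
  have hr := hS.r_pos
  have hTpos' : (0 : ℝ) < T := lt_of_le_of_lt (by positivity) hTC
  have hTpos : 0 < T := by exact_mod_cast hTpos'
  have hdR : (1 : ℝ) ≤ d := by exact_mod_cast hd
  set E := X.meanCov P T with hE
  set H := taskHessian J aopt θ₀ with hH
  set ε := Ccon / (T : ℝ) ^ α with hεdef
  have hε0 : 0 ≤ ε := by positivity
  -- With this the random covariance lies between 3/4 E and 5/4 E.
  have hε4 : ε ≤ 1 / 4 := by
    have h1 : 4 * Ccon ≤ (T : ℝ) ^ α := by
      have := Real.rpow_le_rpow (by positivity) hTC.le hα.le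
      rwa [← Real.rpow_mul (by positivity), one_div_mul_cancel hα.ne', Real.rpow_one] at this
    rw [hεdef, div_le_iff₀ (by positivity)]
    linarith
  have hA₁ := reg.excited T hTse.le
  have hA₂ := reg.concentrated T hTcon.le
  set A₁ := {ω | ¬ (lam * T ≤ lamMin (X.cov T ω) ∧ LoewnerLE (X.cov T ω) ((T : ℝ) • Gbar T))}
    with hA₁def
  set A₂ := {ω | ¬ (opNorm (X.cov T ω - E) ≤ ε * lamMin E)} with hA₂def
  -- Excitation concerns the random covariance only. As δ/2 < 1, some ω is good for both hypotheses;
  -- if the eigenvalue of E were nonpositive, the covariance at ω would equal E, contradicting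
  -- excitation.
  have hlamE : 0 < lamMin E := by
    obtain ⟨ω, hω⟩ : ∃ ω, ω ∉ A₁ ∪ A₂ := by
      by_contra! hall
      have h1 : P Set.univ ≤ ENNReal.ofReal (δ / 4) + ENNReal.ofReal (δ / 4) :=
        (measure_mono fun ω _ => hall ω).trans
          ((measure_union_le _ _).trans (add_le_add hA₁ hA₂))
      rw [measure_univ, ← ENNReal.ofReal_add (by positivity) (by positivity),
        ENNReal.one_le_ofReal] at h1
      linarith
    simp only [Set.mem_union, hA₁def, hA₂def, Set.mem_ofPred_eq, not_or, not_not] at hω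
    by_contra! hneg
    have h2 : opNorm (X.cov T ω - E) ≤ 0 := hω.2.trans (mul_nonpos_of_nonneg_of_nonpos hε0 hneg)
    have h3 := hω.1.1
    rw [eq_of_opNorm_sub_nonpos h2] at h3
    have : 0 < lam * T := by positivity
    linarith
  have hEp : E.PosDef := posDef_of_lamMin_pos (X.isHermitian_meanCov P T) hlamE
  obtain ⟨W, V, hW, hV⟩ := exists_whitening hEp
  obtain ⟨k, hk, hk'⟩ := exists_rank_one_sum hS.posSemidef_taskHessian
  have hE0 : ∀ x, 0 ≤ inner ℝ x (op E x) := inner_op_nonneg hEp.posSemidef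
  have hSup : ∀ ω ∉ A₂, ∀ x, ∑ t ∈ Finset.range T, inner ℝ x (X.z t ω) ^ 2
      ≤ 5 / 4 * inner ℝ x (op E x) := by
    intro ω hω x
    simp only [hA₂def, Set.mem_ofPred_eq, not_not] at hω
    have h1 := (abs_le.1 (abs_inner_op_sub_le hω hε0 x)).2
    rw [X.inner_op_cov_self] at h1
    nlinarith [hE0 x]
  -- Two tails in each of d directions, at cost δ / (8d) each, amount to δ/4; the whitened bound has
  -- one tail of cost δ/4.
  set ℓ₁ := Real.log (8 * d / δ) with hℓ₁
  set ℓ₂ := Real.log (4 / δ) with hℓ₂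
  have hℓ₁0 : 0 ≤ ℓ₁ := Real.log_nonneg (by rw [le_div_iff₀ hδ]; linarith)
  have hexp₁ : Real.exp (-ℓ₁) = δ / (8 * d) := by
    rw [hℓ₁, Real.exp_neg, Real.exp_log (by positivity), inv_div]
  have hexp₂ : Real.exp (-ℓ₂) = δ / 4 := by
    rw [hℓ₂, Real.exp_neg, Real.exp_log (by positivity), inv_div]
  set v : Fin d → Vec d := fun i => op E⁻¹ (k i) with hv
  set q : Fin d → ℝ := fun i => 5 / 4 * inner ℝ (v i) (op E (v i)) with hq
  have hq0 : ∀ i, 0 ≤ q i := fun i => mul_nonneg (by norm_num) (hE0 _)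
  set A₃ : Fin d → Set Ω := fun i =>
    {ω | ∑ t ∈ Finset.range T, inner ℝ (v i) (X.z t ω) ^ 2 ≤ q i ∧ 2 * (σ : ℝ) ^ 2 * q i * ℓ₁
      < (∑ t ∈ Finset.range T, inner ℝ (v i) (X.z t ω) * X.noise θ₀ t ω) ^ 2} with hA₃def
  have hA₃ : ∀ i, P (A₃ i) ≤ ENNReal.ofReal (δ / (4 * d)) := by
    intro i
    have h1 := law.tail_direction (v i) T (hq0 i) hℓ₁0
    rw [hexp₁] at h1
    refine h1.trans (le_of_eq ?_)
    rw [show (2 : ℝ≥0∞) = ENNReal.ofReal 2 by simp, ← ENNReal.ofReal_mul (by norm_num)]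
    congr 1
    field_simp
    norm_num
  set N : Ω → Vec d := fun ω =>
    (ContinuousLinearMap.adjoint W) (∑ t ∈ Finset.range T, X.noise θ₀ t ω • X.z t ω) with hNdef
  have hN : ∀ ω g, inner ℝ g (N ω)
      = ∑ t ∈ Finset.range T, inner ℝ (W g) (X.z t ω) * X.noise θ₀ t ω := by
    intro ω g
    rw [hNdef, ContinuousLinearMap.adjoint_inner_right, inner_sum]
    refine Finset.sum_congr rfl fun t _ => ?_
    rw [real_inner_smul_right, mul_comm]
  -- The mixture bound needs the quadratic variation under control pathwise, so the event is
  -- restricted to the complement of `A₂`.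
  set A₄ : Set Ω := {ω | ω ∉ A₂ ∧ 9 / 2 * (σ : ℝ) ^ 2 * (d + ℓ₂) < ‖N ω‖ ^ 2} with hA₄def
  have hA₄ : P A₄ ≤ ENNReal.ofReal (δ / 4) := by
    rw [← hexp₂]
    refine law.tail_whitened W T hN (fun ω hω g => ?_) (fun ω hω => hω.2)
    have := hSup ω hω.1 (W g)
    rwa [hW] at this
  have hbad : P (A₁ ∪ A₂ ∪ (⋃ i, A₃ i) ∪ A₄) ≤ ENNReal.ofReal δ := by
    have h3 : P (⋃ i, A₃ i) ≤ ENNReal.ofReal (δ / 4) := by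
      refine (measure_iUnion_fintype_le P A₃).trans ((Finset.sum_le_sum fun i _ => hA₃ i).trans ?_)
      rw [Finset.sum_const, Finset.card_univ, Fintype.card_fin, nsmul_eq_mul,
        ← ENNReal.ofReal_natCast, ← ENNReal.ofReal_mul (by positivity)]
      refine le_of_eq (congrArg _ ?_)
      field_simp
    calc P (A₁ ∪ A₂ ∪ (⋃ i, A₃ i) ∪ A₄)
        ≤ ENNReal.ofReal (δ / 4) + ENNReal.ofReal (δ / 4) + ENNReal.ofReal (δ / 4)
          + ENNReal.ofReal (δ / 4) :=
        (measure_union_le _ _).trans (add_le_add ((measure_union_le _ _).trans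
          (add_le_add ((measure_union_le _ _).trans (add_le_add hA₁ hA₂)) h3)) hA₄)
      _ = ENNReal.ofReal δ := by
        rw [← ENNReal.ofReal_add (by positivity) (by positivity),
          ← ENNReal.ofReal_add (by positivity) (by positivity),
          ← ENNReal.ofReal_add (by positivity) (by positivity)]
        congr 1; ring
  refine (measure_mono fun ω hω => ?_).trans hbad
  by_contra hgood
  refine hω ?_
  simp only [Set.mem_union, not_or, Set.mem_iUnion, not_exists] at hgood
  obtain ⟨⟨⟨g₁, g₂⟩, g₃⟩, g₄⟩ := hgood
  have hsup := hSup ω g₂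
  have g₄' : ‖N ω‖ ^ 2 ≤ 9 / 2 * (σ : ℝ) ^ 2 * (d + ℓ₂) := by
    by_contra! hc; exact g₄ ⟨g₂, hc⟩
  have g₃' : ∀ i, (∑ t ∈ Finset.range T, inner ℝ (v i) (X.z t ω) * X.noise θ₀ t ω) ^ 2
      ≤ 2 * (σ : ℝ) ^ 2 * q i * ℓ₁ := by
    intro i
    by_contra! hc; exact g₃ i ⟨hsup (v i), hc⟩
  simp only [hA₁def, hA₂def, Set.mem_ofPred_eq, not_not] at g₁ g₂
  set D := θhat (X.traj T ω) - θ₀ with hD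
  have hne := hls.normal_equations X θ₀ ω
  -- the estimation error
  have hDn : ‖D‖ ^ 2 ≤ 6 * (σ : ℝ) ^ 2 * (d + ℓ₂) / (lam * T) := by
    have h1 := norm_sq_le_whitened (c := lam * T) g₂ hε0 hε4 hE0
      (fun x => (mul_le_mul_of_nonneg_right g₁.1 (sq_nonneg _)).trans (lamMin_mul_le _ x)) hW hV
      (N := N ω) (D := D) (fun g => by rw [hN, hne])
    rw [le_div_iff₀ (by positivity)]
    linarith
  have hcomp := logComplexity_bounds hδ (by linarith) hd hlam (reg.Gbar_psd T)
  rw [← hℓ₂] at hcomp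
  set L := logComplexity δ lam (Gbar T) with hL
  have hℓ₂0 : 0 ≤ ℓ₂ := Real.log_nonneg (by rw [le_div_iff₀ hδ]; linarith)
  have hL0 : 0 ≤ L := by linarith
  have hDL : ‖D‖ ^ 2 ≤ 16 * (σ : ℝ) ^ 2 * L / (lam * T) := by
    refine hDn.trans ?_
    gcongr ?_ / _
    nlinarith [sq_nonneg (σ : ℝ)]
  -- The threshold on T with constant 16 places the estimate in the ball where the risk is smooth.
  have hDr : ‖D‖ ≤ S.r := by
    rw [div_lt_iff₀ (by positivity)] at hTr
    refine le_of_sq_le_sq (hDL.trans ?_) hr.le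
    rw [div_le_iff₀ (by positivity)]
    nlinarith
  have hrisk := hS.excessRisk_plugin_le hDr
  rw [← hD] at hrisk
  have hquad := inner_op_le_plugin hEp hlamE g₂ hε0 hk hk' D
  -- The tail bound gives 2 · 5/4 · σ² log(8d/δ) tr(H E⁻¹), which leaves room for the stated 5 and
  -- 24.
  have hlead : ∑ i, inner ℝ (op E⁻¹ (k i)) (op (X.cov T ω) D) ^ 2
      ≤ 5 * (σ : ℝ) ^ 2 * Real.log (24 * d / δ) * (X.idealRisk H P T / T) := by
    rw [X.idealRisk_div P hTpos H hEp.det_pos.ne'.isUnit, hk']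
    have hlog : ℓ₁ ≤ Real.log (24 * d / δ) := Real.log_le_log (by positivity) (by gcongr; norm_num)
    rw [Finset.mul_sum]
    refine Finset.sum_le_sum fun i _ => ?_
    rw [hne]
    refine (g₃' i).trans ?_
    have e : inner ℝ (v i) (op E (v i)) = inner ℝ (k i) (op E⁻¹ (k i)) := by
      rw [hv, op_op_inv hEp, real_inner_comm]
    have h0 := hE0 (v i)
    simp only [hq]
    rw [e] at h0 ⊢
    have h1 : 0 ≤ (σ : ℝ) ^ 2 * inner ℝ (k i) (op E⁻¹ (k i)) := by positivity
    have m₁ := mul_le_mul_of_nonneg_left hlog h1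
    have m₂ := mul_nonneg h1 hℓ₁0
    calc 2 * (σ : ℝ) ^ 2 * (5 / 4 * inner ℝ (k i) (op E⁻¹ (k i))) * ℓ₁
        = 5 / 2 * ((σ : ℝ) ^ 2 * inner ℝ (k i) (op E⁻¹ (k i)) * ℓ₁) := by ring
      _ ≤ 5 * ((σ : ℝ) ^ 2 * inner ℝ (k i) (op E⁻¹ (k i)) * Real.log (24 * d / δ)) := by linarith
      _ = _ := by ring
  -- the cubic term
  have hcubic : ‖D‖ ^ 3 ≤ 64 * (σ : ℝ) ^ 3 / lam ^ (3 / 2 : ℝ) * L ^ (3 / 2 : ℝ)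
      / (T : ℝ) ^ (3 / 2 : ℝ) := by
    have h1 : ‖D‖ ^ 3 = (‖D‖ ^ 2) ^ (3 / 2 : ℝ) := by
      rw [← Real.rpow_natCast, ← Real.rpow_natCast, ← Real.rpow_mul (norm_nonneg _)]
      norm_num
    have h2 : (16 * (σ : ℝ) ^ 2) ^ (3 / 2 : ℝ) = 64 * (σ : ℝ) ^ 3 := by
      rw [show 16 * (σ : ℝ) ^ 2 = (4 * σ) ^ 2 by ring, ← Real.rpow_natCast (4 * (σ : ℝ)) 2,
        ← Real.rpow_mul (by positivity)]
      norm_num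
      ring
    rw [h1]
    refine (Real.rpow_le_rpow (by positivity) hDL (by norm_num)).trans (le_of_eq ?_)
    rw [Real.div_rpow (by positivity) (by positivity), Real.mul_rpow (by positivity) hL0,
      Real.mul_rpow hlam.le hTpos'.le, h2]
    field_simp
  -- the concentration term
  have htr : 0 ≤ H.trace := by
    rw [trace_eq_sum_norm_sq hk']; positivity
  have hconc : H.trace * ε ^ 2 * ‖D‖ ^ 2
      ≤ 30 * (σ : ℝ) ^ 2 * Ccon ^ 2 * d * H.trace / lam * Real.log (d / δ)
        / (T : ℝ) ^ (1 + 2 * α) := by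
    have hlogδ : Real.log 2 ≤ Real.log (1 / δ) :=
      Real.log_le_log (by norm_num) (by rw [le_div_iff₀ hδ]; linarith)
    have hlogd : Real.log (1 / δ) ≤ Real.log (d / δ) :=
      Real.log_le_log (by positivity) (by gcongr)
    have hl2 := Real.log_two_gt_d9
    have e4 : ℓ₂ = 2 * Real.log 2 + Real.log (1 / δ) := by
      rw [show 2 * Real.log 2 = Real.log 4 by
        rw [show (4 : ℝ) = 2 ^ 2 by norm_num, Real.log_pow]; norm_num,
        ← Real.log_mul (by norm_num) (by positivity), hℓ₂]
      congr 1; ring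
    -- Since δ < 1/2, y = log(d/δ) is at least log 2 and ℓ₂ ≤ 3y; then d + 3y ≤ 5dy because 2y ≥ 1.
    have hb : 6 * (d + ℓ₂) ≤ 30 * (d * Real.log (d / δ)) := by
      set y := Real.log (d / δ)
      have h1 : ℓ₂ ≤ 3 * y := by linarith
      have h2 : (0.69 : ℝ) ≤ y := by linarith
      nlinarith [mul_nonneg (sub_nonneg.2 hdR) (by linarith : 0 ≤ y)]
    have e5 : (T : ℝ) ^ (1 + 2 * α) = T * ((T : ℝ) ^ α) ^ 2 := by
      rw [Real.rpow_add hTpos', Real.rpow_one, mul_comm 2 α, Real.rpow_mul hTpos'.le]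
      norm_num
    have h3 : ‖D‖ ^ 2 ≤ (σ : ℝ) ^ 2 * (30 * (d * Real.log (d / δ))) / (lam * T) := by
      refine hDn.trans ?_
      gcongr ?_ / _
      nlinarith [sq_nonneg (σ : ℝ)]
    calc H.trace * ε ^ 2 * ‖D‖ ^ 2
        ≤ H.trace * ε ^ 2 * ((σ : ℝ) ^ 2 * (30 * (d * Real.log (d / δ))) / (lam * T)) := by gcongr
      _ = _ := by rw [e5, hεdef]; field_simp
  have hLq : 0 ≤ S.Lquad := by
    have h1 := hS.LR1_nonneg
    have h2 := hS.LR2_nonneg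
    have h3 := hS.LR3_nonneg
    have h4 := hS.La1_nonneg
    have h5 := hS.La2_nonneg
    have h6 := hS.La3_nonneg hd
    unfold SmoothConstants.Lquad
    positivity
  have hcubic' : S.Lquad * ‖D‖ ^ 3 ≤ 64 * S.Lquad * (σ : ℝ) ^ 3 / lam ^ (3 / 2 : ℝ)
      * L ^ (3 / 2 : ℝ) / (T : ℝ) ^ (3 / 2 : ℝ) :=
    (mul_le_mul_of_nonneg_left hcubic hLq).trans (le_of_eq (by ring))
  linarith

end Upper


/-! ### The likelihood of a trajectory -/

section Likelihood

variable {Ω : Type*} [mΩ : MeasurableSpace Ω] {d dᵤ : ℕ}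

/-- The ratio of the densities of N(a, v) and N(0, v): the one-dimensional Cameron–Martin formula.
-/
lemma lintegral_gaussianReal_shift {v : ℝ≥0} (hv : v ≠ 0) (a : ℝ) {f : ℝ → ℝ≥0∞}
    (hf : Measurable f) :
    ∫⁻ w, f (a + w) ∂(gaussianReal 0 v)
      = ∫⁻ w, f w * ENNReal.ofReal (Real.exp (a * w / v - a ^ 2 / (2 * v))) ∂(gaussianReal 0 v) := by
  have h1 : ∫⁻ w, f (a + w) ∂(gaussianReal 0 v) = ∫⁻ w, f w ∂(gaussianReal a v) := by
    rw [← lintegral_map hf (measurable_const_add a), gaussianReal_map_const_add, zero_add]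
  have hv' : (0 : ℝ) < v := by positivity
  rw [h1, gaussianReal_of_var_ne_zero _ hv, gaussianReal_of_var_ne_zero _ hv,
    lintegral_withDensity_eq_lintegral_mul _ (measurable_gaussianPDF _ _) hf,
    lintegral_withDensity_eq_lintegral_mul _ (measurable_gaussianPDF _ _) (by fun_prop)]
  refine lintegral_congr fun w => ?_
  simp only [Pi.mul_apply, gaussianPDF, gaussianPDFReal]
  rw [mul_comm (f w), ← mul_assoc, ← ENNReal.ofReal_mul (by positivity),
    mul_assoc (√(2 * Real.pi * v))⁻¹, ← Real.exp_add]
  congr 4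
  field_simp
  ring

/-- The linear statistic of a trajectory in the direction `x`. -/
noncomputable def trajLin {T : ℕ} (θ₀ x : Vec d) (τ : Traj d dᵤ T) : ℝ :=
  ∑ t, inner ℝ x (τ t).2.1 * ((τ t).2.2 - inner ℝ θ₀ (τ t).2.1)

/-- The covariance of a trajectory as a bilinear form. -/
noncomputable def trajCov {T : ℕ} (x y : Vec d) (τ : Traj d dᵤ T) : ℝ :=
  ∑ t, inner ℝ x (τ t).2.1 * inner ℝ y (τ t).2.1

/-- The likelihood ratio of the trajectory for the model `θ₀ + η` against the model `θ₀`. -/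
noncomputable def lik {T : ℕ} (σ : ℝ≥0) (θ₀ η : Vec d) (τ : Traj d dᵤ T) : ℝ :=
  Real.exp (trajLin θ₀ η τ / σ ^ 2 - trajCov η η τ / (2 * σ ^ 2))

@[fun_prop]
lemma measurable_trajLin {T : ℕ} (θ₀ : Vec d) :
    Measurable fun p : Vec d × Traj d dᵤ T => trajLin θ₀ p.1 p.2 := by
  unfold trajLin
  fun_prop

@[fun_prop]
lemma measurable_trajCov {T : ℕ} :
    Measurable fun p : (Vec d × Vec d) × Traj d dᵤ T => trajCov p.1.1 p.1.2 p.2 := by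
  unfold trajCov
  fun_prop

lemma measurable_lik {T : ℕ} (σ : ℝ≥0) (θ₀ : Vec d) :
    Measurable fun p : Vec d × Traj d dᵤ T => lik σ θ₀ p.1 p.2 := by
  unfold lik
  have h1 := measurable_trajLin (dᵤ := dᵤ) (T := T) θ₀
  have h2 := (measurable_trajCov (d := d) (dᵤ := dᵤ) (T := T)).comp
    (f := fun p : Vec d × Traj d dᵤ T => ((p.1, p.1), p.2)) (by fun_prop)
  exact ((h1.div_const _).sub (h2.div_const _)).exp

lemma measurable_lik_right {T : ℕ} (σ : ℝ≥0) (θ₀ η : Vec d) :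
    Measurable fun τ : Traj d dᵤ T => lik σ θ₀ η τ :=
  (measurable_lik σ θ₀).comp (f := fun τ : Traj d dᵤ T => (η, τ)) (by fun_prop)

lemma lik_pos {T : ℕ} (σ : ℝ≥0) (θ₀ η : Vec d) (τ : Traj d dᵤ T) : 0 < lik σ θ₀ η τ :=
  Real.exp_pos _

lemma measurable_snoc {T : ℕ} :
    Measurable fun p : Traj d dᵤ T × (Vec dᵤ × Vec d × ℝ) =>
      (Fin.snoc p.1 p.2 : Traj d dᵤ (T + 1)) := by
  refine measurable_pi_lambda _ fun i => ?_
  refine Fin.lastCases ?_ (fun j => ?_) i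
  · simpa using measurable_snd
  · simp only [Fin.snoc_castSucc]
    fun_prop

lemma Observations.traj_succ (X : Observations Ω d dᵤ) (T : ℕ) (ω : Ω) :
    X.traj (T + 1) ω = Fin.snoc (X.traj T ω) (X.u T ω, X.z T ω, X.y T ω) := by
  funext i
  refine Fin.lastCases ?_ (fun j => ?_) i
  · simp [Observations.traj]
  · simp [Observations.traj]

lemma lik_snoc {T : ℕ} (σ : ℝ≥0) (θ₀ η : Vec d) (τ : Traj d dᵤ T) (u : Vec dᵤ) (z : Vec d) (y : ℝ) :
    lik σ θ₀ η (Fin.snoc τ (u, z, y) : Traj d dᵤ (T + 1))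
      = lik σ θ₀ η τ * Real.exp (inner ℝ η z * (y - inner ℝ θ₀ z) / σ ^ 2
          - inner ℝ η z ^ 2 / (2 * σ ^ 2)) := by
  simp only [lik, trajLin, trajCov, Fin.sum_univ_castSucc, Fin.snoc_castSucc, Fin.snoc_last]
  rw [← Real.exp_add]
  congr 1
  ring

/-- The law of the trajectory under `θ₀ + η` has the density `lik` with respect to its law under
`θ₀`. -/
lemma Observations.lintegral_traj_eq {X : Observations Ω d dᵤ} {σ : ℝ≥0} (hσ : σ ≠ 0)
    {P : Vec d → Measure Ω} (hlaw : ∀ θ, X.IsLaw σ θ (P θ)) (hexp : X.SameExploration P)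
    (θ₀ η : Vec d) (T : ℕ) {F : Traj d dᵤ T → ℝ≥0∞} (hF : Measurable F) :
    ∫⁻ ω, F (X.traj T ω) ∂(P (θ₀ + η))
      = ∫⁻ ω, F (X.traj T ω) * ENNReal.ofReal (lik σ θ₀ η (X.traj T ω)) ∂(P θ₀) := by
  have hp := fun θ => (hlaw θ).prob
  induction T with
  | zero =>
    have h0 : ∀ ω, X.traj 0 ω = default := fun ω => Subsingleton.elim _ _
    simp [h0, lik, trajLin, trajCov]
  | succ T ih =>
    obtain ⟨κ, hκ, hmap⟩ := hexp T
    have htraj := X.measurable_traj T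
    have htraj' : Measurable (X.traj T) := htraj.mono (X.ℱ.le T) le_rfl
    have hY : Measurable[X.ℱ T] fun ω => (X.traj T ω, (X.u T ω, X.z T ω)) :=
      htraj.prodMk ((X.u_meas T).prodMk (X.z_meas T))
    have hY' : Measurable fun ω => (X.traj T ω, (X.u T ω, X.z T ω)) := hY.mono (X.ℱ.le T) le_rfl
    set Gθ : Vec d → (Traj d dᵤ T × (Vec dᵤ × Vec d)) × ℝ → ℝ≥0∞ := fun θ p =>
      F (Fin.snoc p.1.1 (p.1.2.1, p.1.2.2, inner ℝ θ p.1.2.2 + p.2)) with hGθ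
    have hGm : ∀ θ, Measurable (Gθ θ) := fun θ =>
      hF.comp (measurable_snoc.comp (f := fun p : (Traj d dᵤ T × (Vec dᵤ × Vec d)) × ℝ =>
        (p.1.1, (p.1.2.1, p.1.2.2, inner ℝ θ p.1.2.2 + p.2))) (by fun_prop))
    have hy : ∀ θ ω, F (X.traj (T + 1) ω)
        = Gθ θ ((X.traj T ω, (X.u T ω, X.z T ω)), X.noise θ T ω) := by
      intro θ ω
      simp only [hGθ, X.traj_succ, Observations.noise, add_sub_cancel]
    set K : Traj d dᵤ T × (Vec dᵤ × Vec d) → ℝ≥0∞ := fun p =>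
      ∫⁻ w, Gθ (θ₀ + η) (p, w) ∂(gaussianReal 0 (σ ^ 2)) with hK
    have hKm : Measurable K := (hGm _).lintegral_prod_right'
    -- The same kernel κ serves all θ, so the choice of input and covariate contributes no factor to
    -- the likelihood.
    have hcomp : ∀ (θ : Vec d) {f : Traj d dᵤ T × (Vec dᵤ × Vec d) → ℝ≥0∞}, Measurable f →
        ∫⁻ ω, f (X.traj T ω, (X.u T ω, X.z T ω)) ∂(P θ)
          = ∫⁻ ω, ∫⁻ x, f (X.traj T ω, x) ∂(κ (X.traj T ω)) ∂(P θ) := by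
      intro θ f hf
      rw [← lintegral_map hf hY', hmap θ, Measure.lintegral_compProd hf,
        lintegral_map (f := fun τ => ∫⁻ x, f (τ, x) ∂(κ τ)) hf.lintegral_kernel_prod_right' htraj']
    have hlik : Measurable fun τ : Traj d dᵤ T => ENNReal.ofReal (lik σ θ₀ η τ) :=
      (measurable_lik_right σ θ₀ η).ennreal_ofReal
    calc ∫⁻ ω, F (X.traj (T + 1) ω) ∂(P (θ₀ + η))
        = ∫⁻ ω, K (X.traj T ω, (X.u T ω, X.z T ω)) ∂(P (θ₀ + η)) := by
          simp_rw [hy (θ₀ + η)]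
          exact (hlaw _).lintegral_noise T hY (hGm _)
      _ = ∫⁻ ω, ∫⁻ x, K (X.traj T ω, x) ∂(κ (X.traj T ω)) ∂(P (θ₀ + η)) := hcomp _ hKm
      _ = ∫⁻ ω, (∫⁻ x, K (X.traj T ω, x) ∂(κ (X.traj T ω)))
            * ENNReal.ofReal (lik σ θ₀ η (X.traj T ω)) ∂(P θ₀) :=
          ih (F := fun τ => ∫⁻ x, K (τ, x) ∂(κ τ)) hKm.lintegral_kernel_prod_right'
      _ = ∫⁻ ω, K (X.traj T ω, (X.u T ω, X.z T ω))
            * ENNReal.ofReal (lik σ θ₀ η (X.traj T ω)) ∂(P θ₀) := by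
          rw [hcomp θ₀ (f := fun p => K p * ENNReal.ofReal (lik σ θ₀ η p.1))
            (hKm.mul (hlik.comp measurable_fst))]
          refine lintegral_congr fun ω => ?_
          exact (lintegral_mul_const' _ _ ENNReal.ofReal_ne_top).symm
      _ = ∫⁻ ω, ∫⁻ w, Gθ θ₀ ((X.traj T ω, (X.u T ω, X.z T ω)), w)
            * ENNReal.ofReal (lik σ θ₀ η (X.traj T ω)
              * Real.exp (inner ℝ η (X.z T ω) * w / σ ^ 2 - inner ℝ η (X.z T ω) ^ 2 / (2 * σ ^ 2)))
            ∂(gaussianReal 0 (σ ^ 2)) ∂(P θ₀) := by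
          refine lintegral_congr fun ω => ?_
          -- Under `θ₀ + η` the response is that of `θ₀` with the noise translated by ⟨η, z_T⟩.
          have hshift := lintegral_gaussianReal_shift (pow_ne_zero 2 hσ) (inner ℝ η (X.z T ω))
            (f := fun w => Gθ θ₀ ((X.traj T ω, (X.u T ω, X.z T ω)), w))
            ((hGm θ₀).comp measurable_prodMk_left)
          have e : K (X.traj T ω, (X.u T ω, X.z T ω)) = ∫⁻ w,
              Gθ θ₀ ((X.traj T ω, (X.u T ω, X.z T ω)), inner ℝ η (X.z T ω) + w)
                ∂(gaussianReal 0 (σ ^ 2)) := by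
            refine lintegral_congr fun w => ?_
            simp only [hGθ, inner_add_left, add_assoc]
          rw [e, hshift, ← lintegral_mul_const' _ _ ENNReal.ofReal_ne_top]
          refine lintegral_congr fun w => ?_
          rw [ENNReal.ofReal_mul (lik_pos _ _ _ _).le, mul_assoc,
            mul_comm (ENNReal.ofReal (lik _ _ _ _))]
          push_cast
          rfl
      _ = ∫⁻ ω, Gθ θ₀ ((X.traj T ω, (X.u T ω, X.z T ω)), X.noise θ₀ T ω)
            * ENNReal.ofReal (lik σ θ₀ η (X.traj T ω)
              * Real.exp (inner ℝ η (X.z T ω) * X.noise θ₀ T ω / σ ^ 2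
                - inner ℝ η (X.z T ω) ^ 2 / (2 * σ ^ 2))) ∂(P θ₀) := by
          refine ((hlaw θ₀).lintegral_noise T hY (F := fun p => Gθ θ₀ p
            * ENNReal.ofReal (lik σ θ₀ η p.1.1 * Real.exp (inner ℝ η p.1.2.2 * p.2 / σ ^ 2
                - inner ℝ η p.1.2.2 ^ 2 / (2 * σ ^ 2)))) ?_).symm
          have hl : Measurable fun p : (Traj d dᵤ T × (Vec dᵤ × Vec d)) × ℝ => lik σ θ₀ η p.1.1 :=
            (measurable_lik_right σ θ₀ η).comp (measurable_fst.comp measurable_fst)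
          exact (hGm θ₀).mul (hl.mul (by fun_prop)).ennreal_ofReal
      _ = _ := by
          refine lintegral_congr fun ω => ?_
          rw [← hy θ₀, X.traj_succ, lik_snoc]
          rfl

end Likelihood


/-! ### The prior and integration by parts -/

section Prior

variable {d : ℕ}

/-- From the exponent 2 on, the positive part is smoothed into a C¹ function; at 0 the slopes are
powers tending to 0. -/
lemma hasDerivAt_max_zero_pow (n : ℕ) (x : ℝ) :
    HasDerivAt (fun x : ℝ => (max 0 x) ^ (n + 2)) ((n + 2) * (max 0 x) ^ (n + 1)) x := by
  rcases lt_trichotomy x 0 with hx | rfl | hx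
  · rw [max_eq_left hx.le, zero_pow (by omega), mul_zero]
    refine (hasDerivAt_const x (0 : ℝ)).congr_of_eventuallyEq ?_
    filter_upwards [Iio_mem_nhds hx] with y hy
    rw [max_eq_left (le_of_lt hy), zero_pow (by omega)]
  · rw [max_self, zero_pow (by omega), mul_zero, hasDerivAt_iff_tendsto_slope]
    have h : Filter.Tendsto (fun y : ℝ => (max 0 y) ^ (n + 1)) (nhdsWithin 0 {0}ᶜ) (nhds 0) := by
      have hc : Continuous fun y : ℝ => (max 0 y) ^ (n + 1) := by fun_prop
      have := hc.tendsto 0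
      simp only [max_self, zero_pow (Nat.succ_ne_zero n)] at this
      exact this.mono_left nhdsWithin_le_nhds
    refine h.congr' ?_
    filter_upwards [self_mem_nhdsWithin] with y hy
    have hy : y ≠ 0 := hy
    rw [slope_def_field, max_self, zero_pow (by omega), sub_zero, sub_zero, pow_succ _ (n + 1)]
    rcases le_total y 0 with h0 | h0
    · simp [max_eq_left h0]
    · rw [max_eq_right h0]; field_simp
  · rw [max_eq_right hx.le]
    have := hasDerivAt_pow (n + 2) x
    push_cast at this
    refine this.congr_of_eventuallyEq ?_
    filter_upwards [Ioi_mem_nhds hx] with y hy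
    rw [max_eq_right (le_of_lt hy)]

/-- The profile of the prior: `ρ² - ‖η‖²` inside the ball of radius `ρ`, and `0` outside. -/
noncomputable def bump (ρ : ℝ) (η : Vec d) : ℝ := max 0 (ρ ^ 2 - ‖η‖ ^ 2)

lemma bump_nonneg (ρ : ℝ) (η : Vec d) : 0 ≤ bump ρ η := le_max_left _ _

@[fun_prop]
lemma continuous_bump (ρ : ℝ) : Continuous fun η : Vec d => bump ρ η := by
  unfold bump; fun_prop

lemma norm_le_of_bump_ne_zero {ρ : ℝ} (hρ : 0 ≤ ρ) {η : Vec d} (h : bump ρ η ≠ 0) : ‖η‖ ≤ ρ := by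
  by_contra! hc
  refine h (max_eq_left ?_)
  nlinarith [norm_nonneg η]

lemma hasCompactSupport_of_bump {ρ : ℝ} (hρ : 0 ≤ ρ) {f : Vec d → ℝ}
    (hf : ∀ η, bump ρ η = 0 → f η = 0) : HasCompactSupport f := by
  refine HasCompactSupport.of_support_subset_isCompact (isCompact_closedBall 0 ρ) fun η hη => ?_
  rw [mem_closedBall_zero_iff]
  exact norm_le_of_bump_ne_zero hρ fun h => hη (hf η h)

lemma integrable_of_bump {ρ : ℝ} (hρ : 0 ≤ ρ) {f : Vec d → ℝ} (hc : Continuous f)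
    (hf : ∀ η, bump ρ η = 0 → f η = 0) : Integrable f :=
  hc.integrable_of_hasCompactSupport (hasCompactSupport_of_bump hρ hf)

lemma hasFDerivAt_bump_pow (ρ : ℝ) (n : ℕ) (η : Vec d) :
    HasFDerivAt (fun η : Vec d => bump ρ η ^ (n + 2))
      (((n + 2) * bump ρ η ^ (n + 1)) • (-((2 : ℝ) • innerSL ℝ η))) η := by
  have h1 : HasFDerivAt (fun η : Vec d => ρ ^ 2 - ‖η‖ ^ 2) (-((2 : ℝ) • innerSL ℝ η)) η := by
    have := (hasStrictFDerivAt_norm_sq η).hasFDerivAt.const_sub (ρ ^ 2)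
    simpa [two_smul] using this
  exact (hasDerivAt_max_zero_pow n _).comp_hasFDerivAt η h1

/-- All products vanish outside a ball: continuity gives integrability, and there is no boundary
term. -/
lemma integral_mul_deriv_eq_neg {ρ : ℝ} (hρ : 0 ≤ ρ) {f f' g g' : Vec d → ℝ} {v : Vec d}
    (hf : Continuous f) (hf' : Continuous f') (hg : Continuous g) (hg' : Continuous g')
    (hg0 : ∀ η, bump ρ η = 0 → g η = 0) (hg0' : ∀ η, bump ρ η = 0 → g' η = 0)
    (hfd : ∀ η, HasLineDerivAt ℝ f (f' η) η v) (hgd : ∀ η, HasLineDerivAt ℝ g (g' η) η v) :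
    ∫ η, f η * g' η = -∫ η, f' η * g η :=
  integral_bilinear_hasLineDerivAt_right_eq_neg_left_of_integrable
    (B := ContinuousLinearMap.mul ℝ ℝ)
    (integrable_of_bump hρ (hf'.mul hg) fun η h => by simp [hg0 η h])
    (integrable_of_bump hρ (hf.mul hg') fun η h => by simp [hg0' η h])
    (integrable_of_bump hρ (hf.mul hg) fun η h => by simp [hg0 η h])
    (fun η _ => hfd η) (fun η _ => hgd η)

/-- Integrate ⟨η, v⟩ by parts against the derivative -2(n+2) b^{n+1} ⟨η, v⟩ of b^{n+2}. This yields
the moments of the prior without polar coordinates. -/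
lemma integral_bump_mul_inner_sq {ρ : ℝ} (hρ : 0 ≤ ρ) (n : ℕ) (v : Vec d) :
    2 * (n + 2) * ∫ η, bump ρ η ^ (n + 1) * inner ℝ η v ^ 2
      = ‖v‖ ^ 2 * ∫ η : Vec d, bump ρ η ^ (n + 2) := by
  have h := integral_mul_deriv_eq_neg hρ (v := v) (f := fun η => inner ℝ η v)
    (f' := fun _ => ‖v‖ ^ 2) (g := fun η => bump ρ η ^ (n + 2))
    (g' := fun η => (n + 2) * bump ρ η ^ (n + 1) * -(2 * inner ℝ η v)) (by fun_prop) (by fun_prop)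
    (by fun_prop) (by fun_prop) (fun η h => by simp [h]) (fun η h => by simp [h])
    (fun η => by
      have h1 : HasFDerivAt (fun η : Vec d => inner ℝ η v) (innerSL ℝ v) η := by
        simpa [real_inner_comm] using (innerSL ℝ v).hasFDerivAt (x := η)
      simpa using h1.hasLineDerivAt v)
    (fun η => by simpa using (hasFDerivAt_bump_pow ρ n η).hasLineDerivAt v)
  rw [integral_const_mul] at h
  have e : (fun η : Vec d => inner ℝ η v * ((n + 2) * bump ρ η ^ (n + 1) * -(2 * inner ℝ η v)))
      = fun η => (-(2 * (n + 2))) * (bump ρ η ^ (n + 1) * inner ℝ η v ^ 2) := by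
    funext η; ring
  rw [e, integral_const_mul] at h
  linarith

/-- Sum the previous identity over coordinates and use b³ = ρ² b² - ‖η‖² b². The ratio of the two
integrals is the size of the prior information. -/
lemma rho_sq_mul_integral_bump_sq {ρ : ℝ} (hρ : 0 ≤ ρ) :
    ρ ^ 2 * ∫ η : Vec d, bump ρ η ^ 2 = (1 + d / 6) * ∫ η : Vec d, bump ρ η ^ 3 := by
  have h1 : ∀ i : Fin d, ∫ η : Vec d, bump ρ η ^ 2 * (η i) ^ 2
      = (∫ η : Vec d, bump ρ η ^ 3) / 6 := by
    intro i
    have := integral_bump_mul_inner_sq hρ 1 (EuclideanSpace.single i (1 : ℝ))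
    simp only [EuclideanSpace.inner_single_right, PiLp.norm_single] at this
    norm_num at this
    linarith
  have hi : ∀ i : Fin d, Integrable fun η : Vec d => bump ρ η ^ 2 * (η i) ^ 2 := fun i =>
    integrable_of_bump hρ (by fun_prop) fun η h => by simp [h]
  have h2 : ∫ η : Vec d, bump ρ η ^ 2 * ‖η‖ ^ 2 = d / 6 * ∫ η : Vec d, bump ρ η ^ 3 := by
    simp_rw [EuclideanSpace.norm_sq_eq, Real.norm_eq_abs, sq_abs, Finset.mul_sum]
    rw [integral_finsetSum _ fun i _ => hi i, Finset.sum_congr rfl fun i _ => h1 i]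
    simp; ring
  have h3 : ∀ η : Vec d, bump ρ η ^ 3 = ρ ^ 2 * bump ρ η ^ 2 - bump ρ η ^ 2 * ‖η‖ ^ 2 := by
    intro η
    rcases le_total (ρ ^ 2 - ‖η‖ ^ 2) 0 with h | h
    · simp [bump, max_eq_left h]
    · simp only [bump, max_eq_right h]; ring
  have h4 : ∫ η : Vec d, bump ρ η ^ 3
      = ρ ^ 2 * (∫ η : Vec d, bump ρ η ^ 2) - ∫ η : Vec d, bump ρ η ^ 2 * ‖η‖ ^ 2 := by
    simp_rw [h3]
    rw [integral_sub, integral_const_mul]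
    · exact integrable_of_bump hρ (by fun_prop) fun η h => by simp [h]
    · exact integrable_of_bump hρ (by fun_prop) fun η h => by simp [h]
  rw [h2] at h4
  linarith

lemma integral_bump_cube_pos {ρ : ℝ} (hρ : 0 < ρ) : 0 < ∫ η : Vec d, bump ρ η ^ 3 := by
  have hc : Continuous fun η : Vec d => bump ρ η ^ 3 := by fun_prop
  refine hc.integral_pos_of_hasCompactSupport_nonneg_nonzero
    (hasCompactSupport_of_bump hρ.le fun η h => by simp [h])
    (fun η => pow_nonneg (bump_nonneg ρ η) 3) (x := 0) ?_
  have : 0 < bump ρ (0 : Vec d) := by simp [bump, hρ.ne']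
  positivity

/-- The identity of van Trees for a density `p` with score `ψ` against the prior `bump ^ 3`. -/
lemma integral_score_eq {F : Type*} [NormedAddCommGroup F] [NormedSpace ℝ F] {ρ : ℝ} (hρ : 0 ≤ ρ)
    (M : F →L[ℝ] F →L[ℝ] ℝ) (A G : Vec d →L[ℝ] F) (q : F) {p : Vec d → ℝ} {ψ : Vec d → Vec d}
    (hp : Continuous p) (hψ : Continuous ψ)
    (hpd : ∀ η, HasFDerivAt p (p η • innerSL ℝ (ψ η)) η) :
    ∫ η, p η * (bump ρ η ^ 2 * M (q - A η) (G (bump ρ η • ψ η - (6 : ℝ) • η)))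
      = (∑ j, M (A (EuclideanSpace.single j 1)) (G (EuclideanSpace.single j 1)))
        * ∫ η, p η * bump ρ η ^ 3 := by
  set e : Fin d → Vec d := fun j => EuclideanSpace.single j (1 : ℝ) with he
  have hparts : ∀ j, ∫ η, M (q - A η) (G (e j))
      * (p η * (bump ρ η ^ 2 * inner ℝ (bump ρ η • ψ η - (6 : ℝ) • η) (e j)))
      = M (A (e j)) (G (e j)) * ∫ η, p η * bump ρ η ^ 3 := by
    intro j
    -- The gradient of p b³ is p b² (b ψ - 6 η), with 6 = 3 · 2 from the cube and the square norm.
    have h := integral_mul_deriv_eq_neg hρ (v := e j) (f := fun η => M (q - A η) (G (e j)))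
      (f' := fun _ => -M (A (e j)) (G (e j))) (g := fun η => p η * bump ρ η ^ 3)
      (g' := fun η => p η * (bump ρ η ^ 2 * inner ℝ (bump ρ η • ψ η - (6 : ℝ) • η) (e j)))
      (by fun_prop) (by fun_prop) (by fun_prop) (by fun_prop) (fun η h => by simp [h])
      (fun η h => by simp [h])
      (fun η => by
        have h1 : HasFDerivAt (fun η : Vec d => M (q - A η) (G (e j)))
            ((M.flip (G (e j))).comp (-A)) η :=
          (M.flip (G (e j))).hasFDerivAt.comp η (A.hasFDerivAt.const_sub q)
        simpa using h1.hasLineDerivAt (e j))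
      (fun η => by
        have h1 := ((hpd η).mul (hasFDerivAt_bump_pow ρ 1 η)).hasLineDerivAt (e j)
        refine h1.congr_deriv ?_
        simp [inner_sub_left, real_inner_smul_left]
        ring)
    rw [h, integral_const_mul]
    ring
  rw [Finset.sum_mul, ← Finset.sum_congr rfl fun j _ => hparts j, ← integral_finsetSum]
  · refine integral_congr_ae (ae_of_all _ fun η => ?_)
    have hw : ∀ w : Vec d, w = ∑ j, inner ℝ w (e j) • e j := fun w => by
      have := ((EuclideanSpace.basisFun (Fin d) ℝ).sum_repr w).symm
      simpa [he, EuclideanSpace.inner_single_right] using this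
    beta_reduce
    set w := bump ρ η • ψ η - (6 : ℝ) • η
    have : M (q - A η) (G w) = ∑ j, inner ℝ w (e j) * M (q - A η) (G (e j)) := by
      conv_lhs => rw [hw w]
      simp [map_sum]
    simp only [this, Finset.mul_sum]
    exact Finset.sum_congr rfl fun j _ => by ring
  · intro j _
    refine integrable_of_bump hρ (by fun_prop) fun η h => by simp [h]

/-- Expanding b M(b x - y, b x - y) ≥ 0 gives b² M(x, y) ≤ b³ M(x, x)/2 + b M(y, y)/2, inserted in
the van Trees identity. The weights are powers of b, so the prior density is never divided by. -/
lemma ofReal_integral_score_le {F : Type*} [NormedAddCommGroup F] [NormedSpace ℝ F] {ρ : ℝ}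
    (hρ : 0 ≤ ρ) {M : F →L[ℝ] F →L[ℝ] ℝ} (hM : ∀ x, 0 ≤ M x x) (hMs : ∀ x y, M x y = M y x)
    (A G : Vec d →L[ℝ] F) (q : F) {p : Vec d → ℝ} {ψ : Vec d → Vec d}
    (hp : Continuous p) (hp0 : ∀ η, 0 ≤ p η) (hψ : Continuous ψ)
    (hpd : ∀ η, HasFDerivAt p (p η • innerSL ℝ (ψ η)) η) :
    ENNReal.ofReal (∑ j, M (A (EuclideanSpace.single j 1)) (G (EuclideanSpace.single j 1)))
        * ∫⁻ η, ENNReal.ofReal (p η * bump ρ η ^ 3)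
      ≤ ∫⁻ η, ENNReal.ofReal (p η * (bump ρ η ^ 3 * (M (q - A η) (q - A η) / 2)
        + bump ρ η / 2 * M (G (bump ρ η • ψ η - (6 : ℝ) • η))
            (G (bump ρ η • ψ η - (6 : ℝ) • η)))) := by
  rw [← ofReal_integral_eq_lintegral_ofReal (integrable_of_bump hρ (by fun_prop)
    fun η h => by simp [h]) (ae_of_all _ fun η =>
      mul_nonneg (hp0 η) (pow_nonneg (bump_nonneg ρ η) 3))]
  rw [← ENNReal.ofReal_mul' (integral_nonneg fun η =>
    mul_nonneg (hp0 η) (pow_nonneg (bump_nonneg ρ η) 3)), ← integral_score_eq hρ M A G q hp hψ hpd]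
  refine (ENNReal.ofReal_le_ofReal (integral_mono (integrable_of_bump hρ (by fun_prop)
    fun η h => by simp [h]) (integrable_of_bump hρ (f := fun η =>
      p η * (bump ρ η ^ 3 * (M (q - A η) (q - A η) / 2)
        + bump ρ η / 2 * M (G (bump ρ η • ψ η - (6 : ℝ) • η))
            (G (bump ρ η • ψ η - (6 : ℝ) • η)))) (by fun_prop)
    fun η h => by simp [h]) fun η => ?_)).trans ?_
  · refine mul_le_mul_of_nonneg_left ?_ (hp0 η)
    set x := q - A η
    set y := G (bump ρ η • ψ η - (6 : ℝ) • η)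
    set u := bump ρ η
    have hu : 0 ≤ u := bump_nonneg ρ η
    have h1 := mul_nonneg hu (hM (u • x - y))
    simp only [map_sub, map_smul, sub_apply, smul_apply, smul_eq_mul, hMs y x] at h1
    nlinarith
  · rw [ofReal_integral_eq_lintegral_ofReal (integrable_of_bump hρ (by fun_prop)
      fun η h => by simp [h]) (ae_of_all _ fun η => mul_nonneg (hp0 η) (add_nonneg
        (mul_nonneg (pow_nonneg (bump_nonneg ρ η) 3) (by have := hM (q - A η); positivity))
        (mul_nonneg (by have := bump_nonneg ρ η; positivity) (hM _))))]

end Prior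


/-! ### The score of a trajectory -/

section Score

variable {Ω : Type*} [mΩ : MeasurableSpace Ω] {d dᵤ : ℕ} {T : ℕ}

/-- The score of the trajectory at the model `θ₀ + η`. -/
noncomputable def trajScore (σ : ℝ≥0) (θ₀ η : Vec d) (τ : Traj d dᵤ T) : Vec d :=
  ((σ : ℝ) ^ 2)⁻¹ • ∑ t, ((τ t).2.2 - inner ℝ (θ₀ + η) (τ t).2.1) • (τ t).2.1

lemma continuous_trajScore (σ : ℝ≥0) (θ₀ : Vec d) (τ : Traj d dᵤ T) :
    Continuous fun η => trajScore σ θ₀ η τ := by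
  unfold trajScore
  fun_prop

lemma measurable_trajScore (σ : ℝ≥0) (θ₀ : Vec d) :
    Measurable fun p : Vec d × Traj d dᵤ T => trajScore σ θ₀ p.1 p.2 := by
  unfold trajScore
  fun_prop

lemma hasFDerivAt_lik {σ : ℝ≥0} (hσ : σ ≠ 0) (θ₀ η : Vec d) (τ : Traj d dᵤ T) :
    HasFDerivAt (fun η => lik σ θ₀ η τ) (lik σ θ₀ η τ • innerSL ℝ (trajScore σ θ₀ η τ)) η := by
  have hσ' : (σ : ℝ) ≠ 0 := by positivity
  have hin : ∀ z : Vec d, HasFDerivAt (fun η : Vec d => inner ℝ η z) (innerSL ℝ z) η := fun z => by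
    simpa [real_inner_comm] using (innerSL ℝ z).hasFDerivAt (x := η)
  have h1 : HasFDerivAt (fun η => trajLin θ₀ η τ / σ ^ 2 - trajCov η η τ / (2 * σ ^ 2))
      (innerSL ℝ (trajScore σ θ₀ η τ)) η := by
    have hsum := HasFDerivAt.fun_sum (u := Finset.univ) (fun t (_ : t ∈ Finset.univ) =>
      (((hin (τ t).2.1).mul_const ((τ t).2.2 - inner ℝ θ₀ (τ t).2.1)).const_mul ((σ : ℝ) ^ 2)⁻¹).sub
        (((hin (τ t).2.1).mul (hin (τ t).2.1)).const_mul (2 * (σ : ℝ) ^ 2)⁻¹))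
    refine (hsum.congr_fderiv ?_).congr_of_eventuallyEq (Filter.Eventually.of_forall fun η' => ?_)
    · ext v
      simp only [trajScore, sum_apply, sub_apply, smul_apply, add_apply, innerSL_apply_apply,
        smul_eq_mul, real_inner_smul_left, sum_inner, inner_add_left, Finset.mul_sum]
      refine Finset.sum_congr rfl fun t _ => ?_
      field_simp
      ring
    · simp only [trajLin, trajCov, Finset.sum_div, ← Finset.sum_sub_distrib]
      refine Finset.sum_congr rfl fun t _ => ?_
      simp only [Pi.sub_apply, Pi.mul_apply]
      field_simp
  exact h1.exp

lemma continuous_lik {σ : ℝ≥0} (hσ : σ ≠ 0) (θ₀ : Vec d) (τ : Traj d dᵤ T) :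
    Continuous fun η => lik σ θ₀ η τ :=
  continuous_iff_continuousAt.2 fun η => (hasFDerivAt_lik hσ θ₀ η τ).continuousAt

/-- The score at `θ₀ + η` is a martingale for the noise of that same model, so its second moment is
a mean covariance. -/
lemma Observations.inner_trajScore (X : Observations Ω d dᵤ) (σ : ℝ≥0) (θ₀ η v : Vec d) (ω : Ω) :
    inner ℝ v (trajScore σ θ₀ η (X.traj T ω))
      = ∑ t ∈ Finset.range T, inner ℝ (((σ : ℝ) ^ 2)⁻¹ • v) (X.z t ω) * X.noise (θ₀ + η) t ω := by
  rw [trajScore, real_inner_smul_right, inner_sum, Finset.mul_sum,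
    Finset.sum_range fun t => inner ℝ (((σ : ℝ) ^ 2)⁻¹ • v) (X.z t ω) * X.noise (θ₀ + η) t ω]
  refine Finset.sum_congr rfl fun t _ => ?_
  rw [real_inner_smul_right, real_inner_smul_left]
  simp only [Observations.traj, Observations.noise]
  ring

/-- The second moment of the score against the prior. -/
lemma Observations.IsLaw.lintegral_score_sq {X : Observations Ω d dᵤ} {σ : ℝ≥0} (hσ : σ ≠ 0)
    {θ₀ η : Vec d} {P : Measure Ω} (h : X.IsLaw σ (θ₀ + η) P) (hz : ∀ t < T, MemLp (X.z t) 2 P)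
    (v : Vec d) (b : ℝ) :
    ∫⁻ ω, ENNReal.ofReal
        (inner ℝ v (b • trajScore σ θ₀ η (X.traj T ω) - (6 : ℝ) • η) ^ 2) ∂P
      = ENNReal.ofReal (36 * inner ℝ η v ^ 2
          + b ^ 2 / σ ^ 2 * inner ℝ v (op (X.meanCov P T) v)) := by
  have hσ' : (σ : ℝ) ≠ 0 := by positivity
  -- The prior part is a constant and the data part a centred martingale, hence their squares add.
  have e : ∀ ω, inner ℝ v (b • trajScore σ θ₀ η (X.traj T ω) - (6 : ℝ) • η)
      = -6 * inner ℝ η v + ∑ t ∈ Finset.range T,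
        inner ℝ ((b / (σ : ℝ) ^ 2) • v) (X.z t ω) * X.noise (θ₀ + η) t ω := by
    intro ω
    rw [inner_sub_right, real_inner_smul_right, real_inner_smul_right, X.inner_trajScore,
      real_inner_comm η v, Finset.mul_sum, sub_eq_neg_add]
    congr 1
    · ring
    · refine Finset.sum_congr rfl fun t _ => ?_
      rw [real_inner_smul_left, real_inner_smul_left]
      ring
  simp_rw [e]
  obtain ⟨hi, hm⟩ := Observations.inner_op_meanCov hz ((b / (σ : ℝ) ^ 2) • v)
  have h0 : 0 ≤ inner ℝ ((b / (σ : ℝ) ^ 2) • v) (op (X.meanCov P T) ((b / (σ : ℝ) ^ 2) • v)) := by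
    rw [hm]; exact integral_nonneg fun ω => Finset.sum_nonneg fun t _ => sq_nonneg _
  rw [h.lintegral_sq, ← ofReal_integral_eq_lintegral_ofReal hi
    (ae_of_all _ fun ω => Finset.sum_nonneg fun t _ => sq_nonneg _), ← hm,
    ← ENNReal.ofReal_mul (by positivity), ← ENNReal.ofReal_add (by positivity) (by positivity)]
  congr 1
  rw [map_smul, real_inner_smul_left, real_inner_smul_right]
  field_simp
  ring

end Score


/-! ### Lower bound for every decision rule -/

section Lower

variable {Ω : Type*} [mΩ : MeasurableSpace Ω] {d dₐ dᵤ : ℕ} {T : ℕ}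

/-- The prior mass of the squared score in the directions `v k`. -/
lemma lintegral_prior_score_le {ρ s B B' Φ : ℝ} (hρ : 0 < ρ) (hs : 0 < s)
    {v : Fin d → Vec d} (hprior : 9 * (1 + d / 6) / ρ ^ 2 * ∑ k, ‖v k‖ ^ 2 ≤ B' * Φ)
    (hB : 0 ≤ B) (hΦ : 0 ≤ Φ) (hBs : B + B' ≤ s) :
    ∫⁻ η : Vec d, ENNReal.ofReal (bump ρ η / 2 *
        (s⁻¹ ^ 2 * (36 * ∑ k, inner ℝ η (v k) ^ 2 + bump ρ η ^ 2 * (B * Φ))))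
      ≤ ENNReal.ofReal (s⁻¹ * Φ / 2) * ∫⁻ η : Vec d, ENNReal.ofReal (bump ρ η ^ 3) := by
  have hb := bump_nonneg (d := d) ρ
  set I := ∫ η : Vec d, bump ρ η ^ 3 with hI
  have hI0 : 0 < I := integral_bump_cube_pos hρ
  have hint3 : Integrable fun η : Vec d => bump ρ η ^ 3 :=
    integrable_of_bump hρ.le (by fun_prop) fun η h => by simp [h]
  have hintk : ∀ k, Integrable fun η : Vec d => bump ρ η ^ 1 * inner ℝ η (v k) ^ 2 := fun k =>
    integrable_of_bump hρ.le (by fun_prop) fun η h => by simp [h]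
  have hI2 := rho_sq_mul_integral_bump_sq (d := d) hρ.le
  rw [← hI] at hI2
  rw [← ofReal_integral_eq_lintegral_ofReal hint3 (ae_of_all _ fun η => pow_nonneg (hb η) 3),
    ← ofReal_integral_eq_lintegral_ofReal
      (integrable_of_bump hρ.le (by fun_prop) fun η h => by simp [h])
      (ae_of_all _ fun η => by
        have h0 := hb η
        have : 0 ≤ ∑ k, inner ℝ η (v k) ^ 2 := Finset.sum_nonneg fun k _ => sq_nonneg _
        show 0 ≤ bump ρ η / 2 * (s⁻¹ ^ 2 * (36 * ∑ k, inner ℝ η (v k) ^ 2 + bump ρ η ^ 2 * (B * Φ)))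
        positivity), ← ENNReal.ofReal_mul (by positivity)]
  refine ENNReal.ofReal_le_ofReal ?_
  have e : ∀ η : Vec d, bump ρ η / 2 *
        (s⁻¹ ^ 2 * (36 * ∑ k, inner ℝ η (v k) ^ 2 + bump ρ η ^ 2 * (B * Φ)))
      = 18 * s⁻¹ ^ 2 * (∑ k, bump ρ η ^ 1 * inner ℝ η (v k) ^ 2)
        + s⁻¹ ^ 2 * (B * Φ) / 2 * bump ρ η ^ 3 := by
    intro η
    rw [← Finset.mul_sum]; ring
  simp_rw [e]
  rw [integral_add ((integrable_finsetSum _ fun k _ => hintk k).const_mul _) (hint3.const_mul _),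
    integral_const_mul, integral_const_mul, integral_finsetSum _ fun k _ => hintk k, ← hI]
  -- Multiplied by 36, this is the prior information 9 (1 + d/6) / ρ² in the direction `v k`.
  have hk : ∀ k, ∫ η : Vec d, bump ρ η ^ 1 * inner ℝ η (v k) ^ 2
      = ‖v k‖ ^ 2 * ((1 + d / 6) / ρ ^ 2 * I / 4) := by
    intro k
    have h1 := integral_bump_mul_inner_sq hρ.le 0 (v k)
    simp only [Nat.cast_zero, zero_add] at h1
    have h2 : ∫ η : Vec d, bump ρ η ^ 2 = (1 + d / 6) / ρ ^ 2 * I := by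
      field_simp
      field_simp at hI2
      linarith
    rw [h2] at h1
    linarith
  rw [Finset.sum_congr rfl fun k _ => hk k, ← Finset.sum_mul]
  have h3 : 18 * (∑ k, ‖v k‖ ^ 2) * ((1 + d / 6) / ρ ^ 2 * I / 4) ≤ B' * Φ * I / 2 := by
    have := mul_le_mul_of_nonneg_right hprior hI0.le
    have e2 : 18 * (∑ k, ‖v k‖ ^ 2) * ((1 + d / 6) / ρ ^ 2 * I / 4)
      = 9 * (1 + d / 6) / ρ ^ 2 * (∑ k, ‖v k‖ ^ 2) * I / 2 := by ring
    rw [e2]; linarith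
  have h4 : (B + B') * (Φ * I) ≤ s * (Φ * I) := mul_le_mul_of_nonneg_right hBs (by positivity)
  calc 18 * s⁻¹ ^ 2 * ((∑ k, ‖v k‖ ^ 2) * ((1 + d / 6) / ρ ^ 2 * I / 4))
        + s⁻¹ ^ 2 * (B * Φ) / 2 * I
      = s⁻¹ ^ 2 * (18 * (∑ k, ‖v k‖ ^ 2) * ((1 + d / 6) / ρ ^ 2 * I / 4) + B * Φ * I / 2) := by ring
    _ ≤ s⁻¹ ^ 2 * (s * (Φ * I) / 2) := by
        refine mul_le_mul_of_nonneg_left ?_ (by positivity)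
        linarith
    _ = s⁻¹ * Φ / 2 * I := by field_simp

/-- The second moment of the score of the prior-weighted likelihood, summed over directions. -/
theorem Observations.IsLaw.lintegral_sum_score_sq_le {θ₀ η : Vec d} {P : Measure Ω}
    {X : Observations Ω d dᵤ} {σ : ℝ≥0} (law : X.IsLaw σ (θ₀ + η) P) (hσ : σ ≠ 0)
    (hz : ∀ t < T, MemLp (X.z t) 2 P) {Γ : Matrix (Fin d) (Fin d) ℝ} {B : ℝ}
    (hcov : ∀ x, inner ℝ x (op (X.meanCov P T) x) / σ ^ 2 ≤ B * inner ℝ x (op Γ x))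
    (hΓ : ∀ x, 0 ≤ inner ℝ x (op Γ x)) (hB : 0 ≤ B) {c b Φ : ℝ} (hc : 0 ≤ c) {ι : Type*} [Fintype ι]
    (v : ι → Vec d) (hΦ : Φ = ∑ i, inner ℝ (v i) (op Γ (v i))) :
    ∫⁻ ω, ENNReal.ofReal (c * ∑ i, inner ℝ (v i)
        (b • trajScore σ θ₀ η (X.traj T ω) - (6 : ℝ) • η) ^ 2) ∂P
      ≤ ENNReal.ofReal (c * (36 * ∑ i, inner ℝ η (v i) ^ 2 + b ^ 2 * (B * Φ))) := by
  have htm : Measurable (X.traj T) := (X.measurable_traj T).mono (X.ℱ.le T) le_rfl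
  have hpair : Measurable fun ω : Ω => (η, X.traj T ω) := by fun_prop
  have hmeasi : ∀ i, Measurable fun ω => ENNReal.ofReal
      (inner ℝ (v i) (b • trajScore σ θ₀ η (X.traj T ω) - (6 : ℝ) • η) ^ 2) := by
    intro i
    have : Measurable fun ω => trajScore σ θ₀ η (X.traj T ω) :=
      (measurable_trajScore σ θ₀).comp (f := fun ω => (η, X.traj T ω)) hpair
    exact ((((this.const_smul b).sub_const _).const_inner).pow_const 2).ennreal_ofReal
  have e : ∀ ω, ENNReal.ofReal (c * ∑ i, inner ℝ (v i)
        (b • trajScore σ θ₀ η (X.traj T ω) - (6 : ℝ) • η) ^ 2)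
      = ENNReal.ofReal c * ∑ i, ENNReal.ofReal (inner ℝ (v i)
        (b • trajScore σ θ₀ η (X.traj T ω) - (6 : ℝ) • η) ^ 2) := fun ω => by
    rw [ENNReal.ofReal_mul hc, ENNReal.ofReal_sum_of_nonneg]
    exact fun i _ => sq_nonneg _
  rw [lintegral_congr e]
  rw [lintegral_const_mul' _ _ ENNReal.ofReal_ne_top, ENNReal.ofReal_mul hc,
    lintegral_finsetSum _ fun i _ => hmeasi i]
  refine mul_le_mul_right ?_ _
  simp_rw [law.lintegral_score_sq hσ hz]
  calc ∑ i, ENNReal.ofReal (36 * inner ℝ η (v i) ^ 2 + b ^ 2 / σ ^ 2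
        * inner ℝ (v i) (op (X.meanCov P T) (v i)))
      ≤ ∑ i, ENNReal.ofReal (36 * inner ℝ η (v i) ^ 2
        + b ^ 2 * (B * inner ℝ (v i) (op Γ (v i)))) := by
        refine Finset.sum_le_sum fun i _ => ENNReal.ofReal_le_ofReal ?_
        have := mul_le_mul_of_nonneg_left (hcov (v i)) (sq_nonneg b)
        rw [← mul_div_assoc] at this
        rw [div_mul_eq_mul_div]
        exact add_le_add le_rfl this
    _ = ENNReal.ofReal (∑ i, (36 * inner ℝ η (v i) ^ 2
        + b ^ 2 * (B * inner ℝ (v i) (op Γ (v i))))) := by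
        rw [ENNReal.ofReal_sum_of_nonneg]
        intro i _
        have := hΓ (v i)
        positivity
    _ = _ := by
        rw [Finset.sum_add_distrib, hΦ, Finset.mul_sum, Finset.mul_sum, Finset.mul_sum]

/-- Averaging over the models: a bound for every trajectory gives a bound for the mean. -/
theorem Observations.mul_lintegral_le_lintegral_traj {X : Observations Ω d dᵤ}
    {P : Vec d → Measure Ω} {σ : ℝ≥0} (hσ : σ ≠ 0) (hlaw : ∀ θ, X.IsLaw σ θ (P θ))
    (hexp : X.SameExploration P) {θ₀ : Vec d} {g : Vec d → ℝ≥0∞} (hg : Measurable g)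
    {K : Vec d → Traj d dᵤ T → ℝ≥0∞} (hK : Measurable fun p : Vec d × Traj d dᵤ T => K p.1 p.2)
    {c : ℝ≥0∞} (hτ : ∀ τ : Traj d dᵤ T, ∫⁻ η, c * (g η * ENNReal.ofReal (lik σ θ₀ η τ))
      ≤ ∫⁻ η, K η τ * ENNReal.ofReal (lik σ θ₀ η τ)) :
    c * ∫⁻ η, g η ≤ ∫⁻ η, ∫⁻ ω, K η (X.traj T ω) ∂(P (θ₀ + η)) := by
  have hprob := fun θ => (hlaw θ).prob
  have htm : Measurable (X.traj T) := (X.measurable_traj T).mono (X.ℱ.le T) le_rfl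
  have hpair : Measurable fun p : Vec d × Ω => (p.1, X.traj T p.2) := by fun_prop
  have hl : Measurable fun p : Vec d × Ω => ENNReal.ofReal (lik σ θ₀ p.1 (X.traj T p.2)) :=
    ((measurable_lik (dᵤ := dᵤ) (T := T) σ θ₀).comp
      (f := fun p : Vec d × Ω => (p.1, X.traj T p.2)) hpair).ennreal_ofReal
  have hl' : ∀ η, Measurable fun ω => ENNReal.ofReal (lik σ θ₀ η (X.traj T ω)) := fun η =>
    ((measurable_lik_right σ θ₀ η).comp htm).ennreal_ofReal
  have hKp : Measurable fun p : Vec d × Ω => K p.1 (X.traj T p.2) :=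
    hK.comp (f := fun p : Vec d × Ω => (p.1, X.traj T p.2)) hpair
  have hKη : ∀ η, Measurable (K η) := fun η =>
    hK.comp (f := fun τ : Traj d dᵤ T => (η, τ)) measurable_prodMk_left
  have hone : ∀ η : Vec d, ∫⁻ ω, ENNReal.ofReal (lik σ θ₀ η (X.traj T ω)) ∂(P θ₀) = 1 := by
    intro η
    have := X.lintegral_traj_eq hσ hlaw hexp θ₀ η T (F := fun _ => 1) measurable_const
    simpa using this.symm
  -- Every integral is moved to the single measure `P θ₀`, where Tonelli applies; no measurability
  -- of θ ↦ P θ is needed.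
  calc c * ∫⁻ η, g η
      = ∫⁻ η, ∫⁻ ω, c * (g η * ENNReal.ofReal (lik σ θ₀ η (X.traj T ω))) ∂(P θ₀) := by
        rw [← lintegral_const_mul _ hg]
        refine lintegral_congr fun η => ?_
        rw [lintegral_const_mul _ ((hl' η).const_mul _), lintegral_const_mul _ (hl' η), hone,
          mul_one]
    _ = ∫⁻ ω, (∫⁻ η, c * (g η * ENNReal.ofReal (lik σ θ₀ η (X.traj T ω)))) ∂(P θ₀) :=
        lintegral_lintegral_swap (((hg.comp measurable_fst).mul hl).const_mul c).aemeasurable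
    _ ≤ ∫⁻ ω, (∫⁻ η, K η (X.traj T ω) * ENNReal.ofReal (lik σ θ₀ η (X.traj T ω))) ∂(P θ₀) :=
        lintegral_mono fun ω => hτ (X.traj T ω)
    _ = ∫⁻ η, ∫⁻ ω, K η (X.traj T ω) * ENNReal.ofReal (lik σ θ₀ η (X.traj T ω)) ∂(P θ₀) :=
        (lintegral_lintegral_swap (hKp.mul hl).aemeasurable).symm
    _ = ∫⁻ η, ∫⁻ ω, K η (X.traj T ω) ∂(P (θ₀ + η)) :=
        lintegral_congr fun η => (X.lintegral_traj_eq hσ hlaw hexp θ₀ η T (hKη η)).symm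

variable {J : Vec d → Vec dₐ → ℝ} {aopt : Vec d → Vec dₐ} {θ₀ : Vec d} {S : SmoothConstants}
  {X : Observations Ω d dᵤ} {P : Vec d → Measure Ω} {σ : ℝ≥0}

set_option maxHeartbeats 400000 in
/-- Bayesian lower bound: a local quadratic problem with the prior `bump ^ 3`. -/
theorem SmoothDecision.le_iSup_lintegral_excessRisk (h : SmoothDecision J aopt θ₀ S) (hd : 1 ≤ d)
    (hσ : σ ≠ 0) (hlaw : ∀ θ, X.IsLaw σ θ (P θ)) (hexp : X.SameExploration P)
    {Γ : Matrix (Fin d) (Fin d) ℝ} (hΓ : Γ.PosDef) {ρ s B B' : ℝ} (hρ : 0 < ρ)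
    (hρr : 4 * ρ ≤ S.r) (hs : 0 < s) (hB : 0 ≤ B) (hBs : B + B' ≤ s)
    (hz : ∀ η : Vec d, ‖η‖ ≤ ρ → ∀ t < T, MemLp (X.z t) 2 (P (θ₀ + η)))
    (hcov : ∀ η : Vec d, ‖η‖ ≤ ρ → ∀ x, inner ℝ x (op (X.meanCov (P (θ₀ + η)) T) x) / σ ^ 2
      ≤ B * inner ℝ x (op Γ x))
    (hprior : ∀ x : Vec d, 9 * (1 + d / 6) / ρ ^ 2 * ‖x‖ ^ 2 ≤ B' * inner ℝ x (op Γ x))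
    (hfar : s⁻¹ * (taskHessian J aopt θ₀ * Γ⁻¹).trace ≤ 2 * S.μ * S.La1 ^ 2 * ρ ^ 2)
    {dec : Traj d dᵤ T → Vec dₐ} (hdec : Measurable dec) :
    ENNReal.ofReal (s⁻¹ * (taskHessian J aopt θ₀ * Γ⁻¹).trace / 2 - S.Lcubic * ρ ^ 3)
      ≤ ⨆ θ ∈ {θ | ‖θ - θ₀‖ ≤ ρ},
          ∫⁻ ω, ENNReal.ofReal (excessRisk J (dec (X.traj T ω)) θ) ∂(P θ) := by
  have hprob := fun θ => (hlaw θ).prob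
  set V := ⨆ θ ∈ {θ | ‖θ - θ₀‖ ≤ ρ},
          ∫⁻ ω, ENNReal.ofReal (excessRisk J (dec (X.traj T ω)) θ) ∂(P θ) with hV
  set H := taskHessian J aopt θ₀ with hH
  set Φ := (H * Γ⁻¹).trace with hΦ
  set M := riskHess J aopt θ₀ with hM
  set A := fderiv ℝ aopt θ₀ with hA
  -- This choice balances the two sides: the trace term is s⁻¹ Φ, and information of total size s
  -- costs s⁻² · s Φ, of which Young's inequality keeps half.
  set G : Vec d →L[ℝ] Vec dₐ := s⁻¹ • A.comp (op Γ⁻¹) with hG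
  obtain ⟨k, hk, hk'⟩ := exists_rank_one_sum h.posSemidef_taskHessian
  set v : Fin d → Vec d := fun i => op Γ⁻¹ (k i) with hv
  have hinv : (Γ⁻¹).IsHermitian := hΓ.isHermitian.inv
  have hΓ0 := inner_op_nonneg hΓ.posSemidef
  have hΦv : Φ = ∑ i, inner ℝ (v i) (op Γ (v i)) := by
    rw [hΦ, hk']
    refine Finset.sum_congr rfl fun i _ => ?_
    rw [hv, op_op_inv hΓ, real_inner_comm]
  have hΦ0 : 0 ≤ Φ := by rw [hΦv]; exact Finset.sum_nonneg fun i _ => hΓ0 _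
  have htrace : ∑ j, M (A (EuclideanSpace.single j 1)) (G (EuclideanSpace.single j 1))
      = s⁻¹ * Φ := by
    rw [hΦ, Matrix.trace, Finset.mul_sum]
    refine Finset.sum_congr rfl fun j _ => ?_
    have e1 : M (A (EuclideanSpace.single j 1)) (G (EuclideanSpace.single j 1))
        = s⁻¹ * inner ℝ (EuclideanSpace.single j (1 : ℝ) : Vec d)
          (op (H * Γ⁻¹) (EuclideanSpace.single j 1)) := by
      rw [op_mul_apply, h.inner_op_taskHessian]
      simp [hG, hM, hA]
    rw [e1, inner_op]
    simp
  have hGw : ∀ w : Vec d, M (G w) (G w) = s⁻¹ ^ 2 * ∑ i, inner ℝ (v i) w ^ 2 := by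
    intro w
    have e1 : M (G w) (G w) = s⁻¹ ^ 2 * inner ℝ (op Γ⁻¹ w) (op H (op Γ⁻¹ w)) := by
      rw [h.inner_op_taskHessian]
      simp [hG, hM, hA]
      ring
    rw [e1, hk]
    congr 1
    refine Finset.sum_congr rfl fun i _ => ?_
    rw [hv, ← inner_op_comm hinv, sq]
  set m := 2 * S.μ * S.La1 ^ 2 * ρ ^ 2 with hm
  set q : Traj d dᵤ T → Vec dₐ := fun τ => dec τ - aopt θ₀ with hq
  -- The loss is quadratic for near decisions and the constant m for far ones; the case depends on
  -- the trajectory alone, so it can be fixed before integrating over η.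
  set R : Vec d → Traj d dᵤ T → ℝ := fun η τ =>
    if ‖q τ‖ ≤ 3 * S.La1 * ρ then M (q τ - A η) (q τ - A η) / 2 else m with hR
  set Y : Vec d → Traj d dᵤ T → ℝ := fun η τ =>
    s⁻¹ ^ 2 * ∑ i, inner ℝ (v i) (bump ρ η • trajScore σ θ₀ η τ - (6 : ℝ) • η) ^ 2 with hY
  set K : Vec d → Traj d dᵤ T → ℝ≥0∞ := fun η τ =>
    ENNReal.ofReal (bump ρ η ^ 3) * ENNReal.ofReal (R η τ)
      + ENNReal.ofReal (bump ρ η / 2) * ENNReal.ofReal (Y η τ) with hK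
  have hb := bump_nonneg (d := d) ρ
  have hm0 : 0 ≤ m := by have := h.μ_pos; positivity
  have hqm : Measurable q := hdec.sub_const _
  have hbm : Measurable fun η : Vec d => bump ρ η := (continuous_bump ρ).measurable
  have hRm : Measurable fun p : Vec d × Traj d dᵤ T => R p.1 p.2 := by
    have hquad : Measurable fun x : Vec dₐ => M x x / 2 :=
      (by fun_prop : Continuous fun x : Vec dₐ => M x x / 2).measurable
    have hx : Measurable fun p : Vec d × Traj d dᵤ T => q p.2 - A p.1 := by fun_prop
    exact Measurable.ite (measurableSet_le (by fun_prop) measurable_const) (hquad.comp hx)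
      measurable_const
  have hYm : Measurable fun p : Vec d × Traj d dᵤ T => Y p.1 p.2 := by
    have := measurable_trajScore (dᵤ := dᵤ) (T := T) σ θ₀
    fun_prop
  have hKm : Measurable fun p : Vec d × Traj d dᵤ T => K p.1 p.2 := by
    simp only [hK]
    fun_prop
  -- the inequality for a fixed trajectory
  have hτ : ∀ τ : Traj d dᵤ T, ∫⁻ η, ENNReal.ofReal (s⁻¹ * Φ)
      * (ENNReal.ofReal (bump ρ η ^ 3) * ENNReal.ofReal (lik σ θ₀ η τ))
      ≤ ∫⁻ η, K η τ * ENNReal.ofReal (lik σ θ₀ η τ) := by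
    intro τ
    by_cases hnear : ‖q τ‖ ≤ 3 * S.La1 * ρ
    · have key := ofReal_integral_score_le hρ.le h.riskHess_nonneg h.riskHess_comm A G (q τ)
        (continuous_lik hσ θ₀ τ) (fun η => (lik_pos σ θ₀ η τ).le) (continuous_trajScore σ θ₀ τ)
        (fun η => hasFDerivAt_lik hσ θ₀ η τ)
      rw [htrace] at key
      rw [lintegral_const_mul' _ _ ENNReal.ofReal_ne_top]
      refine le_trans (le_of_eq ?_) (key.trans (le_of_eq ?_))
      · congr 1
        refine lintegral_congr fun η => ?_
        rw [mul_comm, ENNReal.ofReal_mul (lik_pos σ θ₀ η τ).le]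
      · refine lintegral_congr fun η => ?_
        have hYη : 0 ≤ Y η τ :=
          mul_nonneg (by positivity) (Finset.sum_nonneg fun i _ => sq_nonneg _)
        have hRη : R η τ = M (q τ - A η) (q τ - A η) / 2 := by simp only [hR, if_pos hnear]
        have hR0 : 0 ≤ R η τ := by
          rw [hRη]; have := h.riskHess_nonneg (q τ - A η); positivity
        have hbη := hb η
        rw [← hM, hGw, ← hRη, ENNReal.ofReal_mul (lik_pos σ θ₀ η τ).le,
          ENNReal.ofReal_add (by positivity) (mul_nonneg (by positivity) hYη),
          ENNReal.ofReal_mul (by positivity), ENNReal.ofReal_mul (by positivity), mul_comm]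
    -- For a far decision the loss m already exceeds s⁻¹ Φ pointwise, and no integration by parts is
    -- needed.
    · refine lintegral_mono fun η => ?_
      rw [← mul_assoc, mul_comm (ENNReal.ofReal (s⁻¹ * Φ))]
      refine mul_le_mul_left (le_trans ?_ le_self_add) _
      simp only [hR, if_neg hnear]
      exact mul_le_mul_right (ENNReal.ofReal_le_ofReal hfar) _
  -- the inequality for a fixed model
  have hη : ∀ η : Vec d, ∫⁻ ω, K η (X.traj T ω) ∂(P (θ₀ + η))
      ≤ ENNReal.ofReal (bump ρ η ^ 3) * (V + ENNReal.ofReal (S.Lcubic * ρ ^ 3))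
        + ENNReal.ofReal (bump ρ η / 2 *
        (s⁻¹ ^ 2 * (36 * ∑ i, inner ℝ η (v i) ^ 2 + bump ρ η ^ 2 * (B * Φ)))) := by
    intro η
    -- Outside the ball both sides vanish, so hypotheses on models inside suffice.
    by_cases hb0 : bump ρ η = 0
    · simp [hK, hb0]
    have hηρ := norm_le_of_bump_ne_zero hρ.le hb0
    have hbη := hb η
    have htm : Measurable (X.traj T) := (X.measurable_traj T).mono (X.ℱ.le T) le_rfl
    have hYη : Measurable fun ω => ENNReal.ofReal (Y η (X.traj T ω)) :=
      (hYm.comp (f := fun ω => (η, X.traj T ω)) (by fun_prop)).ennreal_ofReal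
    simp only [hK]
    rw [lintegral_add_right _ (hYη.const_mul _), lintegral_const_mul' _ _ ENNReal.ofReal_ne_top,
      lintegral_const_mul' _ _ ENNReal.ofReal_ne_top]
    refine add_le_add (mul_le_mul_right ?_ _) ?_
    · have hVη : ∫⁻ ω, ENNReal.ofReal (excessRisk J (dec (X.traj T ω)) (θ₀ + η)) ∂(P (θ₀ + η))
          ≤ V := by
        rw [hV]
        exact le_iSup₂_of_le (θ₀ + η) (by simpa using hηρ) le_rfl
      calc ∫⁻ ω, ENNReal.ofReal (R η (X.traj T ω)) ∂(P (θ₀ + η))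
          ≤ ∫⁻ ω, (ENNReal.ofReal (excessRisk J (dec (X.traj T ω)) (θ₀ + η))
              + ENNReal.ofReal (S.Lcubic * ρ ^ 3)) ∂(P (θ₀ + η)) := by
            refine lintegral_mono fun ω => ?_
            by_cases hnear : ‖q (X.traj T ω)‖ ≤ 3 * S.La1 * ρ
            · simp only [hR, if_pos hnear]
              exact (ENNReal.ofReal_le_ofReal (h.le_excessRisk_near hd hρr hηρ hnear)).trans
                ENNReal.ofReal_add_le
            · simp only [hR, if_neg hnear]
              exact (ENNReal.ofReal_le_ofReal
                (h.le_excessRisk_far hρr hηρ (not_le.1 hnear))).trans le_self_add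
        _ = ∫⁻ ω, ENNReal.ofReal (excessRisk J (dec (X.traj T ω)) (θ₀ + η)) ∂(P (θ₀ + η))
              + ENNReal.ofReal (S.Lcubic * ρ ^ 3) := by
            rw [lintegral_add_right _ measurable_const]; simp
        _ ≤ V + ENNReal.ofReal (S.Lcubic * ρ ^ 3) := add_le_add hVη le_rfl
    · rw [ENNReal.ofReal_mul (by positivity)]
      refine mul_le_mul_right ?_ _
      exact (hlaw (θ₀ + η)).lintegral_sum_score_sq_le hσ (hz η hηρ) (hcov η hηρ) hΓ0 hB
        (by positivity) v hΦv
  -- averaging over the prior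
  set I := ∫⁻ η : Vec d, ENNReal.ofReal (bump ρ η ^ 3) with hI
  have hIr : I = ENNReal.ofReal (∫ η : Vec d, bump ρ η ^ 3) :=
    (ofReal_integral_eq_lintegral_ofReal
      (integrable_of_bump hρ.le (by fun_prop) fun η h => by simp [h])
      (ae_of_all _ fun η => pow_nonneg (hb η) 3)).symm
  have hI0 : I ≠ 0 := by
    rw [hIr]; simpa using integral_bump_cube_pos hρ
  have hIt : I ≠ ∞ := by rw [hIr]; exact ENNReal.ofReal_ne_top
  have main : ENNReal.ofReal (s⁻¹ * Φ) * I
      ≤ I * (V + ENNReal.ofReal (S.Lcubic * ρ ^ 3)) + ENNReal.ofReal (s⁻¹ * Φ / 2) * I := by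
    calc ENNReal.ofReal (s⁻¹ * Φ) * I
        ≤ ∫⁻ η, ∫⁻ ω, K η (X.traj T ω) ∂(P (θ₀ + η)) :=
          Observations.mul_lintegral_le_lintegral_traj hσ hlaw hexp (by fun_prop) hKm hτ
      _ ≤ ∫⁻ η, (ENNReal.ofReal (bump ρ η ^ 3) * (V + ENNReal.ofReal (S.Lcubic * ρ ^ 3))
          + ENNReal.ofReal (bump ρ η / 2 *
          (s⁻¹ ^ 2 * (36 * ∑ i, inner ℝ η (v i) ^ 2 + bump ρ η ^ 2 * (B * Φ))))) :=
          lintegral_mono hη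
      _ ≤ _ := by
          rw [lintegral_add_left (by fun_prop), lintegral_mul_const _ (by fun_prop)]
          refine add_le_add le_rfl (lintegral_prior_score_le hρ hs ?_ hB hΦ0 hBs)
          rw [hΦv, Finset.mul_sum, Finset.mul_sum]
          exact Finset.sum_le_sum fun i _ => hprior (v i)
  have main' : ENNReal.ofReal (s⁻¹ * Φ)
      ≤ V + ENNReal.ofReal (S.Lcubic * ρ ^ 3) + ENNReal.ofReal (s⁻¹ * Φ / 2) := by
    rw [mul_comm _ I, mul_comm _ I, ← mul_add] at main
    exact (ENNReal.mul_le_mul_iff_right hI0 hIt).1 main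
  rcases eq_or_ne V ∞ with hVt | hVt
  · rw [hVt]; exact le_top
  rw [← ENNReal.ofReal_toReal hVt] at main' ⊢
  have hL0 : 0 ≤ S.Lcubic * ρ ^ 3 := by
    have := h.La1_nonneg
    have := h.La2_nonneg
    have := h.LR2_nonneg
    have := h.LR3_nonneg
    have := h.Lhess_nonneg hd
    unfold SmoothConstants.Lcubic
    positivity
  rw [← ENNReal.ofReal_add ENNReal.toReal_nonneg hL0, ← ENNReal.ofReal_add (by positivity)
    (by positivity), ENNReal.ofReal_le_ofReal_iff (by positivity)] at main'
  refine ENNReal.ofReal_le_ofReal ?_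
  linarith

end Lower


/-! ### The minimax bound: choice of parameters and small horizons -/

section Minimax

variable {Ω : Type*} [mΩ : MeasurableSpace Ω] {d dₐ dᵤ : ℕ} {T : ℕ}
  {J : Vec d → Vec dₐ → ℝ} {aopt : Vec d → Vec dₐ} {θ₀ : Vec d} {S : SmoothConstants}
  {X : Observations Ω d dᵤ} {P : Vec d → Measure Ω} {σ : ℝ≥0}

/-- Testing coercivity of Γ at Γ⁻¹ k gives lam ‖Γ⁻¹ k‖ ≤ ‖k‖, for each rank-one term of H. -/
lemma trace_mul_inv_le {H Γ : Matrix (Fin d) (Fin d) ℝ} (hH : H.PosSemidef) (hΓ : Γ.PosDef)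
    {lam : ℝ} (hlam : 0 < lam) (hle : ∀ x : Vec d, lam * ‖x‖ ^ 2 ≤ inner ℝ x (op Γ x)) :
    (H * Γ⁻¹).trace ≤ H.trace / lam := by
  obtain ⟨k, -, hk⟩ := exists_rank_one_sum hH
  rw [hk, trace_eq_sum_norm_sq hk, Finset.sum_div]
  refine Finset.sum_le_sum fun i _ => ?_
  have h1 := hle (op Γ⁻¹ (k i))
  rw [op_op_inv hΓ] at h1
  have h2 := real_inner_le_norm (op Γ⁻¹ (k i)) (k i)
  have h3 := real_inner_le_norm (k i) (op Γ⁻¹ (k i))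
  set a := ‖op Γ⁻¹ (k i)‖
  have ha : 0 ≤ a := norm_nonneg _
  have hk0 := norm_nonneg (k i)
  have h4 : lam * a ≤ ‖k i‖ := by
    rcases ha.eq_or_lt with h0 | h0
    · rw [← h0]; simp
    · exact le_of_mul_le_mul_right (by nlinarith) h0
  rw [le_div_iff₀ hlam]
  nlinarith

lemma trace_mul_inv_nonneg {H Γ : Matrix (Fin d) (Fin d) ℝ} (hH : H.PosSemidef) (hΓ : Γ.PosDef) :
    0 ≤ (H * Γ⁻¹).trace := by
  obtain ⟨k, -, hk⟩ := exists_rank_one_sum hH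
  rw [hk]
  exact Finset.sum_nonneg fun i _ => inner_op_nonneg hΓ.inv.posSemidef _

lemma Observations.posDef_Gam (X : Observations Ω d dᵤ) {P : Measure Ω}
    (h : 0 < lamMin (X.Gam P T)) : (X.Gam P T).PosDef := by
  refine posDef_of_lamMin_pos ?_ h
  rw [Observations.Gam, Matrix.IsHermitian, Matrix.conjTranspose_smul, X.isHermitian_meanCov P T]
  simp

/-- Growth and the Hessian bound are compared in a nonzero direction of the derivative of `aopt`; if
there is none, the task Hessian is zero. This provides LR2 / μ ≥ 1 for small horizons. -/
lemma SmoothDecision.μ_le_LR2_or (h : SmoothDecision J aopt θ₀ S) :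
    S.μ ≤ S.LR2 ∨ taskHessian J aopt θ₀ = 0 := by
  by_cases hA : ∃ i : Fin d, fderiv ℝ aopt θ₀ (EuclideanSpace.single i 1) ≠ 0
  · obtain ⟨i, hi⟩ := hA
    left
    set a := fderiv ℝ aopt θ₀ (EuclideanSpace.single i 1)
    have ha : 0 < ‖a‖ := norm_pos_iff.2 hi
    have h1 := h.le_riskHess a
    have h2 : riskHess J aopt θ₀ a a ≤ ‖riskHess J aopt θ₀‖ * ‖a‖ * ‖a‖ :=
      (le_abs_self _).trans ((riskHess J aopt θ₀).le_opNorm₂ a a)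
    have h3 := mul_le_mul_of_nonneg_right h.norm_riskHess_le (sq_nonneg ‖a‖)
    exact le_of_mul_le_mul_right (by nlinarith) (pow_pos ha 2)
  · right
    push Not at hA
    ext i j
    rw [h.taskHessian_apply, hA i]
    simp

/-- The lower bound at a horizon where `lam * T = p ^ 12`, in the regime `3 σ ≤ p`. -/
lemma SmoothDecision.le_iSup_of_large (h : SmoothDecision J aopt θ₀ S) (hd : 1 ≤ d) (hσ : σ ≠ 0)
    (hlaw : ∀ θ, X.IsLaw σ θ (P θ)) (hexp : X.SameExploration P)
    {lam rcov Lcov Ccov ccov α p : ℝ} (hT : 0 < T)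
    (hresp : X.SmoothResponse P θ₀ T lam rcov Lcov Ccov ccov α)
    (hp : 0 < p) (hpT : lam * T = p ^ 12) (hσp : 3 * σ ≤ p)
    (hr : 80 * d / S.r ^ 2 ≤ p ^ 10) (hμ : (σ : ℝ) ^ 2 * S.LR2 / (5 * S.μ) ≤ p ^ 2)
    (hL : 8 * Lcov * √(5 * d) / lam ≤ p ^ 5) (hC : 8 * Ccov ≤ lam * (T : ℝ) ^ α)
    (hrc : 5 * d / rcov ^ 2 ≤ p ^ 10) {dec : Traj d dᵤ T → Vec dₐ} (hdec : Measurable dec) :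
    ENNReal.ofReal ((σ : ℝ) ^ 2 / (1 + 2 * ccov)
        * (X.idealRisk (taskHessian J aopt θ₀) (P θ₀) T / T)
        - S.Lcubic * (√(5 * d) / p ^ 5) ^ 3)
      ≤ ⨆ θ ∈ {θ | ‖θ - θ₀‖ ≤ √(5 * d) / p ^ 5},
          ∫⁻ ω, ENNReal.ofReal (excessRisk J (dec (X.traj T ω)) θ) ∂(P θ) := by
  have hlam := hresp.lam_pos
  have hc := hresp.ccov_pos
  have hT' : (0 : ℝ) < T := by exact_mod_cast hT
  have hσ' : (0 : ℝ) < σ := by positivity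
  have hd' : (1 : ℝ) ≤ d := by exact_mod_cast hd
  have hr0 := h.r_pos
  have hμ0 := h.μ_pos
  set ρ := √(5 * d) / p ^ 5 with hρ
  have hρ0 : 0 < ρ := by positivity
  have hρ2 : ρ ^ 2 = 5 * d / p ^ 10 := by
    rw [hρ, div_pow, Real.sq_sqrt (by positivity)]; ring
  set Γ := X.Gam (P θ₀) T with hΓdef
  have hΓle : ∀ x : Vec d, lam * ‖x‖ ^ 2 ≤ inner ℝ x (op Γ x) := fun x =>
    (mul_le_mul_of_nonneg_right hresp.excited (sq_nonneg _)).trans (lamMin_mul_le _ x)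
  have hΓ : Γ.PosDef := X.posDef_Gam (hlam.trans_le hresp.excited)
  have hH := h.posSemidef_taskHessian
  have hρr : 4 * ρ ≤ S.r := by
    refine (pow_le_pow_iff_left₀ (by positivity) hr0.le two_ne_zero).1 ?_
    rw [mul_pow, hρ2]
    rw [div_le_iff₀ (by positivity)] at hr
    rw [← mul_div_assoc, div_le_iff₀ (by positivity)]
    linarith
  have hρc : ρ ≤ rcov := by
    have := hresp.rcov_pos
    refine (pow_le_pow_iff_left₀ hρ0.le this.le two_ne_zero).1 ?_
    rw [div_le_iff₀ (by positivity)] at hrc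
    rw [hρ2, div_le_iff₀ (by positivity)]
    linarith
  have hLρ : Lcov * ρ ≤ lam / 8 := by
    rw [div_le_iff₀ hlam] at hL
    rw [hρ, ← mul_div_assoc, div_le_iff₀ (by positivity)]
    linarith
  have hCT : Ccov / (T : ℝ) ^ α ≤ lam / 8 := by
    rw [div_le_iff₀ (by positivity)]; linarith
  -- With 9σ² ≤ p² this reduces to 4 + 2d/3 ≤ 5d, true for d ≥ 1; the factor 5 in the radius
  -- provides the room.
  have hB' : 9 * (1 + d / 6) / ρ ^ 2 ≤ T / (4 * σ ^ 2) * lam := by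
    rw [hρ2, div_div_eq_mul_div, div_mul_eq_mul_div, mul_comm (T : ℝ), hpT,
      div_le_div_iff₀ (by positivity) (by positivity)]
    have h1 : (3 * (σ : ℝ)) ^ 2 ≤ p ^ 2 := pow_le_pow_left₀ (by positivity) hσp 2
    have h2 : 9 * (1 + (d : ℝ) / 6) * (4 * σ ^ 2) ≤ p ^ 2 * (5 * d) := by nlinarith
    have := mul_le_mul_of_nonneg_left h2 (by positivity : 0 ≤ p ^ 10)
    linarith
  have hΦle : (taskHessian J aopt θ₀ * Γ⁻¹).trace ≤ d * (S.LR2 * S.La1 ^ 2) / lam :=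
    (trace_mul_inv_le hH hΓ hlam hΓle).trans (by gcongr; exact h.trace_taskHessian_le)
  -- In units of T/σ², the covariance needs `ccov` plus 1/4 (two eighths of `lam`) and the prior
  -- 1/4. The sum s satisfies s⁻¹/2 = σ² / ((1 + 2 ccov) T).
  have key := h.le_iSup_lintegral_excessRisk (P := P) (X := X) hd hσ hlaw hexp hΓ hρ0 hρr
    (s := T * (ccov + 1 / 2) / σ ^ 2) (B := T * (ccov + 1 / 4) / σ ^ 2) (B' := T / (4 * σ ^ 2))
    (by positivity) (by positivity) (le_of_eq (by ring)) (fun η hη => hresp.square_integrable _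
      (by simpa using hη.trans hρc)) (fun η hη x => ?_) (fun x => ?_) ?_ hdec
  · refine le_trans (le_of_eq ?_) key
    congr 2
    rw [Observations.idealRisk, ← hΓdef]
    field_simp
    ring
  · have h1 := inner_op_le_of_loewnerLE (hresp.response (θ₀ + η) (by simpa using hη.trans hρc)) x
    have h2 : inner ℝ x (op (ccov • Γ + (Lcov * ‖η‖ + Ccov / (T : ℝ) ^ α) • 1) x)
        = ccov * inner ℝ x (op Γ x) + (Lcov * ‖η‖ + Ccov / (T : ℝ) ^ α) * ‖x‖ ^ 2 := by
      simp [op, inner_add_right, real_inner_smul_right]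
    have h3 : inner ℝ x (op (X.Gam (P (θ₀ + η)) T) x)
        = (T : ℝ)⁻¹ * inner ℝ x (op (X.meanCov (P (θ₀ + η)) T) x) := by
      simp [op, Observations.Gam, real_inner_smul_right]
    rw [add_sub_cancel_left, h2, h3, inv_mul_le_iff₀ hT'] at h1
    have h4 : (Lcov * ‖η‖ + Ccov / (T : ℝ) ^ α) * ‖x‖ ^ 2 ≤ 1 / 4 * inner ℝ x (op Γ x) := by
      have := mul_le_mul_of_nonneg_left hη hresp.Lcov_pos.le
      have := mul_le_mul_of_nonneg_right
        (by linarith : Lcov * ‖η‖ + Ccov / (T : ℝ) ^ α ≤ lam / 4) (sq_nonneg ‖x‖)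
      linarith [hΓle x]
    rw [div_mul_eq_mul_div]
    refine div_le_div_of_nonneg_right (h1.trans ?_) (by positivity)
    rw [mul_assoc]
    exact mul_le_mul_of_nonneg_left (by linarith) hT'.le
  · refine (mul_le_mul_of_nonneg_right hB' (sq_nonneg _)).trans ?_
    rw [mul_assoc]
    exact mul_le_mul_of_nonneg_left (hΓle x) (by positivity)
  · have hΦ0 := trace_mul_inv_nonneg hH hΓ
    have hs : (T * (ccov + 1 / 2) / (σ : ℝ) ^ 2)⁻¹ ≤ 2 * (σ : ℝ) ^ 2 / T := by
      rw [inv_div, div_le_div_iff₀ (by positivity) hT']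
      have : 0 ≤ (σ : ℝ) ^ 2 * T * ccov := by positivity
      linarith
    refine (mul_le_mul hs hΦle hΦ0 (by positivity)).trans ?_
    rw [div_mul_div_comm, mul_comm (T : ℝ), hpT, hρ2, ← mul_div_assoc,
      div_le_div_iff₀ (by positivity) (by positivity)]
    rw [div_le_iff₀ (by positivity)] at hμ
    have := mul_le_mul_of_nonneg_left hμ (by positivity : 0 ≤ 2 * d * S.La1 ^ 2 * p ^ 10)
    linarith

/-- The lower-order term dominates the leading term when `p < 3 σ` and `lam * T = p ^ 12`. -/
lemma SmoothDecision.leading_le_of_small (h : SmoothDecision J aopt θ₀ S)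
    {lam ccov p : ℝ} (hT : 0 < T) (hlam : 0 < lam) (hc : 0 < ccov)
    (hexc : lam ≤ lamMin (X.Gam (P θ₀) T)) (hp : 0 < p) (hpT : lam * T = p ^ 12)
    (hσp : p < 3 * σ) :
    (σ : ℝ) ^ 2 / (1 + 2 * ccov) * (X.idealRisk (taskHessian J aopt θ₀) (P θ₀) T / T)
      ≤ 1000 * (d * (σ : ℝ) ^ 5 * S.La1 ^ 2 * S.LR2 * (S.LR2 / S.μ) ^ (3 / 2 : ℝ)) / p ^ 15 := by
  have hT' : (0 : ℝ) < T := by exact_mod_cast hT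
  have hLR := h.LR2_nonneg
  have hμ := h.μ_pos
  have hrhs : 0 ≤ 1000 * (d * (σ : ℝ) ^ 5 * S.La1 ^ 2 * S.LR2 * (S.LR2 / S.μ) ^ (3 / 2 : ℝ))
      / p ^ 15 := by positivity
  rcases h.μ_le_LR2_or with hle | h0
  swap
  · simpa [Observations.idealRisk, h0] using hrhs
  have hΓle : ∀ x : Vec d, lam * ‖x‖ ^ 2 ≤ inner ℝ x (op (X.Gam (P θ₀) T) x) := fun x =>
    (mul_le_mul_of_nonneg_right hexc (sq_nonneg _)).trans (lamMin_mul_le _ x)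
  have hΓ := X.posDef_Gam (hlam.trans_le hexc)
  have hH := h.posSemidef_taskHessian
  have hΦ0 : 0 ≤ X.idealRisk (taskHessian J aopt θ₀) (P θ₀) T := trace_mul_inv_nonneg hH hΓ
  have hΦ : X.idealRisk (taskHessian J aopt θ₀) (P θ₀) T / T
      ≤ d * (S.LR2 * S.La1 ^ 2) / p ^ 12 := by
    rw [← hpT, ← div_div]
    exact div_le_div_of_nonneg_right ((trace_mul_inv_le hH hΓ hlam hΓle).trans
      (by gcongr; exact h.trace_taskHessian_le)) hT'.le
  have h1 : 1 ≤ (S.LR2 / S.μ) ^ (3 / 2 : ℝ) :=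
    Real.one_le_rpow ((one_le_div hμ).2 hle) (by norm_num)
  -- Here p³ < 27 σ³, which turns the order p⁻¹² of the leading term into p⁻¹⁵.
  have h2 : p ^ 3 ≤ 1000 * (σ : ℝ) ^ 3 := by
    have := pow_le_pow_left₀ hp.le hσp.le 3
    have : (0 : ℝ) ≤ (σ : ℝ) ^ 3 := by positivity
    linarith
  calc (σ : ℝ) ^ 2 / (1 + 2 * ccov) * (X.idealRisk (taskHessian J aopt θ₀) (P θ₀) T / T)
      ≤ (σ : ℝ) ^ 2 * (d * (S.LR2 * S.La1 ^ 2) / p ^ 12) :=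
        mul_le_mul (div_le_self (by positivity) (by linarith)) hΦ (by positivity) (by positivity)
    _ = d * (S.LR2 * S.La1 ^ 2) * (σ : ℝ) ^ 2 * p ^ 3 / p ^ 15 := by field_simp
    _ ≤ d * (S.LR2 * S.La1 ^ 2) * (σ : ℝ) ^ 2 * (1000 * (σ : ℝ) ^ 3) / p ^ 15 := by gcongr
    _ = 1000 * (d * (σ : ℝ) ^ 5 * S.La1 ^ 2 * S.LR2 * 1) / p ^ 15 := by ring
    _ ≤ _ := by gcongr

/-- The local minimax lower bound for every decision rule. -/
theorem SmoothDecision.ofReal_le_minimaxRisk (h : SmoothDecision J aopt θ₀ S) (hd : 1 ≤ d)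
    (hlaw : ∀ θ, X.IsLaw σ θ (P θ)) (hexp : X.SameExploration P)
    {lam rcov Lcov Ccov ccov α : ℝ}
    (hresp : X.SmoothResponse P θ₀ T lam rcov Lcov Ccov ccov α)
    (hr : (80 * d / S.r ^ 2) ^ (6 / 5 : ℝ) ≤ lam * T)
    (hμ : ((σ : ℝ) ^ 2 * S.LR2 / (5 * S.μ)) ^ 6 ≤ lam * T)
    (hL : (8 * Lcov * √(5 * d) / lam) ^ (12 / 5 : ℝ) ≤ lam * T)
    (hC : (8 * Ccov / lam ^ (1 - α)) ^ (1 / α) ≤ lam * T)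
    (hrc : (5 * d / rcov ^ 2) ^ (6 / 5 : ℝ) ≤ lam * T) :
    ENNReal.ofReal ((σ : ℝ) ^ 2 / (1 + 2 * ccov)
          * (X.idealRisk (taskHessian J aopt θ₀) (P θ₀) T / T)
        - 1000 * lowerConst d σ S / (lam * T) ^ (5 / 4 : ℝ))
      ≤ X.minimaxRisk P J T {θ | ‖θ - θ₀‖ ^ 2 ≤ 5 * d / (lam * T) ^ (5 / 6 : ℝ)} := by
  have hlam := hresp.lam_pos
  have hα := hresp.α_pos
  have hr0 := h.r_pos
  have hμ0 := h.μ_pos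
  have hLR := h.LR2_nonneg
  have hd' : (1 : ℝ) ≤ d := by exact_mod_cast hd
  have hx : 0 < lam * T := lt_of_lt_of_le (by positivity) hr
  have hT' : (0 : ℝ) < T := pos_of_mul_pos_right hx hlam.le
  have hT : 0 < T := by exact_mod_cast hT'
  have hroot : ∀ {a q : ℝ}, 0 ≤ a → 0 < q → a ^ q ≤ lam * T → a ≤ (lam * T) ^ q⁻¹ :=
    fun ha hq hle => (Real.le_rpow_inv_iff_of_pos ha hx.le hq).2 hle
  have hC' : 8 * Ccov ≤ lam * (T : ℝ) ^ α := by
    have h1 := hroot (by have := hresp.Ccov_pos; positivity) (by positivity) hC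
    rw [one_div, inv_inv, Real.mul_rpow hlam.le hT'.le, div_le_iff₀ (by positivity)] at h1
    refine h1.trans (le_of_eq ?_)
    rw [mul_right_comm, ← Real.rpow_add hlam]
    simp
  -- A twelfth root makes integer powers of all the exponents involved.
  set p := (lam * T) ^ (1 / 12 : ℝ) with hpdef
  have hp : 0 < p := by positivity
  have hpow : ∀ (n : ℕ) (q : ℝ), q = n / 12 → (lam * T) ^ q = p ^ n := by
    intro n q hq
    rw [hpdef, ← Real.rpow_natCast, ← Real.rpow_mul hx.le, hq]
    congr 1; ring
  have hpT : lam * T = p ^ 12 := by rw [← hpow 12 1 (by norm_num), Real.rpow_one]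
  have hr' : 80 * d / S.r ^ 2 ≤ p ^ 10 := by
    rw [← hpow 10 ((6 / 5 : ℝ)⁻¹) (by norm_num)]
    exact hroot (by positivity) (by norm_num) hr
  have hrc' : 5 * d / rcov ^ 2 ≤ p ^ 10 := by
    rw [← hpow 10 ((6 / 5 : ℝ)⁻¹) (by norm_num)]
    exact hroot (by positivity) (by norm_num) hrc
  have hL' : 8 * Lcov * √(5 * d) / lam ≤ p ^ 5 := by
    rw [← hpow 5 ((12 / 5 : ℝ)⁻¹) (by norm_num)]
    exact hroot (by have := hresp.Lcov_pos; positivity) (by norm_num) hL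
  have hμ' : (σ : ℝ) ^ 2 * S.LR2 / (5 * S.μ) ≤ p ^ 2 := by
    rw [hpT, show p ^ 12 = (p ^ 2) ^ 6 by ring] at hμ
    exact le_of_pow_le_pow_left₀ (by norm_num) (by positivity) hμ
  rw [hpow 15 (5 / 4) (by norm_num), hpow 10 (5 / 6) (by norm_num)]
  have hLa1 := h.La1_nonneg
  have hLa2 := h.La2_nonneg
  have hLR3 := h.LR3_nonneg
  have hLh := h.Lhess_nonneg hd
  rcases lt_or_ge p (3 * σ) with hσp | hσp
  · have h1 := h.leading_le_of_small (P := P) (X := X) hT hlam hresp.ccov_pos hresp.excited hp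
      hpT hσp
    have h2 : 1000 * (d * (σ : ℝ) ^ 5 * S.La1 ^ 2 * S.LR2 * (S.LR2 / S.μ) ^ (3 / 2 : ℝ)) / p ^ 15
        ≤ 1000 * lowerConst d σ S / p ^ 15 := by
      gcongr
      rw [lowerConst]
      exact le_add_of_nonneg_left (by positivity)
    rw [ENNReal.ofReal_of_nonpos (by linarith)]
    exact zero_le
  have hlow : S.Lcubic * (√(5 * d) / p ^ 5) ^ 3 ≤ 1000 * lowerConst d σ S / p ^ 15 := by
    have e1 : (d : ℝ) ^ (3 / 2 : ℝ) = √d ^ 3 := by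
      rw [Real.sqrt_eq_rpow, ← Real.rpow_natCast, ← Real.rpow_mul (by positivity)]
      norm_num
    have e2 : √5 ^ 3 ≤ 12 := by
      have h5 : √5 ^ 2 = 5 := Real.sq_sqrt (by norm_num)
      have : √5 ≤ 12 / 5 := Real.sqrt_le_iff.2 ⟨by norm_num, by norm_num⟩
      rw [pow_succ, h5]; linarith
    rw [div_pow, ← pow_mul, ← mul_div_assoc]
    refine div_le_div_of_nonneg_right ?_ (by positivity)
    rw [Real.sqrt_mul (by norm_num), mul_pow, lowerConst, e1]
    have h3 : 0 ≤ d * (σ : ℝ) ^ 5 * S.La1 ^ 2 * S.LR2 * (S.LR2 / S.μ) ^ (3 / 2 : ℝ) := by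
      positivity
    have h4 : S.Lcubic * √5 ^ 3
        ≤ 1000 * (S.La1 * S.La2 * S.LR2 + S.La1 ^ 3 * S.LR3 + S.La1 ^ 2 * S.Lhess) := by
      have : 0 ≤ S.Lcubic := by unfold SmoothConstants.Lcubic; positivity
      refine (mul_le_mul_of_nonneg_left e2 this).trans ?_
      have t₁ : 0 ≤ S.La1 * S.La2 * S.LR2 := by positivity
      have t₂ : 0 ≤ S.La1 ^ 3 * S.LR3 := by positivity
      have t₃ : 0 ≤ S.La1 ^ 2 * S.Lhess := by positivity
      unfold SmoothConstants.Lcubic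
      linarith
    have := mul_le_mul_of_nonneg_right h4 (by positivity : 0 ≤ √(d : ℝ) ^ 3)
    linarith
  -- Without noise there is no likelihood, but the leading term is zero as well.
  rcases eq_or_ne σ 0 with rfl | hσ
  · have h0 : 0 ≤ 1000 * lowerConst d ((0 : ℝ≥0) : ℝ) S / p ^ 15 := by
      unfold lowerConst; positivity
    rw [ENNReal.ofReal_of_nonpos (by simpa using h0)]
    exact zero_le
  have hset : {θ : Vec d | ‖θ - θ₀‖ ^ 2 ≤ 5 * d / p ^ 10} = {θ | ‖θ - θ₀‖ ≤ √(5 * d) / p ^ 5} := by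
    ext θ
    have e : 5 * d / p ^ 10 = (√(5 * d) / p ^ 5) ^ 2 := by
      rw [div_pow, Real.sq_sqrt (by positivity)]; ring
    rw [Set.mem_ofPred_eq, Set.mem_ofPred_eq, e,
      pow_le_pow_iff_left₀ (norm_nonneg _) (by positivity) two_ne_zero]
  rw [hset, Observations.minimaxRisk]
  refine le_iInf₂ fun dec hdec => ?_
  refine le_trans (ENNReal.ofReal_le_ofReal (by linarith)) (h.le_iSup_of_large hd hσ hlaw hexp hT
    hresp hp hpT hσp hr' hμ' hL' hC' hrc' hdec)

end Minimax

end MDM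

/-! ### Both bounds with explicit universal constants -/

theorem theorem1 :
    ∃ c₁ c₂ c₃ c₄ : ℝ, 0 < c₁ ∧ 0 < c₂ ∧ 0 < c₃ ∧ 0 < c₄ ∧
    ∀ (d dₐ dᵤ : ℕ) (_ : 1 ≤ d) (σ : ℝ≥0) (γ : ℝ)
      (J : MDM.Vec d → MDM.Vec dₐ → ℝ) (aopt : MDM.Vec d → MDM.Vec dₐ) (θ₀ : MDM.Vec d)
      (S : MDM.SmoothConstants) (_ : MDM.SmoothDecision J aopt θ₀ S)
      (Ω : Type*) (_ : MeasurableSpace Ω) (X : MDM.Observations Ω d dᵤ)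
      (P : MDM.Vec d → Measure Ω) (T : ℕ),
    -- upper bound for certainty equivalence
    (∀ (δ lam Tse Tcon Ccon α : ℝ) (Gbar : ℕ → Matrix (Fin d) (Fin d) ℝ)
        (θhat : MDM.Traj d dᵤ T → MDM.Vec d),
      0 < δ → δ < 1 / 2 →
      X.IsLaw σ θ₀ (P θ₀) →
      X.PowerBound (P θ₀) T γ →
      X.PolicyRegular (P θ₀) (δ / 4) lam Gbar Tse Tcon Ccon α →
      MDM.IsLeastSquares θhat →
      Tcon < T → Tse < T → (4 * Ccon) ^ (1 / α) < T →
      c₁ * (σ : ℝ) ^ 2 * MDM.logComplexity δ lam (Gbar T) / (lam * S.r ^ 2) < T →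
      (P θ₀) {ω | ¬ (MDM.excessRisk J (aopt (θhat (X.traj T ω))) θ₀
          ≤ 5 * (σ : ℝ) ^ 2 * Real.log (24 * d / δ)
              * (X.idealRisk (MDM.taskHessian J aopt θ₀) (P θ₀) T / T)
            + c₂ * S.Lquad * (σ : ℝ) ^ 3 / lam ^ (3 / 2 : ℝ)
              * MDM.logComplexity δ lam (Gbar T) ^ (3 / 2 : ℝ) / (T : ℝ) ^ (3 / 2 : ℝ)
            + c₃ * (σ : ℝ) ^ 2 * Ccon ^ 2 * d * (MDM.taskHessian J aopt θ₀).trace / lam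
              * Real.log (d / δ) / (T : ℝ) ^ (1 + 2 * α))}
        ≤ ENNReal.ofReal δ)
    ∧
    -- lower bound for every decision rule
    (∀ lam rcov Lcov Ccov ccov α : ℝ,
      (∀ θ, X.IsLaw σ θ (P θ)) →
      X.SameExploration P →
      (∀ θ, X.PowerBound (P θ) T γ) →
      X.SmoothResponse P θ₀ T lam rcov Lcov Ccov ccov α →
      (80 * d / S.r ^ 2) ^ (6 / 5 : ℝ) ≤ lam * T →
      ((σ : ℝ) ^ 2 * S.LR2 / (5 * S.μ)) ^ 6 ≤ lam * T →
      (8 * Lcov * √(5 * d) / lam) ^ (12 / 5 : ℝ) ≤ lam * T →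
      (8 * Ccov / lam ^ (1 - α)) ^ (1 / α) ≤ lam * T →
      (5 * d / rcov ^ 2) ^ (6 / 5 : ℝ) ≤ lam * T →
      ENNReal.ofReal
          ((σ : ℝ) ^ 2 / (1 + 2 * ccov)
              * (X.idealRisk (MDM.taskHessian J aopt θ₀) (P θ₀) T / T)
            - c₄ * MDM.lowerConst d σ S / (lam * T) ^ (5 / 4 : ℝ))
        ≤ X.minimaxRisk P J T {θ | ‖θ - θ₀‖ ^ 2 ≤ 5 * d / (lam * T) ^ (5 / 6 : ℝ)}) := by
  refine ⟨16, 64, 30, 1000, by norm_num, by norm_num, by norm_num, by norm_num, ?_⟩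
  intro d dₐ dᵤ hd σ γ J aopt θ₀ S hS Ω _ X P T
  refine ⟨?_, ?_⟩
  · intro δ lam Tse Tcon Ccon α Gbar θhat hδ hδ' law _ reg hls hTcon hTse hTC hTr
    exact MDM.excessRisk_certaintyEquivalence_le hd hS hδ hδ' law reg hls hTcon hTse hTC hTr
  · intro lam rcov Lcov Ccov ccov α hlaw hexp _ hresp hr hμ hL hC hrc
    exact hS.ofReal_le_minimaxRisk hd hlaw hexp hresp hr hμ hL hC hrc
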